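/- Let $m\ge 1$. Let $\sigma_1,\ldots,\sigma_m$ be finite Borel measures on $\mathbb{R}$, each of constant sign (positive or negative), each with compact support consisting of infinitely many points. Let $\Delta_j$ be the smallest interval containing $\operatorname{supp}\sigma_j$, and assume $\Delta_j\cap\Delta_{j+1}=\emptyset$ for $j=1,\ldots,m-1$. For a measure $s$ write $\widehat{s}(z)=\int \frac{ds(x)}{z-x}$, and for two measures put $d\langle \alpha,\beta\rangle(x)=\widehat{\beta}(x)\,d\alpha(x)$. Let $s_{1,1}=\sigma_1$ and $s_{1,k}=\langle\sigma_1,\langle\sigma_2,\ldots,\sigma_k\rangle\rangle$ for $k=2,\ldots,m$, the inner brackets being iterated in the same way (and $\langle\sigma_k\rangle=\sigma_k$); $(s_{1,1},\ldots,s_{1,m})$ is the Nikishin system generated by $(\sigma_1,\ldots,\sigma_m)$. Then the system of functions $(\widehat{s}_{1,1},\ldots,\widehat{s}_{1,m})$ is type I and type II perfect; that is, for every non-zero multi-index ${\bf n}=(n_1,\ldots,n_m)\in\mathbb{Z}_{\ge 0}^m$, with $|{\bf n}|=n_1+\cdots+n_m$: 1. (Type I) There exist complex polynomials $a_1,\ldots,a_m$,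 not all identically zero, with $\deg a_j\le n_j-1$ for all $j$ (where the zero polynomial has degree $-1$), such that for some polynomial $a_0$ $$a_0(z)+\sum_{j=1}^m a_j(z)\,\widehat{s}_{1,j}(z)=\mathcal{O}\bigl(1/z^{|{\bf n}|}\bigr),\qquad z\to\infty,$$ and every such $(a_1,\ldots,a_m)$ satisfies $\deg a_j=n_j-1$ for $j=1,\ldots,m$. 2. (Type II) There exists a complex polynomial $Q$, not identically zero, with $\deg Q\le|{\bf n}|$, such that for each $j=1,\ldots,m$ there is a polynomial $P_j$ with $$Q(z)\,\widehat{s}_{1,j}(z)-P_j(z)=\mathcal{O}\bigl(1/z^{n_j+1}\bigr),\qquad z\to\infty,$$ and every such $Q$ satisfies $\deg Q=|{\bf n}|$. -/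

import Mathlib

open MeasureTheory Polynomial Asymptotics

namespace HermitePade

/-! ### Hermite–Padé approximation at infinity -/

/-- The degree of a polynomial, with the convention that the zero polynomial has degree `-1`
(so that "degree at most `-1`" means "identically zero"). -/
noncomputable def deg (p : ℂ[X]) : ℤ :=
  if p = 0 then -1 else (p.natDegree : ℤ)

variable {m : ℕ}

/-- The length `|n| = n₁ + ⋯ + n_m` of a multi-index. -/
def size (n : Fin m → ℕ) : ℕ := ∑ j, n j

/-- `(a₁, …, a_m)` is a vector of type I Hermite–Padé polynomials of the system `f = (f₁, …, f_m)`
for the multi-index `n`: the `a_j` are not all zero, `deg a_j ≤ n_j - 1`, and for some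
polynomial `a₀`, `a₀(z) + ∑ a_j(z) f_j(z) = O(1 / z^|n|)` as `z → ∞`. -/
structure IsTypeI (f : Fin m → ℂ → ℂ) (n : Fin m → ℕ) (a : Fin m → ℂ[X]) : Prop where
  ne_zero : a ≠ 0
  deg_le : ∀ j, deg (a j) ≤ (n j : ℤ) - 1
  isBigO : ∃ a₀ : ℂ[X],
    (fun z : ℂ => a₀.eval z + ∑ j, (a j).eval z * f j z)
      =O[Bornology.cobounded ℂ] fun z : ℂ => 1 / z ^ size n

/-- `Q` is a type II Hermite–Padé polynomial of the system `f = (f₁, …, f_m)` for the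
multi-index `n`: `Q` is not zero, `deg Q ≤ |n|`, and for each `j` there is a polynomial `P_j` with
`Q(z) f_j(z) - P_j(z) = O(1 / z^(n_j + 1))` as `z → ∞`. -/
structure IsTypeII (f : Fin m → ℂ → ℂ) (n : Fin m → ℕ) (Q : ℂ[X]) : Prop where
  ne_zero : Q ≠ 0
  deg_le : deg Q ≤ (size n : ℤ)
  isBigO : ∀ j, ∃ P : ℂ[X],
    (fun z : ℂ => Q.eval z * f j z - P.eval z)
      =O[Bornology.cobounded ℂ] fun z : ℂ => 1 / z ^ (n j + 1)

/-- The multi-index `n` is normal for type I approximation of the system `f`: type I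
polynomials exist, and all of them have the maximal degrees `deg a_j = n_j - 1`. -/
def IsNormalTypeI (f : Fin m → ℂ → ℂ) (n : Fin m → ℕ) : Prop :=
  (∃ a, IsTypeI f n a) ∧ ∀ a, IsTypeI f n a → ∀ j, deg (a j) = (n j : ℤ) - 1

/-- The multi-index `n` is normal for type II approximation of the system `f`: type II
polynomials exist, and all of them have the maximal degree `deg Q = |n|`. -/
def IsNormalTypeII (f : Fin m → ℂ → ℂ) (n : Fin m → ℕ) : Prop :=
  (∃ Q, IsTypeII f n Q) ∧ ∀ Q, IsTypeII f n Q → deg Q = (size n : ℤ)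

/-- The system `f` is type I perfect: all (non-zero) multi-indices are normal for type I. -/
def IsPerfectTypeI (f : Fin m → ℂ → ℂ) : Prop :=
  ∀ n : Fin m → ℕ, n ≠ 0 → IsNormalTypeI f n

/-- The system `f` is type II perfect: all (non-zero) multi-indices are normal for type II. -/
def IsPerfectTypeII (f : Fin m → ℂ → ℂ) : Prop :=
  ∀ n : Fin m → ℕ, n ≠ 0 → IsNormalTypeII f n

/-! ### Measures of constant sign, Cauchy transforms, Nikishin systems -/

/-- The support of a (finite) signed Borel measure on the line. -/
noncomputable def supp (s : SignedMeasure ℝ) : Set ℝ := s.variation.support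

/-- The smallest interval `Co(supp s)` which contains the support of `s`. -/
noncomputable def hull (s : SignedMeasure ℝ) : Set ℝ := convexHull ℝ (supp s)

/-- The class of finite Borel measures on the real line with constant sign whose support is compact
and consists of infinitely many points. -/
structure IsAdmissible (s : SignedMeasure ℝ) : Prop where
  constant_sign : 0 ≤ s ∨ s ≤ 0
  isCompact_supp : IsCompact (supp s)
  infinite_supp : (supp s).Infinite

/-- The Cauchy transform `ŝ(z) = ∫ ds(x) / (z - x)`. -/
noncomputable def cauchy (s : SignedMeasure ℝ) (z : ℂ) : ℂ :=
  ∫ᵛ x, 1 / (z - (x : ℂ)) ∂<•s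

/-- The Cauchy transform at points of the real line, where it is real. -/
noncomputable def cauchyReal (s : SignedMeasure ℝ) (y : ℝ) : ℝ :=
  ∫ᵛ x, 1 / (y - x) ∂<•s

/-- The product `⟨α, β⟩` of two measures: `d⟨α, β⟩(x) = β̂(x) dα(x)`. -/
noncomputable def prod (α β : SignedMeasure ℝ) : SignedMeasure ℝ :=
  α.withDensity (cauchyReal β) (ContinuousLinearMap.lsmul ℝ ℝ).flip

/-- The iterated product `⟨σ₁, σ₂, …, σ_k⟩ = ⟨σ₁, ⟨σ₂, …, σ_k⟩⟩`, with `⟨σ₁⟩ = σ₁`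
(the value at the empty list is irrelevant). -/
noncomputable def iterProd : List (SignedMeasure ℝ) → SignedMeasure ℝ
  | [] => 0
  | [s] => s
  | s :: t :: l => prod s (iterProd (t :: l))

/-- `(σ₁, …, σ_m)` generates a Nikishin system: every `σ_j` is a measure of the above class, and
the intervals `Δ_j = Co(supp σ_j)` satisfy `Δ_j ∩ Δ_{j+1} = ∅` for `j = 1, …, m - 1`. -/
structure IsNikishinGenerator (σ : Fin m → SignedMeasure ℝ) : Prop where
  admissible : ∀ j, IsAdmissible (σ j)
  disjoint : ∀ i j : Fin m, (j : ℕ) = i + 1 → hull (σ i) ∩ hull (σ j) = ∅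

/-- The Nikishin system of measures `(s_{1,1}, …, s_{1,m})` generated by `(σ₁, …, σ_m)`, where
`s_{1,k} = ⟨σ₁, …, σ_k⟩`. The index `k : Fin m` counts from zero. -/
noncomputable def nikishin (σ : Fin m → SignedMeasure ℝ) (k : Fin m) : SignedMeasure ℝ :=
  iterProd ((List.ofFn σ).take (k + 1))

end HermitePade

/-! Arrange the Cauchy transforms of the products `⟨σ_{r+1}, …, σ_k⟩` as row `r` of an upper
triangular array with columns `i, …, m`, ones on the diagonal and zeros to its left. For `V ⊆ {i, …,
m}` let `φ_V` be the minor of the first `|V|` rows with columns `V`. Across `Δ_{r+1}` row `r` jumps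
by a multiple of row `r + 1`, so all jumps cancel except that of the last row, and `φ_V` is analytic
off the single interval `Δ_{i+|V|}`. By determinant identities of Sylvester type, `φ_{S∪k} /
φ_{S∪l}` is a polynomial plus the Cauchy transform of `± φ_{S∪{k,l}} φ_S dω`, where `ω` depends only
on `S ∪ l`. The two factors of this density are singular only on the neighbouring intervals, so on
the interval of `ω` they are real and have no zeros. The structure `Family` records these facts.

A `Family` is built by adding generators on the left (`StepData.exists_family`). The new quotients
come from products of Cauchy transforms on disjoint sets, which split into a sum of two
(`CT_mul_CT`), and from reciprocals: the reciprocal of a nonvanishing `c + μ̂` is a polynomial minus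
a Cauchy transform (`IsGen.exists_inv_eq`). The latter is obtained from the resolvent of a rank one
perturbation of multiplication by `x`.

Given a `Family`, a nonzero real form `∑ p_k φ_{S∪k}` with `deg p_k < n_k` has fewer than `∑ n_k`
real zeros off its interval (`Family.card_zeros_lt`). Indeed, after division by one `φ_{S∪l}`, many
zeros become many orthogonality relations for the form `∑_{k≠l} p_k φ_{S∪{l,k}}`, which then changes
sign too often. For `S = ∅` this shows that a nonzero form in `1, ŝ_{2,2}, …, ŝ_{2,m}` cannot be
orthogonal to `1, x, …, x^{|n|-1}` with respect to `σ₁`. Both kinds of normality follow by linear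
algebra on the moment matrix. -/

namespace HermitePade

/-! ### Cauchy transforms off a compact subset of the line -/

section

open Filter Topology Bornology

/-- `μ` is a finite measure concentrated on the compact set `D`. -/
structure IsConc (D : Set ℝ) (μ : Measure ℝ) : Prop where
  isCompact : IsCompact D
  isFinite : IsFiniteMeasure μ
  null : μ Dᶜ = 0

/-- `μ` is a finite measure concentrated on the compact interval `D` which is not concentrated on
a finite set. -/
structure IsGen (D : Set ℝ) (μ : Measure ℝ) : Prop extends IsConc D μ where
  convex : Convex ℝ D
  infinite : ∀ Z : Set ℝ, Z.Finite → μ Zᶜ ≠ 0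

/-- The complement in the complex plane of a subset of the real line. -/
def cdom (D : Set ℝ) : Set ℂ := {z | ∀ x ∈ D, z ≠ (x : ℂ)}

/-- The Cauchy transform of the measure with density `g` with respect to `μ`. -/
noncomputable def CT (μ : Measure ℝ) (g : ℝ → ℂ) (z : ℂ) : ℂ := ∫ x, g x / (z - (x : ℂ)) ∂μ

variable {D D' : Set ℝ} {μ ν : Measure ℝ} {g h : ℝ → ℂ} {z : ℂ}

lemma mem_cdom_of_im (D : Set ℝ) (hz : z.im ≠ 0) : z ∈ cdom D := by
  intro x _ h
  exact hz (by simp [h])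

lemma ofReal_mem_cdom {x : ℝ} (hx : x ∉ D) : (x : ℂ) ∈ cdom D := by
  intro y hy h
  exact hx (by rwa [Complex.ofReal_inj.1 h])

lemma sub_ne_zero_of_mem_cdom (hz : z ∈ cdom D) {x : ℝ} (hx : x ∈ D) : z - (x : ℂ) ≠ 0 :=
  sub_ne_zero.2 (hz x hx)

lemma cdom_eq (D : Set ℝ) : cdom D = ((fun x : ℝ => (x : ℂ)) '' D)ᶜ := by
  ext z
  simp only [cdom, Set.mem_ofPred_eq, Set.mem_compl_iff, Set.mem_image, not_exists, not_and]
  exact ⟨fun h x hx h' => h x hx h'.symm, fun h x hx h' => h x hx h'.symm⟩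

lemma isOpen_cdom (hD : IsCompact D) : IsOpen (cdom D) := by
  rw [cdom_eq]
  exact (hD.image Complex.continuous_ofReal).isClosed.isOpen_compl

lemma continuousOn_kernel (hg : ContinuousOn g D) (hz : z ∈ cdom D) :
    ContinuousOn (fun x : ℝ => g x / (z - (x : ℂ))) D :=
  hg.div (by fun_prop) fun _ hx => sub_ne_zero_of_mem_cdom hz hx

lemma IsConc.restrict_eq (hμ : IsConc D μ) : μ.restrict D = μ :=
  Measure.restrict_eq_self_of_ae_mem (by
    rw [ae_iff]
    exact hμ.null)

lemma IsConc.ae_mem (hμ : IsConc D μ) : ∀ᵐ x ∂μ, x ∈ D := by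
  rw [ae_iff]
  exact hμ.null

lemma IsConc.integrable {E : Type*} [NormedAddCommGroup E] (hμ : IsConc D μ) {f : ℝ → E}
    (hf : ContinuousOn f D) : Integrable f μ := by
  have := hμ.isFinite
  have h := hf.integrableOn_compact (μ := μ) hμ.isCompact
  rwa [IntegrableOn, hμ.restrict_eq] at h

lemma IsConc.integrable_kernel (hμ : IsConc D μ) (hg : ContinuousOn g D) (hz : z ∈ cdom D) :
    Integrable (fun x : ℝ => g x / (z - (x : ℂ))) μ :=
  hμ.integrable (continuousOn_kernel hg hz)

lemma IsConc.integral_congr (hμ : IsConc D μ) {E : Type*} [NormedAddCommGroup E] [NormedSpace ℝ E]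
    {f f' : ℝ → E} (h : ∀ x ∈ D, f x = f' x) : ∫ x, f x ∂μ = ∫ x, f' x ∂μ :=
  integral_congr_ae (hμ.ae_mem.mono h)

lemma IsConc.CT_congr (hμ : IsConc D μ) (hgh : ∀ x ∈ D, g x = h x) (z : ℂ) :
    CT μ g z = CT μ h z :=
  hμ.integral_congr fun x hx => by rw [hgh x hx]

lemma CT_const_mul (c : ℂ) (z : ℂ) : CT μ (fun x => c * g x) z = c * CT μ g z := by
  simp only [CT, mul_div_assoc]
  exact integral_const_mul _ _

lemma CT_neg (z : ℂ) : CT μ (fun x => -g x) z = -CT μ g z := by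
  simp only [CT, neg_div]
  exact integral_neg _

lemma IsConc.CT_add (hμ : IsConc D μ) (hg : ContinuousOn g D) (hh : ContinuousOn h D)
    (hz : z ∈ cdom D) : CT μ (fun x => g x + h x) z = CT μ g z + CT μ h z := by
  simp only [CT, add_div]
  exact integral_add (hμ.integrable_kernel hg hz) (hμ.integrable_kernel hh hz)

lemma IsConc.CT_sum {ι : Type*} (s : Finset ι) {G : ι → ℝ → ℂ} (hμ : IsConc D μ)
    (hg : ∀ i ∈ s, ContinuousOn (G i) D)
    (hz : z ∈ cdom D) : CT μ (fun x => ∑ i ∈ s, G i x) z = ∑ i ∈ s, CT μ (G i) z := by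
  simp only [CT, Finset.sum_div]
  exact integral_finsetSum _ fun i hi => hμ.integrable_kernel (hg i hi) hz

lemma continuousOn_eval (P : ℂ[X]) (s : Set ℝ) :
    ContinuousOn (fun x : ℝ => P.eval (x : ℂ)) s :=
  (P.continuous.comp Complex.continuous_ofReal).continuousOn

lemma IsConc.continuousOn_CT (hμ : IsConc D μ) (hg : ContinuousOn g D) :
    ContinuousOn (CT μ g) (cdom D) := by
  intro z₀ hz₀
  have hfin := hμ.isFinite
  apply ContinuousAt.continuousWithinAt
  obtain ⟨δ, hδ, hball⟩ := Metric.isOpen_iff.1 (isOpen_cdom hμ.isCompact) z₀ hz₀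
  obtain ⟨M, hM⟩ := hμ.isCompact.exists_bound_of_continuousOn hg
  have hM0 : 0 ≤ |M| := abs_nonneg M
  have hnorm : ∀ z ∈ Metric.ball z₀ (δ / 2), ∀ x ∈ D, δ / 2 ≤ ‖z - (x : ℂ)‖ := by
    intro z hz x hx
    by_contra hlt
    push Not at hlt
    have hxb : (x : ℂ) ∈ Metric.ball z₀ δ := by
      rw [Metric.mem_ball, dist_comm]
      calc dist z₀ (x : ℂ) ≤ dist z₀ z + dist z (x : ℂ) := dist_triangle _ _ _
        _ < δ / 2 + δ / 2 := by
          rw [dist_comm z₀ z, dist_eq_norm z (x : ℂ)]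
          exact add_lt_add (Metric.mem_ball.1 hz) hlt
        _ = δ := by ring
    exact hball hxb x hx rfl
  refine continuousAt_of_dominated (bound := fun _ => |M| / (δ / 2)) ?_ ?_ (integrable_const _) ?_
  · filter_upwards [(isOpen_cdom hμ.isCompact).mem_nhds hz₀] with z hz
    exact (hμ.integrable_kernel hg hz).aestronglyMeasurable
  · filter_upwards [Metric.ball_mem_nhds z₀ (half_pos hδ)] with z hz
    filter_upwards [hμ.ae_mem] with x hx
    rw [norm_div]
    have h1 := hnorm z hz x hx
    have h2 := (hM x hx).trans (le_abs_self M)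
    gcongr
  · filter_upwards [hμ.ae_mem] with x hx
    exact continuousAt_const.div (by fun_prop) (sub_ne_zero_of_mem_cdom hz₀ hx)

/-- The moment relation for Cauchy transforms. -/
lemma IsConc.mul_CT (hμ : IsConc D μ) (hg : ContinuousOn g D) (hz : z ∈ cdom D) :
    z * CT μ g z = (∫ x, g x ∂μ) + CT μ (fun x => (x : ℂ) * g x) z := by
  have h1 : Continuous fun x : ℝ => (x : ℂ) := Complex.continuous_ofReal
  rw [CT, CT, ← integral_const_mul, ← integral_add (hμ.integrable hg)
    (hμ.integrable_kernel (h1.continuousOn.fun_mul hg) hz)]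
  refine hμ.integral_congr fun x hx => ?_
  have := sub_ne_zero_of_mem_cdom hz hx
  field_simp
  ring

/-- `(P(z) - P(x)) / (z - x)` is a polynomial in `z` of degree one less than `P`; its integral is
`Q`. The induction peels off one factor `z` at a time through `divX`. -/
lemma IsConc.poly_mul_CT (hμ : IsConc D μ) (n : ℕ) : ∀ {g : ℝ → ℂ} (_ : ContinuousOn g D) (P : ℂ[X])
    (_ : P.degree < (n + 1 : ℕ)), ∃ Q : ℂ[X], Q.degree < (n : ℕ) ∧ ∀ z ∈ cdom D,
      P.eval z * CT μ g z = Q.eval z + CT μ (fun x => P.eval (x : ℂ) * g x) z := by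
  have h1 : Continuous fun x : ℝ => (x : ℂ) := Complex.continuous_ofReal
  induction n with
  | zero =>
    intro g hg P hP
    refine ⟨0, by simp, fun z hz => ?_⟩
    have : P = C (P.coeff 0) := eq_C_of_degree_le_zero (natDegree_le_iff_degree_le.1 (by
      by_cases h0 : P = 0
      · simp [h0]
      · exact Nat.lt_succ_iff.1 ((natDegree_lt_iff_degree_lt h0).2 hP)))
    rw [this]
    simp [CT_const_mul]
  | succ n ih =>
    intro g hg P hP
    have hdeg : P.divX.degree < (n + 1 : ℕ) := by
      by_cases h0 : P = 0
      · simp [h0]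
      · rcases eq_or_ne P.divX 0 with h | h
        · simp [h]
        · rw [degree_eq_natDegree h, natDegree_divX_eq_natDegree_tsub_one]
          have hP' : P.natDegree < n + 1 + 1 := (natDegree_lt_iff_degree_lt h0).2 hP
          exact_mod_cast (by omega : P.natDegree - 1 < n + 1)
    obtain ⟨Q, hQ, hQz⟩ := ih hg P.divX hdeg
    refine ⟨X * Q + C (∫ x, P.divX.eval (x : ℂ) * g x ∂μ), ?_, fun z hz => ?_⟩
    · refine (degree_add_le _ _).trans_lt (max_lt ?_ ?_)
      · rw [X_mul, degree_mul_X]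
        rcases eq_or_ne Q 0 with h | h
        · simp [h]
        · rw [degree_eq_natDegree h] at hQ ⊢
          exact_mod_cast Nat.succ_lt_succ (by exact_mod_cast hQ)
      · exact degree_C_le.trans_lt (by exact_mod_cast n.succ_pos)
    · have hcg := (continuousOn_eval P.divX D).fun_mul hg
      conv_lhs => rw [← divX_mul_X_add P]
      have h2 : CT μ (fun x => P.eval (x : ℂ) * g x) z
          = CT μ (fun x => (x : ℂ) * (P.divX.eval (x : ℂ) * g x)) z + P.coeff 0 * CT μ g z := by
        rw [← CT_const_mul, ← hμ.CT_add (h1.continuousOn.fun_mul hcg) (continuousOn_const.fun_mul hg) hz]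
        refine hμ.CT_congr (fun x _ => ?_) z
        conv_lhs => rw [← divX_mul_X_add P]
        simp
        ring
      rw [h2]
      have h3 := hμ.mul_CT hcg hz
      have h4 := hQz z hz
      simp only [eval_add, eval_mul, eval_X, eval_C]
      linear_combination z * h4 + h3

lemma IsConc.exists_poly_mul_CT (hμ : IsConc D μ) (hg : ContinuousOn g D) (P : ℂ[X]) :
    ∃ Q : ℂ[X], ∀ z ∈ cdom D,
      P.eval z * CT μ g z = Q.eval z + CT μ (fun x => P.eval (x : ℂ) * g x) z := by
  obtain ⟨Q, -, hQ⟩ := hμ.poly_mul_CT P.natDegree hg P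
    (degree_le_natDegree.trans_lt (by exact_mod_cast Nat.lt_succ_self _))
  exact ⟨Q, hQ⟩

/-- The product of the Cauchy transforms of measures on disjoint sets. -/
lemma CT_mul_CT (hμ : IsConc D μ) (hν : IsConc D' ν) (hdis : Disjoint D D')
    (hg : ContinuousOn g D) (hh : ContinuousOn h D') (hz : z ∈ cdom D) (hz' : z ∈ cdom D') :
    CT μ g z * CT ν h z
      = CT ν (fun u => CT μ g u * h u) z + CT μ (fun t => CT ν h t * g t) z := by
  have := hμ.isFinite
  have := hν.isFinite
  have hne : ∀ t ∈ D, ∀ u ∈ D', (t : ℂ) - (u : ℂ) ≠ 0 := fun t ht u hu h0 =>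
    Set.disjoint_left.1 hdis ht (by rwa [Complex.ofReal_inj.1 (sub_eq_zero.1 h0)])
  have hprod : IsFiniteMeasure (μ.prod ν) := inferInstance
  have hae : ∀ᵐ p ∂(μ.prod ν), p ∈ D ×ˢ D' := by
    have h1 := Measure.ae_prod_mem_iff_ae_ae_mem (μ := μ) (ν := ν)
      (hμ.isCompact.measurableSet.prod hν.isCompact.measurableSet)
    rw [h1]
    filter_upwards [hμ.ae_mem] with x hx
    filter_upwards [hν.ae_mem] with y hy
    exact ⟨hx, hy⟩
  have hcont : ContinuousOn (fun p : ℝ × ℝ => g p.1 * h p.2 /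
      (((p.1 : ℂ) - (p.2 : ℂ)) * (z - (p.1 : ℂ)))) (D ×ˢ D') := by
    refine ContinuousOn.div ?_ (by fun_prop) fun p hp =>
      mul_ne_zero (hne _ hp.1 _ hp.2) (sub_ne_zero_of_mem_cdom hz hp.1)
    exact (hg.comp continuousOn_fst fun p hp => hp.1).mul
      (hh.comp continuousOn_snd fun p hp => hp.2)
  have hcont2 : ContinuousOn (fun p : ℝ × ℝ => g p.1 * h p.2 /
      (((p.2 : ℂ) - (p.1 : ℂ)) * (z - (p.2 : ℂ)))) (D ×ˢ D') := by
    refine ContinuousOn.div ?_ (by fun_prop) fun p hp =>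
      mul_ne_zero (by rw [← neg_ne_zero, neg_sub]; exact hne _ hp.1 _ hp.2)
        (sub_ne_zero_of_mem_cdom hz' hp.2)
    exact (hg.comp continuousOn_fst fun p hp => hp.1).mul
      (hh.comp continuousOn_snd fun p hp => hp.2)
  have hint : ∀ {f : ℝ × ℝ → ℂ}, ContinuousOn f (D ×ˢ D') → Integrable f (μ.prod ν) := by
    intro f hf
    have h := hf.integrableOn_compact (μ := μ.prod ν) (hμ.isCompact.prod hν.isCompact)
    rwa [IntegrableOn, Measure.restrict_eq_self_of_ae_mem hae] at h
  have e1 : CT ν (fun u => CT μ g u * h u) z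
      = ∫ p : ℝ × ℝ, g p.1 * h p.2 / (((p.2 : ℂ) - (p.1 : ℂ)) * (z - (p.2 : ℂ))) ∂(μ.prod ν) := by
    rw [integral_prod_symm _ (hint hcont2)]
    refine hν.integral_congr fun u hu => ?_
    simp only [CT]
    rw [mul_div_assoc, ← integral_mul_const]
    refine hμ.integral_congr fun t ht => ?_
    have := sub_ne_zero_of_mem_cdom hz' hu
    have h2 := hne t ht u hu
    have h3 : (u : ℂ) - t ≠ 0 := by rwa [← neg_ne_zero, neg_sub]
    field_simp
  have e2 : CT μ (fun t => CT ν h t * g t) z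
      = ∫ p : ℝ × ℝ, g p.1 * h p.2 / (((p.1 : ℂ) - (p.2 : ℂ)) * (z - (p.1 : ℂ))) ∂(μ.prod ν) := by
    rw [integral_prod _ (hint hcont)]
    refine hμ.integral_congr fun t ht => ?_
    simp only [CT]
    rw [mul_div_assoc, ← integral_mul_const]
    refine hν.integral_congr fun u hu => ?_
    have := sub_ne_zero_of_mem_cdom hz ht
    have h2 := hne t ht u hu
    field_simp
  rw [e1, e2, ← integral_add (hint hcont2) (hint hcont), CT, CT, ← integral_prod_mul]
  -- Partial fractions: `1/((z-t)(z-u)) = 1/((u-t)(z-u)) + 1/((t-u)(z-t))`.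
  refine integral_congr_ae (hae.mono fun p hp => ?_)
  have h1 := hne p.1 hp.1 p.2 hp.2
  have h2 := sub_ne_zero_of_mem_cdom hz hp.1
  have h3 := sub_ne_zero_of_mem_cdom hz' hp.2
  have h4 : (p.2 : ℂ) - p.1 ≠ 0 := by rwa [← neg_ne_zero, neg_sub]
  have h5 : (p.2 : ℂ) - p.1 = -((p.1 : ℂ) - p.2) := by ring
  simp only [h5]
  field_simp
  ring

/-- The product of two functions which are sums of polynomials and Cauchy transforms of measures
on disjoint sets. -/
lemma exists_poly_mul (hμ : IsConc D μ) (hν : IsConc D' ν) (hdis : Disjoint D D')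
    (hg : ContinuousOn g D) (hh : ContinuousOn h D') {F R : ℂ → ℂ} (P Q : ℂ[X])
    (hF : ∀ z ∈ cdom D, F z = P.eval z + CT μ g z)
    (hR : ∀ z ∈ cdom D', R z = Q.eval z + CT ν h z) :
    ∃ S : ℂ[X], ∀ z ∈ cdom D, z ∈ cdom D' →
      F z * R z = S.eval z + CT ν (fun u => F u * h u) z + CT μ (fun t => R t * g t) z := by
  obtain ⟨S₁, h₁⟩ := hμ.exists_poly_mul_CT hg Q
  obtain ⟨S₂, h₂⟩ := hν.exists_poly_mul_CT hh P
  have hD : ∀ t ∈ D, (t : ℂ) ∈ cdom D' := fun t ht =>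
    ofReal_mem_cdom (Set.disjoint_left.1 hdis ht)
  have hD' : ∀ t ∈ D', (t : ℂ) ∈ cdom D := fun t ht =>
    ofReal_mem_cdom (Set.disjoint_right.1 hdis ht)
  refine ⟨P * Q + S₁ + S₂, fun z hz hz' => ?_⟩
  have hc1 : ContinuousOn (fun u : ℝ => CT μ g u) D' :=
    (hμ.continuousOn_CT hg).comp Complex.continuous_ofReal.continuousOn hD'
  have hc2 : ContinuousOn (fun u : ℝ => CT ν h u) D :=
    (hν.continuousOn_CT hh).comp Complex.continuous_ofReal.continuousOn hD
  have e1 : CT ν (fun u => F u * h u) z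
      = CT ν (fun u => P.eval (u : ℂ) * h u) z + CT ν (fun u => CT μ g u * h u) z := by
    rw [← hν.CT_add ((continuousOn_eval P D').fun_mul hh) (hc1.fun_mul hh) hz']
    exact hν.CT_congr (fun u hu => by rw [hF u (hD' u hu)]; ring) z
  have e2 : CT μ (fun u => R u * g u) z
      = CT μ (fun u => Q.eval (u : ℂ) * g u) z + CT μ (fun u => CT ν h u * g u) z := by
    rw [← hμ.CT_add ((continuousOn_eval Q D).fun_mul hg) (hc2.fun_mul hg) hz]
    exact hμ.CT_congr (fun u hu => by rw [hR u (hD u hu)]; ring) z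
  rw [e1, e2, hF z hz, hR z hz']
  have h3 := CT_mul_CT hμ hν hdis hg hh hz hz'
  simp only [eval_add, eval_mul]
  linear_combination h3 + h₁ z hz + h₂ z hz'

end

/-! ### Behaviour at infinity, uniqueness and nonvanishing -/

section

open Filter Topology Bornology

variable {D D' : Set ℝ} {μ ν : Measure ℝ} {g h : ℝ → ℂ} {z : ℂ}

lemma eventually_mem_cdom (hD : IsCompact D) : ∀ᶠ z in cobounded ℂ, z ∈ cdom D := by
  have h := (hD.image Complex.continuous_ofReal).isBounded
  rw [cdom_eq]
  exact isBounded_def.1 h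

lemma IsConc.tendsto_CT (hμ : IsConc D μ) (hg : ContinuousOn g D) :
    Tendsto (CT μ g) (cobounded ℂ) (𝓝 0) := by
  have hfin := hμ.isFinite
  obtain ⟨M, hM⟩ := hμ.isCompact.exists_bound_of_continuousOn hg
  obtain ⟨R, hR⟩ := hμ.isCompact.isBounded.exists_norm_le
  have h0 : (0 : ℂ) = ∫ _ : ℝ, (0 : ℂ) ∂μ := by simp
  rw [h0]
  have : (cobounded ℂ).IsCountablyGenerated := by
    rw [← comap_norm_atTop]
    infer_instance
  refine tendsto_integral_filter_of_dominated_convergence (fun _ => |M|) ?_ ?_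
    (integrable_const _) ?_
  · filter_upwards [eventually_mem_cdom hμ.isCompact] with z hz
    exact (hμ.integrable_kernel hg hz).aestronglyMeasurable
  · filter_upwards [tendsto_norm_cobounded_atTop.eventually_ge_atTop (R + 1)] with z hz
    filter_upwards [hμ.ae_mem] with x hx
    have h1 : 1 ≤ ‖z - (x : ℂ)‖ := by
      have h2 := norm_sub_norm_le z (x : ℂ)
      have h3 := hR x hx
      rw [Complex.norm_real] at h2
      linarith
    rw [norm_div]
    exact (div_le_self (norm_nonneg _) h1).trans ((hM x hx).trans (le_abs_self M))
  · refine Eventually.of_forall fun x => ?_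
    have h1 : Tendsto (fun z : ℂ => z - (x : ℂ)) (cobounded ℂ) (cobounded ℂ) := by
      simp [sub_eq_add_neg]
    simpa [div_eq_mul_inv] using (tendsto_inv₀_cobounded.comp h1).const_mul (g x)

lemma IsConc.tendsto_mul_CT (hμ : IsConc D μ) (hg : ContinuousOn g D) :
    Tendsto (fun z => z * CT μ g z) (cobounded ℂ) (𝓝 (∫ x, g x ∂μ)) := by
  have h1 : Continuous fun x : ℝ => (x : ℂ) := Complex.continuous_ofReal
  have h2 := (hμ.tendsto_CT (h1.continuousOn.fun_mul hg)).const_add (∫ x, g x ∂μ)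
  rw [add_zero] at h2
  refine h2.congr' ?_
  filter_upwards [eventually_mem_cdom hμ.isCompact] with z hz
  rw [hμ.mul_CT hg hz]

lemma degree_le_zero_of_isBigO_one {P : ℂ[X]}
    (hP : (fun z => P.eval z) =O[cobounded ℂ] fun _ => (1 : ℂ)) : P.degree ≤ 0 := by
  by_contra! h
  have h1 := P.tendsto_norm_atTop h tendsto_norm_cobounded_atTop
  have h2 := (isBigO_one_iff (F := ℂ)).1 hP
  exact (not_isBoundedUnder_of_tendsto_atTop h1) h2

lemma eq_zero_of_tendsto_zero {P : ℂ[X]} (hP : Tendsto (fun z => P.eval z) (cobounded ℂ) (𝓝 0)) :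
    P = 0 := by
  have h1 := degree_le_zero_of_isBigO_one (hP.isBigO_one ℂ)
  rw [eq_C_of_degree_le_zero h1] at hP ⊢
  simp only [eval_C] at hP
  rw [tendsto_nhds_unique tendsto_const_nhds hP, C_0]

lemma degree_le_one_of_isBigO {P : ℂ[X]}
    (hP : (fun z => P.eval z) =O[cobounded ℂ] fun z => z) : P.degree ≤ 1 := by
  have h1 : (fun z => P.divX.eval z) =O[cobounded ℂ] fun _ => (1 : ℂ) := by
    have h2 : (fun z => P.divX.eval z) =ᶠ[cobounded ℂ]
        fun z => z⁻¹ * (P.eval z - P.coeff 0) := by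
      filter_upwards [eventually_ne_cobounded (0 : ℂ)] with z hz
      conv_rhs => rw [← divX_mul_X_add P]
      simp
      field_simp
    refine h2.trans_isBigO ?_
    have h3 : (fun _ : ℂ => P.coeff 0) =O[cobounded ℂ] fun z => z := by
      apply IsLittleO.isBigO
      exact isLittleO_const_left.2 (Or.inr tendsto_norm_cobounded_atTop)
    have h4 := (isBigO_refl (fun z : ℂ => z⁻¹) (cobounded ℂ)).mul (hP.sub h3)
    refine h4.trans (IsBigO.of_bound 1 ?_)
    filter_upwards [eventually_ne_cobounded (0 : ℂ)] with z hz
    simp [hz]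
  have h2 := degree_le_zero_of_isBigO_one h1
  rw [← divX_mul_X_add P, eq_C_of_degree_le_zero h2]
  exact degree_linear_le

lemma neBot_nonreal (z : ℂ) : (𝓝[{w : ℂ | w.im ≠ 0}] z).NeBot := by
  rw [← mem_closure_iff_nhdsWithin_neBot, Metric.mem_closure_iff]
  intro ε hε
  by_cases h : z.im = 0
  · refine ⟨z + (ε / 2 : ℝ) * Complex.I, by simp [h, hε.ne'], ?_⟩
    simp [dist_eq_norm, abs_of_pos hε, hε]
  · exact ⟨z, h, by simpa using hε⟩

/-- Continuous functions on an open set that agree off the real line are equal. -/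
lemma eqOn_of_eq_nonreal {U : Set ℂ} (hU : IsOpen U) {F G : ℂ → ℂ} (hF : ContinuousOn F U)
    (hG : ContinuousOn G U) (h : ∀ z, z.im ≠ 0 → F z = G z) : ∀ z ∈ U, F z = G z := by
  intro z hz
  have := neBot_nonreal z
  have h1 := ((hF.continuousAt (hU.mem_nhds hz)).tendsto).mono_left
    (nhdsWithin_le_nhds (s := {w : ℂ | w.im ≠ 0}))
  have h2 := ((hG.continuousAt (hU.mem_nhds hz)).tendsto).mono_left
    (nhdsWithin_le_nhds (s := {w : ℂ | w.im ≠ 0}))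
  refine tendsto_nhds_unique h1 (h2.congr' ?_)
  filter_upwards [self_mem_nhdsWithin] with w hw using (h w hw).symm

section Moments

variable {ι : Type*} [Fintype ι] {K : ι → Set ℝ} {m : ι → Measure ℝ} {d : ι → ℝ → ℂ}

/-- The left side of `h` tends to zero at infinity, so `P = 0`. Multiplying by `z` then exposes the
moments one after the other. Equality off the real line passes to a full neighbourhood of infinity
by continuity. -/
lemma sum_integral_pow_eq_zero (hm : ∀ i, IsConc (K i) (m i))
    (hd : ∀ i, ContinuousOn (d i) (K i)) {P : ℂ[X]}
    (h : ∀ z : ℂ, z.im ≠ 0 → ∑ i, CT (m i) (d i) z = P.eval z) (k : ℕ) :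
    ∑ i, ∫ x, (x : ℂ) ^ k * d i x ∂(m i) = 0 := by
  have h1 : Continuous fun x : ℝ => (x : ℂ) := Complex.continuous_ofReal
  have hc : ∀ k i, ContinuousOn (fun x : ℝ => (x : ℂ) ^ k * d i x) (K i) := fun k i =>
    (h1.pow k).continuousOn.fun_mul (hd i)
  set B : ℕ → ℂ → ℂ := fun k z => ∑ i, CT (m i) (fun x => (x : ℂ) ^ k * d i x) z with hB
  have htend : ∀ k, Tendsto (B k) (cobounded ℂ) (𝓝 0) := fun k => by
    have := tendsto_finsetSum Finset.univ fun i _ => (hm i).tendsto_CT (hc k i)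
    simpa using this
  have hev : ∀ᶠ z in cobounded ℂ, ∀ i, z ∈ cdom (K i) :=
    eventually_all.2 fun i => eventually_mem_cdom (hm i).isCompact
  have hrec : ∀ k, ∀ᶠ z in cobounded ℂ,
      z * B k z = ∑ i, ∫ x, (x : ℂ) ^ k * d i x ∂(m i) + B (k + 1) z := fun k => by
    filter_upwards [hev] with z hz
    simp only [hB]
    rw [Finset.mul_sum, ← Finset.sum_add_distrib]
    refine Finset.sum_congr rfl fun i _ => ?_
    rw [(hm i).mul_CT (hc k i) (hz i)]
    simp only [pow_succ', mul_assoc]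
  have hU : IsOpen (⋂ i, cdom (K i)) := isOpen_iInter_of_finite fun i => isOpen_cdom (hm i).isCompact
  have hP0 : ∀ᶠ z in cobounded ℂ, B 0 z = P.eval z := by
    have h2 := eqOn_of_eq_nonreal (F := B 0) (G := fun z => P.eval z) hU
      (continuousOn_finsetSum _ fun i _ => ((hm i).continuousOn_CT (hc 0 i)).mono
        (Set.iInter_subset _ i)) P.continuous.continuousOn (fun z hz => by simpa [hB] using h z hz)
    filter_upwards [hev] with z hz
    exact h2 z (Set.mem_iInter.2 hz)
  have hP : P = 0 := eq_zero_of_tendsto_zero ((htend 0).congr' hP0)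
  have hall : ∀ k, ∀ᶠ z in cobounded ℂ, B k z = 0 := by
    intro k
    induction k with
    | zero => simpa [hP] using hP0
    | succ k ih =>
      have h3 : ∀ᶠ z in cobounded ℂ, B (k + 1) z = -∑ i, ∫ x, (x : ℂ) ^ k * d i x ∂(m i) := by
        filter_upwards [ih, hrec k] with z h4 h5
        rw [h4, mul_zero] at h5
        linear_combination -h5
      have h6 := tendsto_nhds_unique (tendsto_const_nhds.congr' (h3.mono fun _ h => h.symm))
        (htend (k + 1))
      filter_upwards [h3] with z hz
      rw [hz, h6]
  obtain ⟨z, hz1, hz2, hz3⟩ := ((hall k).and ((hall (k + 1)).and (hrec k))).exists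
  rw [hz1, hz2] at hz3
  simpa using hz3.symm

lemma sum_integral_eval_eq_zero (hm : ∀ i, IsConc (K i) (m i))
    (hd : ∀ i, ContinuousOn (d i) (K i)) {P : ℂ[X]}
    (h : ∀ z : ℂ, z.im ≠ 0 → ∑ i, CT (m i) (d i) z = P.eval z) (Q : ℂ[X]) :
    ∑ i, ∫ x, Q.eval (x : ℂ) * d i x ∂(m i) = 0 := by
  have h1 : Continuous fun x : ℝ => (x : ℂ) := Complex.continuous_ofReal
  have e : ∀ i, ∫ x, Q.eval (x : ℂ) * d i x ∂(m i)
      = ∑ k ∈ Finset.range (Q.natDegree + 1), Q.coeff k * ∫ x, (x : ℂ) ^ k * d i x ∂(m i) := by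
    intro i
    simp only [← integral_const_mul]
    have hc : ∀ k, ContinuousOn (fun x : ℝ => Q.coeff k * ((x : ℂ) ^ k * d i x)) (K i) := fun k =>
      continuousOn_const.fun_mul ((h1.pow k).continuousOn.fun_mul (hd i))
    rw [← integral_finsetSum _ fun k _ => (hm i).integrable (hc k)]
    simp only [eval_eq_sum_range, Finset.sum_mul, mul_assoc]
  simp only [e]
  rw [Finset.sum_comm]
  simp only [← Finset.mul_sum, sum_integral_pow_eq_zero hm hd h, mul_zero, Finset.sum_const_zero]

/-- Weierstrass approximation on one interval containing all the `K i`. -/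
lemma sum_integral_continuous_eq_zero (hm : ∀ i, IsConc (K i) (m i))
    (hd : ∀ i, ContinuousOn (d i) (K i)) {P : ℂ[X]}
    (h : ∀ z : ℂ, z.im ≠ 0 → ∑ i, CT (m i) (d i) z = P.eval z) {f : ℝ → ℝ} (hf : Continuous f) :
    ∑ i, ∫ x, (f x : ℂ) * d i x ∂(m i) = 0 := by
  obtain ⟨R, hR⟩ := (isBounded_iUnion.2 fun i => (hm i).isCompact.isBounded).exists_norm_le
  have hsub : ∀ i, ∀ x ∈ K i, x ∈ Set.Icc (-R) R := fun i x hx =>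
    abs_le.1 (hR x (Set.mem_iUnion.2 ⟨i, hx⟩))
  set Cst := ∑ i, ∫ x, ‖d i x‖ ∂(m i)
  have hC : 0 ≤ Cst := Finset.sum_nonneg fun i _ => integral_nonneg fun x => norm_nonneg _
  rw [← norm_eq_zero]
  refine le_antisymm (le_of_forall_pos_le_add fun ε hε => ?_) (norm_nonneg _)
  obtain ⟨p, hp⟩ := exists_polynomial_near_of_continuousOn (-R) R f hf.continuousOn (ε / (Cst + 1))
    (by positivity)
  have h2 := sum_integral_eval_eq_zero hm hd h (p.map Complex.ofRealHom)
  have h3 : ∑ i, ∫ x, (f x : ℂ) * d i x ∂(m i)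
      = ∑ i, ∫ x, ((f x - p.eval x : ℝ) : ℂ) * d i x ∂(m i) := by
    rw [← sub_zero (∑ i, ∫ x, (f x : ℂ) * d i x ∂(m i)), ← h2, ← Finset.sum_sub_distrib]
    refine Finset.sum_congr rfl fun i _ => ?_
    have hc : ContinuousOn (fun x : ℝ => (f x : ℂ) * d i x) (K i) :=
      (Complex.continuous_ofReal.comp hf).continuousOn.fun_mul (hd i)
    rw [← integral_sub ((hm i).integrable hc)
      ((hm i).integrable ((continuousOn_eval _ _).fun_mul (hd i)))]
    refine integral_congr_ae (Eventually.of_forall fun x => ?_)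
    have : eval (x : ℂ) (p.map Complex.ofRealHom) = ((p.eval x : ℝ) : ℂ) := by
      have := eval_map_apply (f := Complex.ofRealHom) (p := p) x
      simpa using this
    simp only [this]
    push_cast
    ring
  rw [h3, zero_add]
  calc ‖∑ i, ∫ x, ((f x - p.eval x : ℝ) : ℂ) * d i x ∂(m i)‖
      ≤ ∑ i, ‖∫ x, ((f x - p.eval x : ℝ) : ℂ) * d i x ∂(m i)‖ := norm_sum_le _ _
    _ ≤ ∑ i, ∫ x, ε / (Cst + 1) * ‖d i x‖ ∂(m i) := by
        refine Finset.sum_le_sum fun i _ => ?_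
        refine norm_integral_le_of_norm_le (((hm i).integrable (hd i)).norm.const_mul _) ?_
        filter_upwards [(hm i).ae_mem] with x hx
        rw [norm_mul, Complex.norm_real, Real.norm_eq_abs, abs_sub_comm]
        gcongr
        exact (hp x (hsub i x hx)).le
    _ = ε / (Cst + 1) * Cst := by simp only [integral_const_mul, ← Finset.mul_sum, Cst]
    _ ≤ ε := by
        rw [div_mul_eq_mul_div, div_le_iff₀ (by positivity)]
        nlinarith

end Moments

/-- A measure is determined by the singular part of its Cauchy transform. -/
lemma eq_of_CT_eq {ω₁ ω₂ : Measure ℝ} (h₁ : IsConc D ω₁) (h₂ : IsConc D ω₂) (hν : IsConc D' ν)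
    (hdis : Disjoint D D') (hg : ContinuousOn g D) (hg0 : ∀ x ∈ D, (g x).re ≠ 0)
    (hh : ContinuousOn h D') (P : ℂ[X])
    (heq : ∀ z : ℂ, z.im ≠ 0 → CT ω₁ g z = P.eval z + CT ν h z + CT ω₂ g z) : ω₁ = ω₂ := by
  have := h₁.isFinite
  have := h₂.isFinite
  refine ext_of_forall_integral_eq_of_IsFiniteMeasure fun u => ?_
  set g₁ : ℝ → ℝ := fun x => (g x).re
  have hg₁ : ContinuousOn g₁ D := Complex.continuous_re.comp_continuousOn hg
  classical
  -- Tietze extension: the test function vanishes on `D'`, so `ν` is invisible to it, and on `D` it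
  -- cancels the real part of the density.
  obtain ⟨f, hf⟩ : ∃ f : C(ℝ, ℝ), (∀ x ∈ D, f x = u x / g₁ x) ∧ ∀ x ∈ D', f x = 0 := by
    have hcl : IsClosed (D ∪ D') := h₁.isCompact.isClosed.union hν.isCompact.isClosed
    have hc : ContinuousOn (fun x => if x ∈ D then u x / g₁ x else 0) (D ∪ D') := by
      refine ContinuousOn.union_of_isClosed ?_ ?_ h₁.isCompact.isClosed hν.isCompact.isClosed
      · exact (u.continuous.continuousOn.div hg₁ hg0).congr fun x hx => by simp [hx]
      · exact (continuousOn_const (c := (0 : ℝ))).congr fun x hx => by simp [Set.disjoint_right.1 hdis hx]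
    obtain ⟨f, hf⟩ := ContinuousMap.exists_restrict_eq hcl
      ⟨_, continuousOn_iff_continuous_domRestrict.1 hc⟩
    have hf' : ∀ x ∈ D ∪ D', f x = if x ∈ D then u x / g₁ x else 0 := fun x hx =>
      congrArg (fun F : C((D ∪ D' : Set ℝ), ℝ) => F ⟨x, hx⟩) hf
    exact ⟨f, fun x hx => by rw [hf' x (Or.inl hx), if_pos hx],
      fun x hx => by rw [hf' x (Or.inr hx), if_neg (Set.disjoint_right.1 hdis hx)]⟩
  have key := sum_integral_continuous_eq_zero (ι := Fin 3) (K := ![D, D', D]) (m := ![ω₁, ν, ω₂])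
    (d := ![g, fun x => -h x, fun x => -g x]) (P := P)
    (by intro i; fin_cases i <;> simp [h₁, h₂, hν])
    (by intro i; fin_cases i <;> simp [hg, hh.fun_neg, hg.fun_neg])
    (by
      intro z hz
      simp only [Fin.sum_univ_three, Matrix.cons_val_zero, Matrix.cons_val_one, Matrix.cons_val_two,
        Matrix.head_cons, Matrix.tail_cons, CT_neg]
      rw [heq z hz]
      ring) f.continuous
  simp only [Fin.sum_univ_three, Matrix.cons_val_zero, Matrix.cons_val_one, Matrix.cons_val] at key
  have e0 : ∫ x, (f x : ℂ) * -h x ∂ν = 0 := by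
    rw [hν.integral_congr (f' := fun _ => 0) fun x hx => by simp [hf.2 x hx], integral_zero]
  have hre : ∀ ω : Measure ℝ, IsConc D ω → (∫ x, (f x : ℂ) * g x ∂ω).re = ∫ x, u x ∂ω := by
    intro ω hω
    have h3 := integral_re (𝕜 := ℂ) (hω.integrable
      ((Complex.continuous_ofReal.comp f.continuous).continuousOn.fun_mul hg))
    simp only [RCLike.re_to_complex] at h3
    refine h3.symm.trans (hω.integral_congr fun x hx => ?_)
    have h4 := hg0 x hx
    simp only [Function.comp, Complex.re_ofReal_mul, hf.1 x hx]
    exact div_mul_cancel₀ _ h4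
  rw [← hre ω₁ h₁, ← hre ω₂ h₂]
  rw [e0, add_zero] at key
  have e1 : ∫ x, (f x : ℂ) * -g x ∂ω₂ = -∫ x, (f x : ℂ) * g x ∂ω₂ := by
    rw [← integral_neg]
    simp only [mul_neg]
  rw [e1] at key
  rw [add_neg_eq_zero.1 key]

/-- A real continuous nonvanishing function on an interval has constant sign. -/
lemma sign_const (hD : Convex ℝ D) {f : ℝ → ℝ} (hf : ContinuousOn f D) (h0 : ∀ x ∈ D, f x ≠ 0) :
    (∀ x ∈ D, 0 < f x) ∨ (∀ x ∈ D, f x < 0) := by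
  by_contra! hcon
  obtain ⟨⟨x, hx, hx0⟩, y, hy, hy0⟩ := hcon
  have hsub : Set.uIcc x y ⊆ D := hD.ordConnected.uIcc_subset hx hy
  obtain ⟨w, hw, hw0⟩ := intermediate_value_uIcc (hf.mono hsub)
    (Set.mem_uIcc_of_le hx0 hy0 : (0 : ℝ) ∈ Set.uIcc (f x) (f y))
  exact h0 w (hsub hw) hw0

/-- The integral of a continuous function on `D` which is nonnegative, and positive off a finite
set, is positive. -/
lemma IsGen.integral_pos (hμ : IsGen D μ) {f : ℝ → ℝ} (hf : ContinuousOn f D)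
    (h0 : ∀ x ∈ D, 0 ≤ f x) {Z : Set ℝ} (hZ : Z.Finite) (h1 : ∀ x ∈ D, x ∉ Z → 0 < f x) :
    0 < ∫ x, f x ∂μ := by
  rw [integral_pos_iff_support_of_nonneg_ae (hμ.toIsConc.ae_mem.mono h0) (hμ.toIsConc.integrable hf)]
  refine pos_iff_ne_zero.2 fun hs => hμ.infinite Z hZ (measure_mono_null (fun x hx => ?_)
    (measure_union_null hs hμ.null))
  by_cases hxD : x ∈ D
  · exact Or.inl (h1 x hxD hx).ne'
  · exact Or.inr hxD

lemma IsGen.integral_ne_zero (hμ : IsGen D μ) {f : ℝ → ℝ} (hf : ContinuousOn f D)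
    (h0 : ∀ x ∈ D, f x ≠ 0) : ∫ x, f x ∂μ ≠ 0 := by
  rcases sign_const hμ.convex hf h0 with h | h
  · exact (hμ.integral_pos hf (fun x hx => (h x hx).le) Set.finite_empty fun x hx _ => h x hx).ne'
  · have := hμ.integral_pos hf.fun_neg (fun x hx => by linarith [h x hx]) Set.finite_empty
      fun x hx _ => by linarith [h x hx]
    rw [integral_neg] at this
    linarith

lemma IsGen.integral_ofReal_ne_zero (hμ : IsGen D μ) (hg : ContinuousOn g D)
    (hre : ∀ x ∈ D, (g x).im = 0) (h0 : ∀ x ∈ D, g x ≠ 0) : ∫ x, g x ∂μ ≠ 0 := by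
  have h := hμ.integral_ne_zero (f := fun x => (g x).re)
    (Complex.continuous_re.comp_continuousOn hg) fun x hx h =>
    h0 x hx (Complex.ext h (hre x hx))
  have h1 : ∫ x, g x ∂μ = ((∫ x, (g x).re ∂μ : ℝ) : ℂ) := by
    rw [← integral_complex_ofReal]
    exact hμ.toIsConc.integral_congr fun x hx => Complex.ext rfl (by simpa using hre x hx)
  rw [h1]
  exact_mod_cast h

/-- The Cauchy transform of a real density without zeros does not vanish. -/
lemma IsGen.CT_ne_zero (hμ : IsGen D μ) (hg : ContinuousOn g D) (hre : ∀ x ∈ D, (g x).im = 0)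
    (h0 : ∀ x ∈ D, g x ≠ 0) (hz : z ∈ cdom D) : CT μ g z ≠ 0 := by
  by_cases hz0 : z.im = 0
  · refine hμ.integral_ofReal_ne_zero (continuousOn_kernel hg hz) (fun x hx => ?_) fun x hx =>
      div_ne_zero (h0 x hx) (sub_ne_zero_of_mem_cdom hz hx)
    simp [Complex.div_im, hz0, hre x hx]
  -- Off the real line the imaginary part of the transform is `-z.im * ∫ g / |z - x|²`, whose
  -- integrand has constant sign.
  · have hcont : ContinuousOn (fun x => (g x).re / Complex.normSq (z - (x : ℂ))) D :=
      (Complex.continuous_re.comp_continuousOn hg).div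
        (Complex.continuous_normSq.comp (by fun_prop)).continuousOn
        fun x hx => (Complex.normSq_pos.2 (sub_ne_zero_of_mem_cdom hz hx)).ne'
    have h := hμ.integral_ne_zero hcont fun x hx => div_ne_zero
      (fun h => h0 x hx (Complex.ext h (hre x hx)))
      (Complex.normSq_pos.2 (sub_ne_zero_of_mem_cdom hz hx)).ne'
    intro hCT
    have h2 := integral_im (𝕜 := ℂ) (hμ.toIsConc.integrable_kernel hg hz)
    simp only [RCLike.im_to_complex] at h2
    have h4 : ∫ x, (g x / (z - (x : ℂ))).im ∂μ
        = ∫ x, -z.im * ((g x).re / Complex.normSq (z - (x : ℂ))) ∂μ := by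
      refine hμ.toIsConc.integral_congr fun x hx => ?_
      simp [Complex.div_im, hre x hx]
      ring
    rw [CT] at hCT
    rw [h4, integral_const_mul, hCT] at h2
    simp [hz0, h] at h2

end

/-! ### Spectral measures of self-adjoint operators -/

section

open Filter Topology Bornology CompactlySupported

/-- The spectral measure of a vector with respect to a bounded self-adjoint operator, described
through the resolvent. -/
lemma exists_spectral_measure {H : Type*} [NormedAddCommGroup H] [InnerProductSpace ℂ H]
    [CompleteSpace H] (T : H →L[ℂ] H) (hT : IsSelfAdjoint T) (v : H) :
    ∃ τ : Measure ℝ, IsConc (spectrum ℝ T) τ ∧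
      ∀ z : ℂ, z.im ≠ 0 → ∀ w : H, z • w - T w = v → inner ℂ v w = CT τ (fun _ => 1) z := by
  have hcpt : IsCompact (spectrum ℝ T) := ContinuousFunctionalCalculus.isCompact_spectrum T
  have : CompactSpace (spectrum ℝ T) := isCompact_iff_compactSpace.1 hcpt
  let cf : C_c(spectrum ℝ T, ℝ) → (H →L[ℂ] H) := fun f => cfcHom hT (f : C(spectrum ℝ T, ℝ))
  -- The functional `f ↦ Re ⟨v, f(T) v⟩` is positive; its Riesz measure is the spectral measure of
  -- `v`.
  let L : C_c(spectrum ℝ T, ℝ) →ₗ[ℝ] ℝ :=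
    { toFun := fun f => (inner ℂ v (cfcHom hT (f : C(spectrum ℝ T, ℝ)) v)).re
      map_add' := fun f g => by
        have : ((f + g : C_c(spectrum ℝ T, ℝ)) : C(spectrum ℝ T, ℝ)) = (f : C(spectrum ℝ T, ℝ)) + g :=
          rfl
        rw [this, map_add]
        simp
      map_smul' := fun c f => by
        have : ((c • f : C_c(spectrum ℝ T, ℝ)) : C(spectrum ℝ T, ℝ)) = c • (f : C(spectrum ℝ T, ℝ)) :=
          rfl
        rw [this, map_smul]
        simp [inner_smul_right_eq_smul] }
  have hpos : ∀ f : C_c(spectrum ℝ T, ℝ), 0 ≤ f → 0 ≤ L f := by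
    intro f hf
    have h1 : 0 ≤ cfcHom hT (f : C(spectrum ℝ T, ℝ)) := by
      rw [cfcHom_nonneg_iff]
      exact hf
    have h2 := (ContinuousLinearMap.nonneg_iff_isPositive _).1 h1
    have h3 := h2.re_inner_nonneg_right v
    exact h3
  let Λ : C_c(spectrum ℝ T, ℝ) →ₚ[ℝ] ℝ := PositiveLinearMap.mk₀ L hpos
  let τ₀ := RealRMK.rieszMeasure Λ
  have hτ₀ : IsFiniteMeasure τ₀ := ⟨isCompact_univ.measure_lt_top⟩
  have hmeas : Measurable (Subtype.val : spectrum ℝ T → ℝ) := measurable_subtype_coe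
  have hint : ∀ f : C(spectrum ℝ T, ℝ), ∫ x, f x ∂τ₀ = (inner ℂ v (cfcHom hT f v)).re := by
    intro f
    exact RealRMK.integral_rieszMeasure Λ (CompactlySupportedContinuousMap.continuousMapEquiv f)
  have hreal : ∀ f : C(spectrum ℝ T, ℝ),
      inner ℂ v (cfcHom hT f v) = ((∫ x, f x ∂τ₀ : ℝ) : ℂ) := by
    intro f
    rw [hint f]
    have hsa : IsSelfAdjoint (cfcHom hT f) := cfcHom_predicate hT f
    have := hsa.isSymmetric.coe_re_inner_self_apply v
    exact this.symm
  refine ⟨τ₀.map Subtype.val, ⟨hcpt, Measure.isFiniteMeasure_map _ _, ?_⟩, fun z hz w hw => ?_⟩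
  · rw [Measure.map_apply hmeas hcpt.measurableSet.compl]
    have : (Subtype.val ⁻¹' (spectrum ℝ T)ᶜ : Set (spectrum ℝ T)) = ∅ := by
      ext x
      simp
    rw [this, measure_empty]
  · have hne : ∀ x : ℝ, z - (x : ℂ) ≠ 0 := fun x h => hz (by
      have := congrArg Complex.im h
      simpa using this)
    have hc : Continuous fun x : spectrum ℝ T => 1 / (z - ((x : ℝ) : ℂ)) :=
      continuous_const.div (by fun_prop) fun x => hne x
    -- The functional calculus is over the reals, so `1 / (z - x)` is split into real and imaginary
    -- parts. `e1` and `e2` are the two parts of `(1 / (z - x)) (z - x) = 1`; applied to `w` they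
    -- give `w = u(T) v + i u'(T) v`.
    let u : C(spectrum ℝ T, ℝ) := ⟨fun x => (1 / (z - ((x : ℝ) : ℂ))).re, Complex.continuous_re.comp hc⟩
    let u' : C(spectrum ℝ T, ℝ) := ⟨fun x => (1 / (z - ((x : ℝ) : ℂ))).im, Complex.continuous_im.comp hc⟩
    let idc : C(spectrum ℝ T, ℝ) := ⟨Subtype.val, continuous_subtype_val⟩
    have hid : cfcHom hT idc = T := cfcHom_id hT
    have e1 : u * (algebraMap ℝ _ z.re - idc) - z.im • u' = 1 := by
      ext x
      have h1 := div_mul_cancel₀ (1 : ℂ) (hne x)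
      have h2 := congrArg Complex.re h1
      rw [Complex.mul_re] at h2
      simp only [Complex.sub_re, Complex.sub_im, Complex.ofReal_re, Complex.ofReal_im,
        Complex.one_re] at h2
      change (1 / (z - ((x : ℝ) : ℂ))).re * (z.re - x) - z.im * (1 / (z - ((x : ℝ) : ℂ))).im = 1
      linarith
    have e2 : u' * (algebraMap ℝ _ z.re - idc) + z.im • u = 0 := by
      ext x
      have h1 := div_mul_cancel₀ (1 : ℂ) (hne x)
      have h2 := congrArg Complex.im h1
      rw [Complex.mul_im] at h2
      simp only [Complex.sub_re, Complex.sub_im, Complex.ofReal_re, Complex.ofReal_im,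
        Complex.one_im] at h2
      change (1 / (z - ((x : ℝ) : ℂ))).im * (z.re - x) + z.im * (1 / (z - ((x : ℝ) : ℂ))).re = 0
      linarith
    set U := cfcHom hT u
    set W := cfcHom hT u'
    have f1 : U (z.re • w - T w) - z.im • W w = w := by
      have := congrArg (fun F => cfcHom hT F) e1
      rw [map_sub, map_mul, map_sub, map_smul, map_one, hid, AlgHomClass.commutes] at this
      exact congrArg (fun A : H →L[ℂ] H => A w) this
    have f2 : W (z.re • w - T w) + z.im • U w = 0 := by
      have := congrArg (fun F => cfcHom hT F) e2
      rw [map_add, map_mul, map_sub, map_smul, map_zero, hid, AlgHomClass.commutes] at this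
      exact congrArg (fun A : H →L[ℂ] H => A w) this
    have h3 : w = U v + Complex.I • W v := by
      have hz' : v = (z.re • w - T w) + (z.im : ℂ) • (Complex.I • w) := by
        rw [← hw]
        conv_lhs => rw [← Complex.re_add_im z]
        rw [add_smul, mul_smul, Complex.coe_smul]
        abel
      have g1 : U v = w + z.im • W w + (z.im : ℂ) • (Complex.I • U w) := by
        rw [hz', map_add, map_smul, map_smul, ← sub_eq_iff_eq_add.1 f1]
      have g2 : W v = -(z.im • U w) + (z.im : ℂ) • (Complex.I • W w) := by
        rw [hz', map_add, map_smul, map_smul, ← eq_neg_of_add_eq_zero_left f2]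
      rw [g1, g2, smul_add, ← Complex.coe_smul, ← Complex.coe_smul]
      simp only [smul_neg, smul_smul]
      have : Complex.I * ((z.im : ℂ) * Complex.I) = -(z.im : ℂ) := by
        linear_combination (z.im : ℂ) * Complex.I_mul_I
      rw [this]
      module
    have h4 : CT (τ₀.map Subtype.val) (fun _ => 1) z
        = ((∫ x, u x ∂τ₀ : ℝ) : ℂ) + Complex.I * ((∫ x, u' x ∂τ₀ : ℝ) : ℂ) := by
      rw [CT, integral_map hmeas.aemeasurable]
      · have hi : Integrable (fun x : spectrum ℝ T => 1 / (z - ((x : ℝ) : ℂ))) τ₀ := by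
          rw [← integrableOn_univ]
          exact hc.continuousOn.integrableOn_compact isCompact_univ
        rw [← integral_re_add_im hi, mul_comm Complex.I]
        rfl
      · exact (continuous_const.div (by fun_prop) hne).aestronglyMeasurable
    rw [h4]
    conv_lhs => rw [h3]
    rw [inner_add_right, inner_smul_right, hreal, hreal]

end

/-! ### Rank one perturbation of the multiplication operator -/

section

open Filter Topology Bornology InnerProductSpace
open scoped ENNReal

variable {D D' : Set ℝ} {μ ν ω : Measure ℝ} {g h : ℝ → ℂ} {z : ℂ} {w : ℝ → ℝ}

section Density

/-- The measure with the real density `w`. -/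
noncomputable def wdens (ω : Measure ℝ) (w : ℝ → ℝ) : Measure ℝ :=
  ω.withDensity fun x => ENNReal.ofReal (w x)

lemma IsConc.aemeasurable_ofReal (hω : IsConc D ω) (hw : ContinuousOn w D) :
    AEMeasurable (fun x => ENNReal.ofReal (w x)) ω :=
  (hω.integrable hw).aestronglyMeasurable.aemeasurable.ennreal_ofReal

lemma IsConc.wd (hω : IsConc D ω) (hw : ContinuousOn w D) : IsConc D (wdens ω w) where
  isCompact := hω.isCompact
  isFinite := isFiniteMeasure_withDensity_ofReal (hω.integrable hw).hasFiniteIntegral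
  null := withDensity_absolutelyContinuous _ _ hω.null

lemma IsConc.integral_wd (hω : IsConc D ω) (hw : ContinuousOn w D) (h0 : ∀ x ∈ D, 0 ≤ w x)
    (f : ℝ → ℂ) : ∫ x, f x ∂(wdens ω w) = ∫ x, (w x : ℂ) * f x ∂ω := by
  rw [wdens, integral_withDensity_eq_integral_toReal_smul₀ (hω.aemeasurable_ofReal hw)
    (Eventually.of_forall fun x => ENNReal.ofReal_lt_top)]
  refine hω.integral_congr fun x hx => ?_
  rw [ENNReal.toReal_ofReal (h0 x hx), Complex.real_smul]

lemma IsConc.CT_wd (hω : IsConc D ω) (hw : ContinuousOn w D) (h0 : ∀ x ∈ D, 0 ≤ w x)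
    (g : ℝ → ℂ) (z : ℂ) : CT (wdens ω w) g z = CT ω (fun x => (w x : ℂ) * g x) z := by
  rw [CT, hω.integral_wd hw h0, CT]
  simp only [mul_div_assoc]

lemma IsGen.wd (hω : IsGen D ω) (hw : ContinuousOn w D) (h0 : ∀ x ∈ D, 0 < w x) :
    IsGen D (wdens ω w) where
  toIsConc := hω.toIsConc.wd hw
  convex := hω.convex
  infinite Z hZ hZ0 := by
    rw [wdens, withDensity_apply_eq_zero' (hω.toIsConc.aemeasurable_ofReal hw)] at hZ0
    refine hω.infinite Z hZ (measure_mono_null (fun x hx => ?_) (measure_union_null hZ0 hω.null))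
    by_cases hxD : x ∈ D
    · exact Or.inl ⟨by simpa using h0 x hxD, hx⟩
    · exact Or.inr hxD

end Density

section Multiplication

/-- The operator of multiplication by an essentially bounded function. -/
noncomputable def mulOp (φ : Lp ℂ ∞ μ) : Lp ℂ 2 μ →L[ℂ] Lp ℂ 2 μ :=
  LinearMap.mkContinuous
    { toFun := fun f => φ • f
      map_add' := fun f g => Lp.add_smul φ f g
      map_smul' := fun c f => (Lp.smul_comm c φ f).symm } ‖φ‖ fun f => Lp.norm_smul_le φ f

lemma coeFn_mulOp (φ : Lp ℂ ∞ μ) (f : Lp ℂ 2 μ) : mulOp φ f =ᵐ[μ] fun x => φ x * f x :=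
  Lp.coeFn_lpSMul φ f

lemma IsConc.memLp (hμ : IsConc D μ) (hg : ContinuousOn g D) (p : ℝ≥0∞) : MemLp g p μ := by
  have := hμ.isFinite
  obtain ⟨M, hM⟩ := hμ.isCompact.exists_bound_of_continuousOn hg
  exact MemLp.of_bound (hμ.integrable hg).aestronglyMeasurable M (hμ.ae_mem.mono hM)

/-- For a rank one perturbation of the multiplication operator: the reciprocal of
`c + ∫ dμ(x) / (z - x)`. -/
lemma IsConc.exists_inv_eq_of_ne_zero (hμ : IsConc D μ) {c : ℝ} (hc : c ≠ 0)
    (hF : ∀ z : ℂ, z.im ≠ 0 → c + CT μ (fun _ => 1) z ≠ 0) :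
    ∃ (K : Set ℝ) (τ : Measure ℝ), IsConc K τ ∧
      (∀ y ∈ K, y ∈ D ∨ (c : ℂ) + CT μ (fun _ => 1) y = 0) ∧
      ∀ z : ℂ, z.im ≠ 0 → 1 / (c + CT μ (fun _ => 1) z) = 1 / c - CT τ (fun _ => 1) z := by
  have hc' : (c : ℂ) ≠ 0 := by exact_mod_cast hc
  have hone : ContinuousOn (fun _ : ℝ => (1 : ℂ)) D := continuousOn_const
  have hidc : ContinuousOn (fun x : ℝ => (x : ℂ)) D := Complex.continuous_ofReal.continuousOn
  set e : Lp ℂ 2 μ := (hμ.memLp hone 2).toLp _ with he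
  have he_ae : e =ᵐ[μ] fun _ => 1 := MemLp.coeFn_toLp _
  set xφ : Lp ℂ ∞ μ := (hμ.memLp hidc ∞).toLp _
  have hx_ae : xφ =ᵐ[μ] fun x => (x : ℂ) := MemLp.coeFn_toLp _
  set M := mulOp xφ
  have hM : ∀ f, M f =ᵐ[μ] fun x => (x : ℂ) * f x := fun f => by
    filter_upwards [coeFn_mulOp xφ f, hx_ae] with x h1 h2
    rw [h1, h2]
  have hR : ∀ z ∈ cdom D, ∃ R : Lp ℂ 2 μ →L[ℂ] Lp ℂ 2 μ,
      ∀ f, R f =ᵐ[μ] fun x => 1 / (z - (x : ℂ)) * f x := fun z hz => by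
    refine ⟨mulOp ((hμ.memLp (continuousOn_kernel hone hz) ∞).toLp _), fun f => ?_⟩
    filter_upwards [coeFn_mulOp ((hμ.memLp (continuousOn_kernel hone hz) ∞).toLp _) f,
      MemLp.coeFn_toLp (hμ.memLp (continuousOn_kernel hone hz) ∞)] with x h1 h2
    rw [h1, h2]
  choose! R hR using hR
  have hRl : ∀ z ∈ cdom D, ∀ f, z • R z f - M (R z f) = f := fun z hz f => by
    apply Lp.ext
    filter_upwards [hR z hz f, hM (R z f), Lp.coeFn_sub (z • R z f) (M (R z f)),
      Lp.coeFn_smul z (R z f), hμ.ae_mem] with x h1 h2 h3 h4 h5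
    have := sub_ne_zero_of_mem_cdom hz h5
    rw [h3, Pi.sub_apply, h4, Pi.smul_apply, h2, h1, smul_eq_mul]
    field_simp
  have hRr : ∀ z ∈ cdom D, ∀ f, R z (z • f - M f) = f := fun z hz f => by
    apply Lp.ext
    filter_upwards [hR z hz (z • f - M f), hM f, Lp.coeFn_sub (z • f) (M f),
      Lp.coeFn_smul z f, hμ.ae_mem] with x h1 h2 h3 h4 h5
    have := sub_ne_zero_of_mem_cdom hz h5
    rw [h1, h3, Pi.sub_apply, h4, Pi.smul_apply, h2, smul_eq_mul]
    field_simp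
  have hRe : ∀ z ∈ cdom D, inner ℂ e (R z e) = CT μ (fun _ => 1) z := fun z hz => by
    rw [L2.inner_def, CT]
    refine integral_congr_ae ?_
    filter_upwards [he_ae, hR z hz e] with x h1 h2
    rw [h2, h1]
    simp
  -- With `R = (z - M)⁻¹` and `b = ⟨e, R e⟩ = CT μ 1 z`, the vector `w = c/(c+b) • R e` solves `(z -
  -- T) w = e`. Thus `⟨e, w⟩ = c b/(c+b)` and `1/(c+b) = 1/c - c⁻² ⟨e, w⟩`, which explains the
  -- factor `(c ^ 2)⁻¹` below.
  set T : Lp ℂ 2 μ →L[ℂ] Lp ℂ 2 μ := M - (c : ℂ)⁻¹ • rankOne ℂ e e with hTdef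
  have hTapp : ∀ f, T f = M f - (c : ℂ)⁻¹ • (inner ℂ e f • e) := fun f => rfl
  have hTsa : IsSelfAdjoint T := by
    rw [ContinuousLinearMap.isSelfAdjoint_iff_isSymmetric]
    have h1 : ∀ f f' : Lp ℂ 2 μ, inner ℂ (M f) f' = inner ℂ f (M f') := fun f f' => by
      rw [L2.inner_def, L2.inner_def]
      refine integral_congr_ae ?_
      filter_upwards [hM f, hM f'] with x h1 h2
      rw [h1, h2]
      simp
      ring
    intro f f'
    simp only [ContinuousLinearMap.coe_coe, hTapp, inner_sub_left, inner_sub_right, h1,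
      inner_smul_left, inner_smul_right, map_inv₀, Complex.conj_ofReal, inner_conj_symm]
    ring
  obtain ⟨τ₀, hτ₀, hτ₀z⟩ := exists_spectral_measure T hTsa e
  have hw : ContinuousOn (fun _ : ℝ => (c ^ 2)⁻¹) (spectrum ℝ T) := continuousOn_const
  refine ⟨spectrum ℝ T, wdens τ₀ fun _ => (c ^ 2)⁻¹, hτ₀.wd hw, fun y hy => ?_, fun z hz => ?_⟩
  -- At a real `y` off `D` with `c + b ≠ 0`, the Sherman–Morrison formula inverts `y - T`, so `y` is
  -- not in the spectrum.
  · by_contra! hcon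
    obtain ⟨hyD, hy0⟩ := hcon
    have hyc := ofReal_mem_cdom hyD
    refine hy ?_
    change IsUnit _
    rw [ContinuousLinearMap.isUnit_iff_bijective]
    have happ : ∀ f, (algebraMap ℝ (Lp ℂ 2 μ →L[ℂ] Lp ℂ 2 μ) y - T) f
        = ((y : ℂ) • f - M f) + (c : ℂ)⁻¹ • (inner ℂ e f • e) := fun f => by
      have : (algebraMap ℝ (Lp ℂ 2 μ →L[ℂ] Lp ℂ 2 μ) y - T) f = (y : ℂ) • f - T f := rfl
      rw [this, hTapp, sub_sub_eq_add_sub, sub_eq_add_neg, sub_eq_add_neg]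
      abel
    constructor
    · rw [injective_iff_map_eq_zero]
      intro f hf
      rw [happ] at hf
      have h1 := congrArg (R y) hf
      rw [map_add, hRr _ hyc, map_smul, map_smul, map_zero] at h1
      have h2 := congrArg (inner ℂ e) h1
      rw [inner_add_right, inner_smul_right, inner_smul_right, hRe _ hyc, inner_zero_right] at h2
      have h3 : inner ℂ e f * (c + CT μ (fun _ => 1) y) = 0 := by
        field_simp at h2
        linear_combination h2
      have h4 := (mul_eq_zero.1 h3).resolve_right hy0
      rw [h4, zero_smul, smul_zero, add_zero] at h1
      exact h1
    · intro f
      refine ⟨R y f - (inner ℂ e (R y f) / (c + CT μ (fun _ => 1) y)) • R y e, ?_⟩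
      rw [happ, map_sub, map_smul, inner_sub_right, inner_smul_right, hRe _ hyc]
      have h1 := hRl _ hyc f
      have h2 := hRl _ hyc e
      set a := inner ℂ e (R y f)
      set b := CT μ (fun _ => 1) (y : ℂ)
      have h3 : (y : ℂ) • (R y f - (a / (c + b)) • R y e) - (M (R y f) - (a / (c + b)) • M (R y e))
          = f - (a / (c + b)) • e := by
        conv_rhs => rw [← h1, ← h2]
        module
      rw [h3, smul_smul, sub_add, ← sub_smul]
      have h4 : a / (c + b) - (c : ℂ)⁻¹ * (a - a / (c + b) * b) = 0 := by
        field_simp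
        ring
      rw [h4, zero_smul, sub_zero]
  · have hzc := mem_cdom_of_im D hz
    have hFz := hF z hz
    have h1 := hτ₀z z hz ((c / (c + CT μ (fun _ => 1) z)) • R z e) (by
      rw [hTapp, map_smul, inner_smul_right, hRe z hzc]
      have h2 := hRl z hzc e
      set b := CT μ (fun _ => 1) z
      have h3 : z • (c / (c + b)) • (R z) e - (c / (c + b)) • M ((R z) e) = (c / (c + b)) • e := by
        conv_rhs => rw [← h2]
        module
      rw [← sub_add, h3, smul_smul, ← add_smul]
      have h4 : c / (c + b) + (c : ℂ)⁻¹ * (c / (c + b) * b) = 1 := by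
        field_simp
      rw [h4, one_smul])
    rw [inner_smul_right, hRe z hzc] at h1
    rw [hτ₀.CT_wd hw fun x _ => by positivity, CT_const_mul, ← h1]
    push_cast
    field_simp
    ring

end Multiplication

end

/-! ### Reciprocals of Cauchy transforms -/

section

open Filter Topology Bornology

variable {D D' : Set ℝ} {μ ν ω τ : Measure ℝ} {g h : ℝ → ℂ} {z : ℂ} {w : ℝ → ℝ}

/-- A measure whose Cauchy transform is, up to a polynomial, the reciprocal of a function
`c + ∫ dμ(x) / (z - x)` is not concentrated on a finite set if `μ` is not. -/
lemma infinite_of_inv_eq (hμ : IsGen D μ) (hτ : IsConc D' τ) (c : ℂ) (P : ℂ[X])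
    (hF : ∀ z : ℂ, z.im ≠ 0 → c + CT μ (fun _ => 1) z ≠ 0)
    (heq : ∀ z : ℂ, z.im ≠ 0 → 1 / (c + CT μ (fun _ => 1) z) = P.eval z - CT τ (fun _ => 1) z)
    (Z : Set ℝ) (hZ : Z.Finite) : τ Zᶜ ≠ 0 := by
  intro hZ0
  have hone : ∀ s : Set ℝ, ContinuousOn (fun _ : ℝ => (1 : ℂ)) s := fun s => continuousOn_const
  -- If `τ` lived on `Z`, then `q` would clear the denominators and `q = p * (c + CT μ 1)` for a
  -- polynomial `p`. Then `CT μ p` is a polynomial, `p dμ` has no moments, and testing against the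
  -- conjugate of `p` gives `∫ |p|² dμ = 0`.
  set q : ℂ[X] := ∏ x ∈ hZ.toFinset, (X - C (x : ℂ)) with hq
  have hqm : q.Monic := monic_prod_of_monic _ _ fun x _ => monic_X_sub_C _
  have hq0 : ∀ x ∈ Z, q.eval (x : ℂ) = 0 := fun x hx => by
    rw [hq, eval_prod]
    exact Finset.prod_eq_zero (hZ.mem_toFinset.2 hx) (by simp)
  obtain ⟨Q, hQ⟩ := hτ.exists_poly_mul_CT (hone D') q
  have h0 : ∀ z, CT τ (fun x => q.eval (x : ℂ) * 1) z = 0 := fun z => by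
    refine integral_eq_zero_of_ae ?_
    have : ∀ᵐ x ∂τ, x ∈ Z := by
      rw [ae_iff]
      exact hZ0
    filter_upwards [this] with x hx
    simp [hq0 x hx]
  set p := q * P - Q with hp
  have hpF : ∀ z : ℂ, z.im ≠ 0 → q.eval z = p.eval z * (c + CT μ (fun _ => 1) z) := fun z hz => by
    have h1 := hQ z (mem_cdom_of_im D' hz)
    rw [h0 z, add_zero] at h1
    have h2 := heq z hz
    rw [div_eq_iff (hF z hz)] at h2
    simp only [hp, eval_sub, eval_mul]
    linear_combination q.eval z * h2 - h1 * (c + CT μ (fun _ => 1) z)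
  obtain ⟨S, hS⟩ := hμ.toIsConc.exists_poly_mul_CT (hone D) p
  have hconj : ∀ x : ℝ, (p.map (starRingEnd ℂ)).eval (x : ℂ) = (starRingEnd ℂ) (p.eval (x : ℂ)) :=
    fun x => by
      have := eval_map_apply (f := starRingEnd ℂ) (p := p) (x : ℂ)
      simpa using this
  have key := sum_integral_eval_eq_zero (ι := Fin 1) (K := fun _ => D) (m := fun _ => μ)
    (d := fun _ x => p.eval (x : ℂ) * 1) (P := q - C c * p - S) (fun _ => hμ.toIsConc)
    (fun _ => (continuousOn_eval p D).fun_mul (hone D)) (fun z hz => by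
      have h1 := hS z (mem_cdom_of_im D hz)
      simp only [Finset.univ_unique, Finset.sum_singleton, eval_sub, eval_mul, eval_C, hpF z hz]
      linear_combination -h1) (p.map (starRingEnd ℂ))
  simp only [Finset.univ_unique, Finset.sum_singleton, hconj, mul_one] at key
  have h1 : ∫ x : ℝ, (starRingEnd ℂ) (p.eval (x : ℂ)) * p.eval (x : ℂ) ∂μ
      = ((∫ x : ℝ, Complex.normSq (p.eval (x : ℂ)) ∂μ : ℝ) : ℂ) := by
    rw [← integral_complex_ofReal]
    simp only [Complex.normSq_eq_conj_mul_self]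
  rw [h1, Complex.ofReal_eq_zero] at key
  have hp0 : p ≠ 0 := by
    intro hp0
    have : q = 0 := by
      refine Polynomial.funext fun z => ?_
      have h3 := eqOn_of_eq_nonreal isOpen_univ q.continuous.continuousOn
        (G := fun _ => 0) continuousOn_const (fun z hz => by rw [hpF z hz, hp0]; simp) z trivial
      simpa using h3
    exact hqm.ne_zero this
  refine (hμ.integral_pos (f := fun x => Complex.normSq (p.eval (x : ℂ)))
    (Complex.continuous_normSq.comp_continuousOn (continuousOn_eval p D))
    (fun x _ => Complex.normSq_nonneg _) (Z := (fun x : ℝ => (x : ℂ)) ⁻¹' {y | p.IsRoot y})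
    ((finite_setOfPred_isRoot hp0).preimage Complex.ofReal_injective.injOn)
    fun x _ hx => Complex.normSq_pos.2 hx).ne' key

/-- The spectral measure can leave `D` only at zeros of `c + CT μ 1`, and there are none. The case
`c = 0` is reduced to a nonzero constant by a linear factor. -/
lemma IsGen.exists_inv_eq_of_one (hμ : IsGen D μ) (c : ℝ)
    (hF : ∀ z ∈ cdom D, c + CT μ (fun _ => 1) z ≠ 0) :
    ∃ τ, IsGen D τ ∧ ∃ P : ℂ[X], ∀ z ∈ cdom D,
      1 / (c + CT μ (fun _ => 1) z) = P.eval z - CT τ (fun _ => 1) z := by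
  have hone : ContinuousOn (fun _ : ℝ => (1 : ℂ)) D := continuousOn_const
  have hF' : ∀ z : ℂ, z.im ≠ 0 → c + CT μ (fun _ => 1) z ≠ 0 := fun z hz =>
    hF z (mem_cdom_of_im D hz)
  obtain ⟨τ, hτ, P, hP⟩ : ∃ τ, IsConc D τ ∧ ∃ P : ℂ[X], ∀ z : ℂ, z.im ≠ 0 →
      1 / (c + CT μ (fun _ => 1) z) = P.eval z - CT τ (fun _ => 1) z := by
    by_cases hc : c = 0
    · obtain ⟨R, hR⟩ := hμ.isCompact.isBounded.exists_norm_le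
      -- A point to the left of `D`: `(z - p) * CT μ 1 z` equals `m₀` plus the transform of `(x - p)
      -- dμ`, and the constant `m₀` is the mass of `μ`, which is not zero.
      set p : ℝ := -R - 1
      have hpD : ∀ x ∈ D, 0 < x - p := fun x hx => by
        have := (abs_le.1 (hR x hx)).1
        simp only [p]
        linarith
      have hw : ∀ s, ContinuousOn (fun x : ℝ => x - p) s := fun s => by fun_prop
      have hμ₁ := hμ.wd (hw D) hpD
      have := hμ.isFinite
      set m₀ : ℝ := ∫ _, (1 : ℝ) ∂μ with hm₀
      have hm₀ne : m₀ ≠ 0 :=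
        (hμ.integral_pos continuousOn_const (fun _ _ => zero_le_one) Set.finite_empty
          fun _ _ _ => zero_lt_one).ne'
      have hm₀c : ∫ _, (1 : ℂ) ∂μ = m₀ := by
        rw [hm₀, ← integral_complex_ofReal]
        simp
      have hrel : ∀ z ∈ cdom D, m₀ + CT (wdens μ fun x => x - p) (fun _ => 1) z
          = (z - p) * CT μ (fun _ => 1) z := fun z hz => by
        rw [hμ.toIsConc.CT_wd (hw D) fun x hx => (hpD x hx).le]
        have h1 := hμ.toIsConc.mul_CT hone hz
        have h2 : CT μ (fun x => ((x - p : ℝ) : ℂ) * 1) z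
            = CT μ (fun x => (x : ℂ) * 1) z - p * CT μ (fun _ => 1) z := by
          rw [sub_eq_add_neg, ← neg_mul, ← CT_const_mul, ← hμ.toIsConc.CT_add _ _ hz]
          · congr 1
            ext x
            push_cast
            ring
          · exact Complex.continuous_ofReal.continuousOn.fun_mul hone
          · fun_prop
        rw [h2]
        rw [hm₀c] at h1
        linear_combination -h1
      have hpne : ∀ z : ℂ, z.im ≠ 0 → z - (p : ℂ) ≠ 0 := fun z hz h => hz (by
        have := congrArg Complex.im h
        simpa using this)
      obtain ⟨K, τ₁, hτ₁, hK, hτ₁z⟩ := hμ₁.toIsConc.exists_inv_eq_of_ne_zero hm₀ne (fun z hz => by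
        rw [hrel z (mem_cdom_of_im D hz)]
        refine mul_ne_zero (hpne z hz) ?_
        simpa [hc] using hF' z hz)
      have hKD : ∀ y ∈ K, y ∈ D ∨ y = p := fun y hy => by
        by_cases hyD : y ∈ D
        · exact Or.inl hyD
        · have h1 := (hK y hy).resolve_left hyD
          rw [hrel y (ofReal_mem_cdom hyD)] at h1
          have h2 := hF y (ofReal_mem_cdom hyD)
          rw [hc, Complex.ofReal_zero, zero_add] at h2
          have h3 := (mul_eq_zero.1 h1).resolve_right h2
          exact Or.inr (by exact_mod_cast sub_eq_zero.1 h3)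
      have hK0 : ∀ y ∈ K, 0 ≤ y - p := fun y hy => by
        rcases hKD y hy with h | h
        · exact (hpD y h).le
        · simp [h]
      have hτ := hτ₁.wd (hw K)
      obtain ⟨Q, hQ⟩ := hτ₁.exists_poly_mul_CT (g := fun _ => 1) continuousOn_const (X - C (p : ℂ))
      refine ⟨wdens τ₁ fun x => x - p, ⟨hμ.isCompact, hτ.isFinite, ?_⟩,
        (X - C (p : ℂ)) * C (1 / (m₀ : ℂ)) - Q, fun z hz => ?_⟩
      -- The factor `z - p` may put an atom at `p`, the only possible point of `K` outside `D`; the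
      -- density `x - p` removes it.
      · have h1 : wdens τ₁ (fun x => x - p) ({x | ENNReal.ofReal (x - p) ≠ 0}ᶜ) = 0 := by
          rw [wdens, withDensity_apply_eq_zero' (hτ₁.aemeasurable_ofReal (hw K))]
          simp
        refine measure_mono_null (fun x hx => ?_) (measure_union_null h1 hτ.null)
        by_cases hxK : x ∈ K
        · refine Or.inl ?_
          rw [(hKD x hxK).resolve_left hx]
          simp
        · exact Or.inr hxK
      · have h1 := hτ₁z z hz
        rw [hrel z (mem_cdom_of_im D hz)] at h1
        have h2 := hQ z (mem_cdom_of_im K hz)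
        rw [hτ₁.CT_wd (hw K) hK0]
        have h3 : CT τ₁ (fun x => eval (x : ℂ) (X - C (p : ℂ)) * 1) z
            = CT τ₁ (fun x => ((x - p : ℝ) : ℂ) * 1) z := by
          congr 1
          ext x
          simp
        rw [h3] at h2
        have h4 := hpne z hz
        have h5 := hF' z hz
        rw [hc, Complex.ofReal_zero, zero_add] at h5 ⊢
        have h6 : 1 / CT μ (fun _ => 1) z = (z - p) * (1 / ((z - p) * CT μ (fun _ => 1) z)) := by
          field_simp
        rw [h6, h1]
        simp only [eval_sub, eval_mul, eval_X, eval_C] at h2 ⊢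
        linear_combination -h2
    · obtain ⟨K, τ, hτ, hK, hz⟩ := hμ.toIsConc.exists_inv_eq_of_ne_zero hc hF'
      refine ⟨τ, ⟨hμ.isCompact, hτ.isFinite, measure_mono_null (Set.compl_subset_compl.2 ?_) hτ.null⟩,
        C (1 / (c : ℂ)), fun z hz' => by rw [hz z hz', eval_C]⟩
      intro y hy
      by_contra hyD
      exact hF y (ofReal_mem_cdom hyD) ((hK y hy).resolve_left hyD)
  refine ⟨τ, ⟨hτ, hμ.convex, infinite_of_inv_eq hμ hτ c P hF' hP⟩, P, ?_⟩
  refine eqOn_of_eq_nonreal (isOpen_cdom hμ.isCompact) ?_ ?_ hP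
  · exact continuousOn_const.div (continuousOn_const.add (hμ.toIsConc.continuousOn_CT hone)) hF
  · exact P.continuous.continuousOn.sub (hτ.continuousOn_CT hone)

/-- The reciprocal of a nonvanishing function `c + ∫ g(x) dω(x) / (z - x)` has, up to a polynomial,
a representation of the same kind. -/
lemma IsGen.exists_inv_eq (hω : IsGen D ω) (hg : ContinuousOn g D) (hre : ∀ x ∈ D, (g x).im = 0)
    (h0 : ∀ x ∈ D, g x ≠ 0) (c : ℝ) (hF : ∀ z ∈ cdom D, c + CT ω g z ≠ 0) :
    ∃ τ, IsGen D τ ∧ ∃ P : ℂ[X], ∀ z ∈ cdom D, 1 / (c + CT ω g z) = P.eval z - CT τ g z := by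
  have hgre : ContinuousOn (fun x => (g x).re) D := Complex.continuous_re.comp_continuousOn hg
  have hg0 : ∀ x ∈ D, (g x).re ≠ 0 := fun x hx h => h0 x hx (Complex.ext h (hre x hx))
  -- `s` is the constant sign of `g`. The case of density one is applied to the positive measure `s
  -- g dω`, and `s g` is divided out of the resulting measure at the end.
  obtain ⟨s, hs, hsg⟩ : ∃ s : ℝ, s * s = 1 ∧ ∀ x ∈ D, 0 < s * (g x).re := by
    rcases sign_const hω.convex hgre hg0 with h | h
    · exact ⟨1, by norm_num, fun x hx => by simpa using h x hx⟩
    · exact ⟨-1, by norm_num, fun x hx => by simpa using h x hx⟩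
  have hs' : (s : ℂ) * s = 1 := by exact_mod_cast hs
  have hs0 : (s : ℂ) ≠ 0 := fun h => by simp [h] at hs'
  have hw : ContinuousOn (fun x => s * (g x).re) D := continuousOn_const.fun_mul hgre
  have hge : ∀ x ∈ D, g x = ((g x).re : ℂ) := fun x hx => Complex.ext rfl (by simpa using hre x hx)
  have hCT : ∀ z, CT (wdens ω fun x => s * (g x).re) (fun _ => 1) z = s * CT ω g z := fun z => by
    rw [hω.toIsConc.CT_wd hw fun x hx => (hsg x hx).le, ← CT_const_mul]
    refine hω.toIsConc.CT_congr (fun x hx => ?_) z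
    conv_rhs => rw [hge x hx]
    push_cast
    ring
  have hrel : ∀ z, ((s * c : ℝ) : ℂ) + CT (wdens ω fun x => s * (g x).re) (fun _ => 1) z
      = s * (c + CT ω g z) := fun z => by
    rw [hCT]
    push_cast
    ring
  obtain ⟨τ, hτ, P, hP⟩ := (hω.wd hw hsg).exists_inv_eq_of_one (s * c) fun z hz => by
    rw [hrel]
    exact mul_ne_zero hs0 (hF z hz)
  have hw' : ContinuousOn (fun x => (s * (g x).re)⁻¹) D := hw.inv₀ fun x hx => (hsg x hx).ne'
  have hw0 : ∀ x ∈ D, 0 < (s * (g x).re)⁻¹ := fun x hx => inv_pos.2 (hsg x hx)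
  refine ⟨wdens τ fun x => (s * (g x).re)⁻¹, hτ.wd hw' hw0, C (s : ℂ) * P, fun z hz => ?_⟩
  have h1 := hP z hz
  rw [hrel] at h1
  have h2 : CT (wdens τ fun x => (s * (g x).re)⁻¹) g z = s * CT τ (fun _ => 1) z := by
    rw [hτ.toIsConc.CT_wd hw' fun x hx => (hw0 x hx).le, ← CT_const_mul]
    refine hτ.toIsConc.CT_congr (fun x hx => ?_) z
    have h5 := hge x hx
    have h6 : ((g x).re : ℂ) ≠ 0 := by exact_mod_cast hg0 x hx
    set r := (g x).re
    rw [h5]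
    push_cast
    field_simp
    linear_combination -hs'
  have h3 := hF z hz
  have h4 : 1 / (c + CT ω g z) = s * (1 / (s * (c + CT ω g z))) := by
    field_simp
  rw [h4, h1, h2, eval_mul, eval_C]
  ring

end

/-! ### Minors, their signs and the determinant identities -/

section

open Filter Topology Bornology

section Signs

/-- The sign of moving `k` in front of the increasingly ordered set `S`. -/
def eps (S : Finset ℕ) (k : ℕ) : ℂ := (-1) ^ (S.filter (· < k)).card

lemma eps_mul_self (S : Finset ℕ) (k : ℕ) : eps S k * eps S k = 1 := by
  rw [eps, ← mul_pow]
  simp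

lemma eps_ne_zero (S : Finset ℕ) (k : ℕ) : eps S k ≠ 0 := by
  simp [eps]

lemma eps_im (S : Finset ℕ) (k : ℕ) : (eps S k).im = 0 := by
  rcases neg_one_pow_eq_or ℂ (S.filter (· < k)).card with h | h <;> simp [eps, h]

lemma eps_insert_of_lt {S : Finset ℕ} {k l : ℕ} (hl : l ∉ S) (h : l < k) :
    eps (insert l S) k = -eps S k := by
  rw [eps, eps, Finset.filter_insert, if_pos h, Finset.card_insert_of_notMem (by simp [hl]), pow_succ]
  ring

lemma eps_insert_of_gt {S : Finset ℕ} {k l : ℕ} (h : k < l) : eps (insert l S) k = eps S k := by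
  rw [eps, eps, Finset.filter_insert, if_neg (by omega)]

lemma eps_eq_one {S : Finset ℕ} {k : ℕ} (h : ∀ s ∈ S, k < s) : eps S k = 1 := by
  rw [eps, Finset.filter_false_of_mem fun s hs => by have := h s hs; omega]
  simp

/-- Each side moves both indices in front of `S`; the two resulting orders differ by a
transposition. -/
lemma eps_mul_eps_insert {S : Finset ℕ} {k l : ℕ} (hk : k ∉ S) (hl : l ∉ S) (hkl : k ≠ l) :
    eps S l * eps (insert l S) k = -(eps S k * eps (insert k S) l) := by
  rcases lt_or_gt_of_ne hkl with h | h
  · rw [eps_insert_of_gt h, eps_insert_of_lt hk h]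
    ring
  · rw [eps_insert_of_lt hl h, eps_insert_of_gt h]
    ring

/-- The antisymmetric extension of the family `φ`, with one index in front. -/
def f1 (φ : Finset ℕ → ℂ → ℂ) (k : ℕ) (S : Finset ℕ) (z : ℂ) : ℂ := eps S k * φ (insert k S) z

/-- The antisymmetric extension of the family `φ`, with two indices in front. -/
def f2 (φ : Finset ℕ → ℂ → ℂ) (k l : ℕ) (S : Finset ℕ) (z : ℂ) : ℂ :=
  eps S l * eps (insert l S) k * φ (insert k (insert l S)) z

variable (φ : Finset ℕ → ℂ → ℂ) {k l : ℕ} {S : Finset ℕ}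

lemma f2_eq (k l : ℕ) (S : Finset ℕ) (z : ℂ) : f2 φ k l S z = eps S l * f1 φ k (insert l S) z := by
  rw [f2, f1, mul_assoc]

lemma f1_insert (k l : ℕ) (S : Finset ℕ) (z : ℂ) :
    f1 φ k (insert l S) z = eps S l * f2 φ k l S z := by
  rw [f2_eq, ← mul_assoc, eps_mul_self, one_mul]

lemma apply_insert (k : ℕ) (S : Finset ℕ) (z : ℂ) : φ (insert k S) z = eps S k * f1 φ k S z := by
  rw [f1, ← mul_assoc, eps_mul_self, one_mul]

lemma f2_antisymm (hk : k ∉ S) (hl : l ∉ S) (hkl : k ≠ l) (z : ℂ) :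
    f2 φ k l S z = -f2 φ l k S z := by
  rw [f2, f2, eps_mul_eps_insert hk hl hkl, Finset.insert_comm]
  ring

end Signs

/-- The number of elements of `V` which are at least `i + |V|`. -/
def highCount (i : ℕ) (V : Finset ℕ) : ℕ := (V.filter fun s => i + V.card ≤ s).card

/-- The functions `φ_V` attached to the sets of indices `V ⊆ {i, …, m}` by a Nikishin system
generated by measures on the intervals `D (i + 1), …, D m`: these are the minors of the first rows
of the matrix of the Cauchy transforms of the iterated products, and `φ_V` is analytic off
`D (i + |V|)`. -/
structure Family (m : ℕ) (D : ℕ → Set ℝ) (s : ℕ → ℝ) (i : ℕ) (φ : Finset ℕ → ℂ → ℂ)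
    (ω : Finset ℕ → Measure ℝ) : Prop where
  empty : ∀ z, φ ∅ z = 1
  cont : ∀ V ⊆ Finset.Icc i m, ContinuousOn (φ V) (cdom (D (i + V.card)))
  real : ∀ V ⊆ Finset.Icc i m, ∀ x : ℝ, x ∉ D (i + V.card) → (φ V x).im = 0
  ne : ∀ V ⊆ Finset.Icc i m, ∀ z ∈ cdom (D (i + V.card)), φ V z ≠ 0
  -- Thus `highCount i V` is the order of the zero of `φ V` at infinity.
  growth : ∀ V ⊆ Finset.Icc i m, ∃ L : ℂ, L ≠ 0 ∧
    Tendsto (fun z => φ V z * z ^ highCount i V) (cobounded ℂ) (𝓝 L)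
  -- The full set is excluded: a measure is used only when some index `k` remains outside its set.
  gen : ∀ V ⊆ Finset.Icc i m, V.Nonempty → V ≠ Finset.Icc i m → IsGen (D (i + V.card)) (ω V)
  -- One measure serves all `k`, and all ways of writing its index set as `insert l S`.
  rep : ∀ S ⊆ Finset.Icc i m, ∀ l ∈ Finset.Icc i m, ∀ k ∈ Finset.Icc i m, l ∉ S → k ∉ S → k ≠ l →
    ∃ P : ℂ[X], ∀ z ∈ cdom (D (i + S.card + 1)), f1 φ k S z = f1 φ l S z * (P.eval z +
      CT (ω (insert l S)) (fun x => s (i + S.card + 1) * (f2 φ k l S x * φ S x)) z)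
  -- The three-term Plücker relation.
  inc : ∀ S ⊆ Finset.Icc i m, ∀ a ∈ Finset.Icc i m, ∀ b ∈ Finset.Icc i m, ∀ k ∈ Finset.Icc i m,
    a ∉ S → b ∉ S → k ∉ S → a ≠ b → b ≠ k → k ≠ a → ∀ z : ℂ, z.im ≠ 0 →
    f1 φ a S z * f2 φ b k S z + f1 φ b S z * f2 φ k a S z + f1 φ k S z * f2 φ a b S z = 0

section Step

/-- The expansion along the first row of the minor with columns `W`. -/
noncomputable def stepE (f : ℕ → ℂ → ℂ) (φ : Finset ℕ → ℂ → ℂ) (W : Finset ℕ) (z : ℂ) : ℂ :=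
  ∑ c ∈ W, eps (W.erase c) c * f c z * φ (W.erase c) z

variable {f : ℕ → ℂ → ℂ} {φ : Finset ℕ → ℂ → ℂ} {b k : ℕ} {U : Finset ℕ} {z : ℂ}

/-- With `b` moved to the front, its own term has sign one; in every other term moving `b` past `c`
costs a sign. -/
lemma stepE_insert (hb : b ∉ U) :
    f1 (stepE f φ) b U z = f b z * φ U z
      - ∑ c ∈ U, eps (U.erase c) c * f c z * f1 φ b (U.erase c) z := by
  rw [f1, stepE, Finset.sum_insert hb, Finset.erase_insert hb, mul_add, Finset.mul_sum, sub_eq_add_neg,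
    ← Finset.sum_neg_distrib]
  congr 1
  · rw [← mul_assoc, ← mul_assoc, eps_mul_self, one_mul]
  · refine Finset.sum_congr rfl fun c hc => ?_
    have hcb : c ≠ b := fun h => hb (h ▸ hc)
    obtain ⟨X, hX, rfl⟩ : ∃ X, c ∉ X ∧ U = insert c X :=
      ⟨U.erase c, Finset.notMem_erase _ _, (Finset.insert_erase hc).symm⟩
    have hbX : b ∉ X := fun h => hb (Finset.mem_insert_of_mem h)
    rw [Finset.erase_insert hX, Finset.insert_comm, Finset.erase_insert (by simp [hcb, hX]), f1]
    have h1 := eps_mul_eps_insert hbX hX hcb.symm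
    have h2 := eps_mul_self X c
    have h3 := eps_mul_self (insert b X) c
    linear_combination (eps X c * h1 - eps (insert c X) b * h2) * eps (insert b X) c
      * f c z * φ (insert b X) z - eps X c * eps X b * h3 * f c z * φ (insert b X) z

lemma stepE_insert_insert (hb : b ∉ U) (hk : k ∉ U) (hbk : b ≠ k) :
    f2 (stepE f φ) b k U z = f b z * f1 φ k U z - f k z * f1 φ b U z
      + ∑ c ∈ U, eps (U.erase c) c * f c z * f2 φ b k (U.erase c) z := by
  rw [f2, stepE, Finset.sum_insert (by simp [hb, hbk]), Finset.sum_insert hk,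
    Finset.erase_insert (by simp [hb, hbk]), mul_add, mul_add, Finset.mul_sum, ← add_assoc]
  congr 1
  · have h1 := eps_mul_eps_insert hb hk hbk
    have h2 := eps_mul_self (insert k U) b
    have h3 := eps_mul_self (insert b U) k
    rw [Finset.insert_comm, Finset.erase_insert (by simp [hk, hbk.symm]), f1, f1]
    linear_combination eps U k * f b z * φ (insert k U) z * h2
      + eps (insert b U) k * f k z * φ (insert b U) z * h1 - eps U b * f k z * φ (insert b U) z * h3
  · refine Finset.sum_congr rfl fun c hc => ?_
    have hcb : c ≠ b := fun h => hb (h ▸ hc)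
    have hck : c ≠ k := fun h => hk (h ▸ hc)
    obtain ⟨X, hX, rfl⟩ : ∃ X, c ∉ X ∧ U = insert c X :=
      ⟨U.erase c, Finset.notMem_erase _ _, (Finset.insert_erase hc).symm⟩
    have hbX : b ∉ X := fun h => hb (Finset.mem_insert_of_mem h)
    have hkX : k ∉ X := fun h => hk (Finset.mem_insert_of_mem h)
    have e1 : insert b (insert k (insert c X)) = insert c (insert b (insert k X)) := by
      rw [Finset.insert_comm k, Finset.insert_comm b]
    rw [Finset.erase_insert hX, e1, Finset.erase_insert (by simp [hcb, hck, hX]), f2,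
      Finset.insert_comm k c]
    have h1 := eps_mul_eps_insert hX hkX hck
    have h2 := eps_mul_eps_insert (S := insert k X) (k := c) (l := b) (by simp [hX, hck])
      (by simp [hbX, hbk]) hcb
    have q1 := eps_mul_self X c
    have q2 := eps_mul_self (insert k X) c
    have q3 := eps_mul_self (insert b (insert k X)) c
    set A := eps X c
    set B := eps (insert c X) k
    set A' := eps X k
    set B' := eps (insert k X) c
    set C' := eps (insert k X) b
    set E := eps (insert b (insert k X)) c
    set G := eps (insert c (insert k X)) b
    have key : B * G * E = A * A' * C' := by
      have h3 : B = -(A * A' * B') := by linear_combination A * h1 - B * q1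
      have h4 : G = -(B' * C' * E) := by linear_combination B' * h2 - G * q2
      rw [h3, h4]
      linear_combination A * A' * C' * E * E * q2 + A * A' * C' * q3
    linear_combination f c z * φ (insert b (insert k X)) z * key

/-- The relation between the minors of the matrix and those of the matrix without its first row
and column. -/
lemma stepE_relation (hb : b ∉ U) (hk : k ∉ U) (hbk : b ≠ k)
    (hinc : ∀ c ∈ U, f1 φ c (U.erase c) z * f2 φ b k (U.erase c) z
      + f1 φ b (U.erase c) z * f2 φ k c (U.erase c) z
      + f1 φ k (U.erase c) z * f2 φ c b (U.erase c) z = 0) :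
    φ U z * f2 (stepE f φ) b k U z
      = f1 φ k U z * f1 (stepE f φ) b U z - f1 φ b U z * f1 (stepE f φ) k U z := by
  rw [stepE_insert hb, stepE_insert hk, stepE_insert_insert hb hk hbk]
  -- Both sides are linear in the entries of the first row. The coefficients of `f b` and `f k`
  -- agree at once; for `f c` the claim is the Plücker relation `hinc` for `U.erase c`.
  have key : φ U z * ∑ c ∈ U, eps (U.erase c) c * f c z * f2 φ b k (U.erase c) z
      = f1 φ b U z * ∑ c ∈ U, eps (U.erase c) c * f c z * f1 φ k (U.erase c) z
        - f1 φ k U z * ∑ c ∈ U, eps (U.erase c) c * f c z * f1 φ b (U.erase c) z := by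
    rw [Finset.mul_sum, Finset.mul_sum, Finset.mul_sum, ← Finset.sum_sub_distrib]
    refine Finset.sum_congr rfl fun c hc => ?_
    have h := hinc c hc
    have hcb : c ≠ b := fun h => hb (h ▸ hc)
    obtain ⟨X, hX, rfl⟩ : ∃ X, c ∉ X ∧ U = insert c X :=
      ⟨U.erase c, Finset.notMem_erase _ _, (Finset.insert_erase hc).symm⟩
    have hbX : b ∉ X := fun h => hb (Finset.mem_insert_of_mem h)
    rw [Finset.erase_insert hX] at h ⊢
    rw [apply_insert φ, f1_insert φ, f1_insert φ]
    rw [f2_antisymm φ hX hbX hcb] at h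
    linear_combination eps X c * eps X c * f c z * h
  linear_combination key

end Step

end

/-! ### Regular functions and their orders at infinity -/

section

open Filter Topology Bornology

/-- `F` is continuous, nonvanishing and real off the subset `D` of the real line and behaves like
a multiple of `1 / z ^ N` at infinity. -/
structure IsReg (D : Set ℝ) (N : ℕ) (F : ℂ → ℂ) : Prop where
  cont : ContinuousOn F (cdom D)
  real : ∀ x : ℝ, x ∉ D → (F x).im = 0
  ne : ∀ z ∈ cdom D, F z ≠ 0
  growth : ∃ L : ℂ, L ≠ 0 ∧ Tendsto (fun z => F z * z ^ N) (cobounded ℂ) (𝓝 L)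

section IsReg

variable {D K : Set ℝ} {M N j : ℕ} {F G : ℂ → ℂ} {μ : Measure ℝ} {g : ℝ → ℂ}

lemma im_mul_eq_zero {a b : ℂ} (ha : a.im = 0) (hb : b.im = 0) : (a * b).im = 0 := by
  simp [ha, hb]

lemma IsReg.mul (hF : IsReg D M F) (hG : IsReg D N G) :
    IsReg D (M + N) fun z => F z * G z := by
  refine ⟨hF.cont.mul hG.cont, fun x hx => im_mul_eq_zero (hF.real x hx) (hG.real x hx),
    fun z hz => mul_ne_zero (hF.ne z hz) (hG.ne z hz), ?_⟩
  obtain ⟨L, hL, h⟩ := hF.growth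
  obtain ⟨L', hL', h'⟩ := hG.growth
  refine ⟨L * L', mul_ne_zero hL hL', (h.mul h').congr fun z => ?_⟩
  rw [pow_add]
  ring

lemma isReg_const (D : Set ℝ) {c : ℂ} (hc : c.im = 0) (h0 : c ≠ 0) : IsReg D 0 fun _ => c :=
  ⟨continuousOn_const, fun _ _ => hc, fun _ _ => h0, c, h0, by simp⟩

lemma IsReg.const_mul (hF : IsReg D N F) {c : ℂ} (hc : c.im = 0) (h0 : c ≠ 0) :
    IsReg D N fun z => c * F z := by
  simpa using (isReg_const D hc h0).mul hF

lemma IsReg.continuousOn_ofReal (hF : IsReg D N F) (hK : Disjoint K D) :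
    ContinuousOn (fun x : ℝ => F x) K :=
  hF.cont.comp Complex.continuous_ofReal.continuousOn fun _ hx =>
    ofReal_mem_cdom (Set.disjoint_left.1 hK hx)

lemma IsReg.isBigO_div (hF : IsReg D M F) (hG : IsReg D N G) (h : N ≤ M + j) :
    (fun z => F z / G z) =O[cobounded ℂ] fun z => z ^ j := by
  obtain ⟨L, hL, h1⟩ := hF.growth
  obtain ⟨L', hL', h2⟩ := hG.growth
  have h3 := (h1.div h2 hL').isBigO_one ℂ
  have h4 : (fun z : ℂ => z ^ N / z ^ M) =O[cobounded ℂ] fun z => z ^ j := by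
    refine IsBigO.of_bound 1 ?_
    filter_upwards [tendsto_norm_cobounded_atTop.eventually_ge_atTop (1 : ℝ)] with z hz
    rw [norm_div, norm_pow, norm_pow, norm_pow, one_mul, div_le_iff₀ (by positivity), ← pow_add]
    exact pow_le_pow_right₀ hz (by omega)
  refine (h3.mul h4).congr' ?_ (by simp)
  filter_upwards [eventually_ne_cobounded (0 : ℂ)] with z hz
  have : z ^ N ≠ 0 := pow_ne_zero _ hz
  have : z ^ M ≠ 0 := pow_ne_zero _ hz
  simp only [Pi.div_apply]
  field_simp

lemma CT_im (hμ : IsConc D μ) (hg : ∀ x ∈ D, (g x).im = 0) (x : ℝ) : (CT μ g x).im = 0 := by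
  have h : CT μ g x = ((∫ t, (g t).re / (x - t) ∂μ : ℝ) : ℂ) := by
    rw [CT, ← integral_complex_ofReal]
    refine hμ.integral_congr fun t ht => ?_
    push_cast
    congr 1
    exact Complex.ext (by simp) (by simp [hg t ht])
  rw [h, Complex.ofReal_im]

lemma IsGen.isReg_CT (hμ : IsGen D μ) (hg : ContinuousOn g D) (hre : ∀ x ∈ D, (g x).im = 0)
    (h0 : ∀ x ∈ D, g x ≠ 0) : IsReg D 1 (CT μ g) := by
  refine ⟨hμ.toIsConc.continuousOn_CT hg, fun x _ => CT_im hμ.toIsConc hre x,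
    fun z hz => hμ.CT_ne_zero hg hre h0 hz, _, hμ.integral_ofReal_ne_zero hg hre h0, ?_⟩
  refine (hμ.toIsConc.tendsto_mul_CT hg).congr fun z => ?_
  ring

lemma IsReg.congr (hD : IsCompact D) (hF : IsReg D N F) (h : ∀ z ∈ cdom D, G z = F z) :
    IsReg D N G := by
  refine ⟨hF.cont.congr h, fun x hx => ?_, fun z hz => ?_, ?_⟩
  · rw [h _ (ofReal_mem_cdom hx)]
    exact hF.real x hx
  · rw [h z hz]
    exact hF.ne z hz
  · obtain ⟨L, hL, h1⟩ := hF.growth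
    refine ⟨L, hL, h1.congr' ?_⟩
    filter_upwards [eventually_mem_cdom hD] with z hz
    rw [h z hz]

lemma extendFrom_eq_of_nonreal {U : Set ℂ} (hU : IsOpen U) (hF : ContinuousOn F U)
    (h : ∀ z : ℂ, z.im ≠ 0 → G z = F z) {z : ℂ} (hz : z ∈ U) :
    extendFrom {w : ℂ | w.im ≠ 0} G z = F z := by
  refine extendFrom_eq (mem_closure_iff_nhdsWithin_neBot.2 (neBot_nonreal z)) ?_
  refine ((hF.continuousAt (hU.mem_nhds hz)).tendsto.mono_left nhdsWithin_le_nhds).congr' ?_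
  filter_upwards [self_mem_nhdsWithin] with w hw
  exact (h w hw).symm

end IsReg

section Family

variable {m i k l : ℕ} {D : ℕ → Set ℝ} {s : ℕ → ℝ} {φ : Finset ℕ → ℂ → ℂ}
  {ω : Finset ℕ → Measure ℝ} {S V : Finset ℕ}

lemma Family.isReg (h : Family m D s i φ ω) (hV : V ⊆ Finset.Icc i m) :
    IsReg (D (i + V.card)) (highCount i V) (φ V) :=
  ⟨h.cont V hV, h.real V hV, h.ne V hV, h.growth V hV⟩

lemma IsReg.f1 (h : IsReg (D (i + (insert k S).card)) (highCount i (insert k S)) (φ (insert k S)))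
    (hk : k ∉ S) : IsReg (D (i + S.card + 1)) (highCount i (insert k S)) (f1 φ k S) := by
  have := h.const_mul (eps_im S k) (eps_ne_zero S k)
  rwa [Finset.card_insert_of_notMem hk] at this

lemma IsReg.f2 (h : IsReg (D (i + (insert k (insert l S)).card))
    (highCount i (insert k (insert l S))) (φ (insert k (insert l S))))
    (hk : k ∉ S) (hl : l ∉ S) (hkl : k ≠ l) :
    IsReg (D (i + S.card + 2)) (highCount i (insert k (insert l S))) (f2 φ k l S) := by
  have := h.const_mul (im_mul_eq_zero (eps_im S l) (eps_im (insert l S) k))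
    (mul_ne_zero (eps_ne_zero S l) (eps_ne_zero (insert l S) k))
  rwa [Finset.card_insert_of_notMem (by simp [hk, hkl]), Finset.card_insert_of_notMem hl] at this

lemma Family.isReg_f1 (h : Family m D s i φ ω) (hS : S ⊆ Finset.Icc i m) (hk : k ∈ Finset.Icc i m)
    (hkS : k ∉ S) : IsReg (D (i + S.card + 1)) (highCount i (insert k S)) (HermitePade.f1 φ k S) :=
  (h.isReg (Finset.insert_subset hk hS)).f1 hkS

lemma Family.isReg_f2 (h : Family m D s i φ ω) (hS : S ⊆ Finset.Icc i m) (hk : k ∈ Finset.Icc i m)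
    (hkS : k ∉ S) (hl : l ∈ Finset.Icc i m) (hlS : l ∉ S) (hkl : k ≠ l) :
    IsReg (D (i + S.card + 2)) (highCount i (insert k (insert l S))) (HermitePade.f2 φ k l S) :=
  (h.isReg (Finset.insert_subset hk (Finset.insert_subset hl hS))).f2 hkS hlS hkl

/-- The number `highCount` does not decrease when an element is replaced by a larger one. -/
lemma highCount_insert_le (hl : l ∉ S) (hk : k ∉ S) (hlk : l < k) :
    highCount i (insert l S) ≤ highCount i (insert k S) := by
  rw [highCount, highCount, Finset.card_insert_of_notMem hl, Finset.card_insert_of_notMem hk,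
    Finset.filter_insert, Finset.filter_insert]
  have h3 : k ∉ S.filter fun x => i + (S.card + 1) ≤ x := by simp [hk]
  have h4 : l ∉ S.filter fun x => i + (S.card + 1) ≤ x := by simp [hl]
  split_ifs with h1 h2 h2
  · rw [Finset.card_insert_of_notMem h3, Finset.card_insert_of_notMem h4]
  · omega
  · rw [Finset.card_insert_of_notMem h3]
    omega
  · rfl

lemma highCount_insert_le_add_one (hl : l ∉ S) (hk : k ∉ S) :
    highCount i (insert l S) ≤ highCount i (insert k S) + 1 := by
  rw [highCount, highCount, Finset.card_insert_of_notMem hl, Finset.card_insert_of_notMem hk]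
  calc ((insert l S).filter fun x => i + (S.card + 1) ≤ x).card
      ≤ (insert l (S.filter fun x => i + (S.card + 1) ≤ x)).card := by
        refine Finset.card_le_card fun x hx => ?_
        simp only [Finset.mem_filter, Finset.mem_insert] at hx ⊢
        tauto
    _ ≤ (S.filter fun x => i + (S.card + 1) ≤ x).card + 1 := Finset.card_insert_le _ _
    _ ≤ _ := by
        gcongr
        exact Finset.subset_insert k S

/-- This makes the quotient of a new minor `φ_{S∪l}` by the old minor `ψ_S` bounded at infinity. -/
lemma highCount_succ_le (hl : l ∉ S) : highCount (i + 1) S ≤ highCount i (insert l S) := by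
  rw [highCount, highCount, Finset.card_insert_of_notMem hl]
  refine Finset.card_le_card fun x hx => ?_
  simp only [Finset.mem_filter, Finset.mem_insert] at hx ⊢
  exact ⟨Or.inr hx.1, by omega⟩

lemma highCount_insert_self (hi : i ∉ S) : highCount i (insert i S) = highCount (i + 1) S := by
  rw [highCount, highCount, Finset.card_insert_of_notMem hi, Finset.filter_insert, if_neg (by omega)]
  congr 1
  refine Finset.filter_congr fun x _ => ?_
  omega

/-- The elements of `S` lie in `[i + 1, k)`, so `k ≥ i + 1 + |S|` and `k` itself is counted; on `S`
the two thresholds coincide. -/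
lemma highCount_insert_max (hS : S ⊆ Finset.Icc (i + 1) m) (hk : i + 1 ≤ k)
    (hmax : ∀ x ∈ S, x < k) : highCount i (insert k S) = highCount (i + 1) S + 1 := by
  have hkS : k ∉ S := fun h => (hmax k h).false
  have h1 : S ⊆ Finset.Ico (i + 1) k := fun x hx =>
    Finset.mem_Ico.2 ⟨(Finset.mem_Icc.1 (hS hx)).1, hmax x hx⟩
  have h2 := Finset.card_le_card h1
  rw [Nat.card_Ico] at h2
  rw [highCount, highCount, Finset.card_insert_of_notMem hkS, Finset.filter_insert,
    if_pos (by omega), Finset.card_insert_of_notMem (by simp [hkS])]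
  congr 2
  refine Finset.filter_congr fun x _ => ?_
  omega

end Family

end

/-! ### Adding a generator: the new minors -/

section

open Filter Topology Bornology

/-- The functions attached to the system with one more generator `σ` on the interval `D (i + 1)`,
constructed from the functions `ψ` of the system without it. -/
noncomputable def stepφ (i : ℕ) (s : ℕ → ℝ) (σ : Measure ℝ) (ψ : Finset ℕ → ℂ → ℂ) (W : Finset ℕ) :
    ℂ → ℂ :=
  -- Column `i` is `(1, 0, …, 0)`, which settles the case `i ∈ W`. Otherwise the row expansion is
  -- reliable only off the intervals of its terms; the continuous extension carries it across those
  -- that are not singular for the minor.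
  if i ∈ W then ψ (W.erase i) else if W = ∅ then fun _ => 1 else
    extendFrom {z : ℂ | z.im ≠ 0}
      (stepE (fun k z => -s (i + 1) * CT σ (fun x => ψ {k} x) z) ψ W)

/-- The measures attached to the indices and sets containing the first one. -/
noncomputable def stepω (σ : Measure ℝ) (η : Finset ℕ → Measure ℝ) (T : Finset ℕ) : Measure ℝ :=
  if T = ∅ then σ else η T

/-- The data for adding a generator `σ` to a system. -/
structure StepData (m : ℕ) (D : ℕ → Set ℝ) (s : ℕ → ℝ) (i : ℕ) (ψ : Finset ℕ → ℂ → ℂ)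
    (η : Finset ℕ → Measure ℝ) (σ : Measure ℝ) : Prop where
  compact : ∀ l, IsCompact (D l)
  disjoint : ∀ l, Disjoint (D l) (D (l + 1))
  ne : ∀ l, s l ≠ 0
  lt : i < m
  fam : Family m D s (i + 1) ψ η
  gen : IsGen (D (i + 1)) σ

variable {m i k l : ℕ} {D : ℕ → Set ℝ} {s : ℕ → ℝ} {ψ : Finset ℕ → ℂ → ℂ}
  {η : Finset ℕ → Measure ℝ} {σ : Measure ℝ} {S T U V : Finset ℕ} {z : ℂ}

lemma notMem_of_subset_Icc_succ (hS : S ⊆ Finset.Icc (i + 1) m) : i ∉ S := fun h => by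
  have := Finset.mem_Icc.1 (hS h)
  omega

lemma stepφ_empty : stepφ i s σ ψ ∅ = fun _ => 1 := by
  simp [stepφ]

lemma stepφ_insert_self (hS : i ∉ S) : stepφ i s σ ψ (insert i S) = ψ S := by
  rw [stepφ, if_pos (Finset.mem_insert_self _ _), Finset.erase_insert hS]

lemma eps_self_of_subset (hS : S ⊆ Finset.Icc (i + 1) m) : eps S i = 1 :=
  eps_eq_one fun s hs => by
    have := Finset.mem_Icc.1 (hS hs)
    omega

lemma f1_stepφ_self (hS : S ⊆ Finset.Icc (i + 1) m) : f1 (stepφ i s σ ψ) i S z = ψ S z := by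
  rw [f1, eps_self_of_subset hS, one_mul, stepφ_insert_self (notMem_of_subset_Icc_succ hS)]

lemma f1_stepφ_insert_self (hS : S ⊆ Finset.Icc (i + 1) m) (hk : k ∈ Finset.Icc (i + 1) m) :
    f1 (stepφ i s σ ψ) k (insert i S) z = -f1 ψ k S z := by
  rw [f1, f1, Finset.insert_comm, stepφ_insert_self
    (notMem_of_subset_Icc_succ (Finset.insert_subset hk hS)),
    eps_insert_of_lt (notMem_of_subset_Icc_succ hS) (Finset.mem_Icc.1 hk).1, neg_mul]

lemma f2_stepφ_self_right (hS : S ⊆ Finset.Icc (i + 1) m) (hk : k ∈ Finset.Icc (i + 1) m) :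
    f2 (stepφ i s σ ψ) k i S z = -f1 ψ k S z := by
  rw [f2_eq, eps_self_of_subset hS, one_mul, f1_stepφ_insert_self hS hk]

lemma f2_stepφ_self_left (hS : S ⊆ Finset.Icc (i + 1) m) (hk : k ∈ Finset.Icc (i + 1) m)
    (hkS : k ∉ S) : f2 (stepφ i s σ ψ) i k S z = f1 ψ k S z := by
  have hki : i ≠ k := fun h => by
    have := Finset.mem_Icc.1 hk
    omega
  rw [f2_antisymm _ (notMem_of_subset_Icc_succ hS) hkS hki, f2_stepφ_self_right hS hk, neg_neg]

lemma f2_stepφ_insert_self (hS : S ⊆ Finset.Icc (i + 1) m) (hk : k ∈ Finset.Icc (i + 1) m)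
    (hl : l ∈ Finset.Icc (i + 1) m) :
    f2 (stepφ i s σ ψ) k l (insert i S) z = f2 ψ k l S z := by
  have hiS := notMem_of_subset_Icc_succ hS
  have h1 := eps_insert_of_lt hiS (Finset.mem_Icc.1 hl).1
  have h2 := eps_insert_of_lt (notMem_of_subset_Icc_succ (Finset.insert_subset hl hS))
    (Finset.mem_Icc.1 hk).1
  rw [f2, f2, Finset.insert_comm l i, h2, h1, Finset.insert_comm k i, stepφ_insert_self
    (notMem_of_subset_Icc_succ (Finset.insert_subset hk (Finset.insert_subset hl hS))), neg_mul_neg]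

namespace StepData

variable (H : StepData m D s i ψ η σ)
include H

lemma isReg_singleton (hk : k ∈ Finset.Icc (i + 1) m) :
    IsReg (D (i + 2)) (highCount (i + 1) {k}) (ψ {k}) := by
  have := H.fam.isReg (V := {k}) (by simpa using hk)
  rwa [Finset.card_singleton] at this

lemma continuousOn_first (hk : k ∈ Finset.Icc (i + 1) m) :
    ContinuousOn (fun z => -s (i + 1) * CT σ (fun x => ψ {k} x) z) (cdom (D (i + 1))) :=
  continuousOn_const.mul (H.gen.toIsConc.continuousOn_CT
    ((H.isReg_singleton hk).continuousOn_ofReal (H.disjoint (i + 1))))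

lemma continuousOn_stepE (hV : V ⊆ Finset.Icc (i + 1) m) :
    ContinuousOn (stepE (fun k z => -s (i + 1) * CT σ (fun x => ψ {k} x) z) ψ V)
      {z : ℂ | z.im ≠ 0} := by
  refine continuousOn_finsetSum _ fun c hc => ?_
  have h1 := (H.continuousOn_first (hV hc)).mono fun z hz => mem_cdom_of_im _ hz
  have h2 := (H.fam.isReg ((Finset.erase_subset c V).trans hV)).cont.mono fun z hz =>
    mem_cdom_of_im _ hz
  exact (continuousOn_const.mul h1).mul h2

lemma stepφ_eq (hV : V ⊆ Finset.Icc (i + 1) m) (h0 : V.Nonempty) (hz : z.im ≠ 0) :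
    stepφ i s σ ψ V z = stepE (fun k z => -s (i + 1) * CT σ (fun x => ψ {k} x) z) ψ V z := by
  rw [stepφ, if_neg (notMem_of_subset_Icc_succ hV), if_neg h0.ne_empty]
  refine extendFrom_eq_of_nonreal ?_ (H.continuousOn_stepE hV) (fun _ _ => rfl) hz
  exact isOpen_ne.preimage Complex.continuous_im

/-- Sylvester's identity between the new minors and the minors `ψ` of the array without its first
row. The representations in this step come from dividing it by suitable minors. -/
lemma relation (hU : U ⊆ Finset.Icc (i + 1) m) (hk : k ∈ Finset.Icc (i + 1) m)
    (hl : l ∈ Finset.Icc (i + 1) m) (hkU : k ∉ U) (hlU : l ∉ U) (hkl : k ≠ l) (hz : z.im ≠ 0) :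
    ψ U z * f2 (stepφ i s σ ψ) k l U z = f1 ψ l U z * f1 (stepφ i s σ ψ) k U z
      - f1 ψ k U z * f1 (stepφ i s σ ψ) l U z := by
  have h1 := stepE_relation (f := fun k z => -s (i + 1) * CT σ (fun x => ψ {k} x) z) (z := z)
    (φ := ψ) hkU hlU hkl fun c hc =>
    H.fam.inc (U.erase c) ((Finset.erase_subset c U).trans hU) c (hU hc) k hk l hl
      (Finset.notMem_erase _ _) (fun h => hkU (Finset.mem_of_mem_erase h))
      (fun h => hlU (Finset.mem_of_mem_erase h)) (fun h => hkU (h ▸ hc)) hkl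
      (fun h => hlU (h ▸ hc)) z hz
  rw [f2, f1.eq_1 (stepφ i s σ ψ) k, f1.eq_1 (stepφ i s σ ψ) l, H.stepφ_eq (Finset.insert_subset hk (Finset.insert_subset hl hU)) (by simp) hz,
    H.stepφ_eq (Finset.insert_subset hk hU) (by simp) hz,
    H.stepφ_eq (Finset.insert_subset hl hU) (by simp) hz]
  exact h1

lemma isGen_stepω (hT : T ⊆ Finset.Icc (i + 1) m) (hne : T ≠ Finset.Icc (i + 1) m) :
    IsGen (D (i + T.card + 1)) (stepω σ η T) := by
  rw [stepω]
  split_ifs with h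
  · subst h
    exact H.gen
  · rw [add_right_comm]
    exact H.fam.gen T hT (Finset.nonempty_iff_ne_empty.2 h) hne

end StepData

end

/-! ### Adding a generator: new minors divided by old ones -/

section

open Filter Topology Bornology

lemma IsReg.density {K D₁ D₂ : Set ℝ} {M N : ℕ} {F G : ℂ → ℂ} {c : ℝ} (hF : IsReg D₁ M F)
    (hG : IsReg D₂ N G) (h₁ : Disjoint K D₁) (h₂ : Disjoint K D₂) (hc : c ≠ 0) :
    ContinuousOn (fun x : ℝ => (c : ℂ) * (F x * G x)) K ∧
      (∀ x ∈ K, ((c : ℂ) * (F x * G x)).im = 0) ∧ ∀ x ∈ K, (c : ℂ) * (F x * G x) ≠ 0 :=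
  ⟨continuousOn_const.mul ((hF.continuousOn_ofReal h₁).mul (hG.continuousOn_ofReal h₂)),
    fun x hx => im_mul_eq_zero (Complex.ofReal_im c) (im_mul_eq_zero
      (hF.real x (Set.disjoint_left.1 h₁ hx)) (hG.real x (Set.disjoint_left.1 h₂ hx))),
    fun _ hx => mul_ne_zero (Complex.ofReal_ne_zero.2 hc) (mul_ne_zero
      (hF.ne _ (ofReal_mem_cdom (Set.disjoint_left.1 h₁ hx)))
      (hG.ne _ (ofReal_mem_cdom (Set.disjoint_left.1 h₂ hx))))⟩

variable {m i k l : ℕ} {D : ℕ → Set ℝ} {s : ℕ → ℝ} {ψ : Finset ℕ → ℂ → ℂ}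
  {η : Finset ℕ → Measure ℝ} {σ : Measure ℝ} {S T U V : Finset ℕ} {z : ℂ}

namespace StepData

variable (H : StepData m D s i ψ η σ)
include H

lemma isReg_ψ (hV : V ⊆ Finset.Icc (i + 1) m) :
    IsReg (D (i + V.card + 1)) (highCount (i + 1) V) (ψ V) := by
  rw [add_right_comm]
  exact H.fam.isReg hV

lemma isReg_f1 (hV : V ⊆ Finset.Icc (i + 1) m) (hk : k ∈ Finset.Icc (i + 1) m) (hkV : k ∉ V) :
    IsReg (D (i + V.card + 1 + 1)) (highCount (i + 1) (insert k V)) (f1 ψ k V) := by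
  rw [add_right_comm i]
  exact H.fam.isReg_f1 hV hk hkV

/-- The hypothesis `h` has no polynomial part, so the new minor is `± ψ S` times the Cauchy
transform of a real density without zeros on an interval. Such a transform does not vanish and
contributes one more order at infinity. -/
lemma isReg_insert_max (hS : S ⊆ Finset.Icc (i + 1) m) (hl : l ∈ Finset.Icc (i + 1) m)
    (hmax : ∀ x ∈ S, x < l) (hreg : IsReg (D (i + S.card)) (highCount i S) (stepφ i s σ ψ S))
    (h : ∀ z : ℂ, z.im ≠ 0 → f1 (stepφ i s σ ψ) l S z = ψ S z * CT (stepω σ η S)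
      (fun x => (-s (i + S.card + 1) : ℝ) * (f1 ψ l S x * stepφ i s σ ψ S x)) z) :
    IsReg (D (i + S.card + 1)) (highCount i (insert l S)) (stepφ i s σ ψ (insert l S)) := by
  have hlS : l ∉ S := fun h => (hmax l h).false
  have hTS := Finset.insert_subset hl hS
  have hω := H.isGen_stepω hS fun h => hlS (h ▸ hl)
  obtain ⟨hc, hr, h0⟩ := (H.isReg_f1 hS hl hlS).density hreg (H.disjoint (i + S.card + 1))
    (H.disjoint (i + S.card)).symm (neg_ne_zero.2 (H.ne (i + S.card + 1)))
  have hF := (((H.isReg_ψ hS).mul (hω.isReg_CT hc hr h0)).const_mul (eps_im S l)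
    (eps_ne_zero S l))
  rw [← highCount_insert_max hS (Finset.mem_Icc.1 hl).1 hmax] at hF
  refine hF.congr (H.compact _) fun z hz => ?_
  rw [stepφ, if_neg (notMem_of_subset_Icc_succ hTS), if_neg (Finset.insert_ne_empty _ _)]
  refine extendFrom_eq_of_nonreal (isOpen_cdom (H.compact _)) hF.cont (fun w hw => ?_) hz
  rw [← H.stepφ_eq hTS (Finset.insert_nonempty _ _) hw, apply_insert (stepφ i s σ ψ), h w hw]

/-- Induction on `|T|` with `T = S ∪ l`, `l = max T`. Dividing `relation` by the old minors gives
`φ_{S∪{k,l}} / ψ_{S∪l} = φ_{S∪k} / ψ_S - (ψ_{S∪k} / ψ_{S∪l}) (φ_{S∪l} / ψ_S)` up to signs. When the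
product is split, the part carried by the measure of `S` cancels and the part carried by the measure
of `T` remains. The clause `P = 0` is needed to continue: it feeds `isReg_insert_max` at the next
size. -/
lemma isReg_and_exists_rep (n : ℕ) : ∀ T ⊆ Finset.Icc (i + 1) m, T.card = n →
    IsReg (D (i + T.card)) (highCount i T) (stepφ i s σ ψ T) ∧
    ∀ k ∈ Finset.Icc (i + 1) m, k ∉ T → ∃ P : ℂ[X], ((∀ t ∈ T, t < k) → P = 0) ∧
      ∀ z : ℂ, z.im ≠ 0 → f1 (stepφ i s σ ψ) k T z = ψ T z * (P.eval z + CT (stepω σ η T)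
        (fun x => (-s (i + T.card + 1) : ℝ) * (f1 ψ k T x * stepφ i s σ ψ T x)) z) := by
  induction n with
  | zero =>
    intro T _ hT0
    rw [Finset.card_eq_zero] at hT0
    subst hT0
    refine ⟨?_, fun k hk _ => ⟨0, fun _ => rfl, fun z hz => ?_⟩⟩
    · rw [stepφ_empty]
      exact isReg_const _ (by simp) one_ne_zero
    · have h1 : eps ∅ k = 1 := eps_eq_one (by simp)
      rw [f1, h1, one_mul, LawfulSingleton.insert_empty_eq,
        H.stepφ_eq (by simpa using hk) (by simp) hz, stepE, Finset.sum_singleton, H.fam.empty, CT_const_mul]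
      simp [h1, f1, stepφ_empty, stepω, H.fam.empty]
  | succ n ih =>
    intro T hT hTn
    have hTne : T.Nonempty := Finset.card_pos.1 (by omega)
    obtain ⟨l, S, hlS, rfl, hmax⟩ : ∃ l S, l ∉ S ∧ T = insert l S ∧ ∀ x ∈ S, x < l :=
      ⟨T.max' hTne, T.erase (T.max' hTne), Finset.notMem_erase _ _,
        (Finset.insert_erase (T.max'_mem hTne)).symm, fun x hx => T.lt_max'_of_mem_erase_max' hTne hx⟩
    have hl := hT (Finset.mem_insert_self l S)
    have hS := (Finset.subset_insert l S).trans hT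
    have hSn := Finset.card_insert_of_notMem hlS
    obtain ⟨hreg, hA⟩ := ih S hS (by omega)
    obtain ⟨P₀, hP₀, hl'⟩ := hA l hl hlS
    simp only [hP₀ hmax, eval_zero, zero_add] at hl'
    have hregT := H.isReg_insert_max hS hl hmax hreg hl'
    have hSn' : i + S.card + 1 = i + (insert l S).card := by omega
    rw [hSn'] at hregT
    refine ⟨hregT, fun k hk hkT => ?_⟩
    have hkl : k ≠ l := fun h => hkT (h ▸ Finset.mem_insert_self l S)
    have hkS : k ∉ S := fun h => hkT (Finset.mem_insert_of_mem h)
    obtain ⟨Pk, hPk, hk'⟩ := hA k hk hkS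
    have hω := H.isGen_stepω hS fun h => hlS (h ▸ hl)
    have hω' := H.isGen_stepω hT fun h => hkT (h ▸ hk)
    have hωT : stepω σ η (insert l S) = η (insert l S) := if_neg (Finset.insert_ne_empty _ _)
    obtain ⟨Q, hQ⟩ := H.fam.rep S hS l hl k hk hlS hkS hkl
    have hlev : i + 1 + S.card + 1 = i + (insert l S).card + 1 := by omega
    rw [hlev] at hQ
    rw [← hωT] at hQ
    set ω₀ := stepω σ η S
    set ω₁ := stepω σ η (insert l S)
    rw [hSn'] at hω hl' hk'
    have hψS := H.isReg_ψ hS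
    rw [hSn'] at hψS
    have hfl := H.isReg_f1 hS hl hlS
    have hfk := H.isReg_f1 hS hk hkS
    have hf2 := H.fam.isReg_f2 hS hk hkS hl hlS hkl
    rw [show i + 1 + S.card + 2 = i + (insert l S).card + 1 + 1 by omega] at hf2
    rw [hSn'] at hfl hfk
    set j := i + (insert l S).card
    have hd := H.disjoint j
    have hd' := H.disjoint (j + 1)
    have hd0 : Disjoint (D j) (D (i + S.card)) := by
      have := (H.disjoint (i + S.card)).symm
      rwa [hSn'] at this
    obtain ⟨hgc, -, -⟩ := hfl.density hreg hd hd0 (neg_ne_zero.2 (H.ne j))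
    obtain ⟨hgkc, -, -⟩ := hfk.density hreg hd hd0 (neg_ne_zero.2 (H.ne j))
    obtain ⟨hhc, -, -⟩ := hf2.density hψS hd' hd.symm (H.ne (j + 1))
    set gl : ℝ → ℂ := fun x => (-s j : ℝ) * (f1 ψ l S x * stepφ i s σ ψ S x)
    set gk : ℝ → ℂ := fun x => (-s j : ℝ) * (f1 ψ k S x * stepφ i s σ ψ S x)
    set h : ℝ → ℂ := fun x => s (j + 1) * (f2 ψ k l S x * ψ S x)
    obtain ⟨S₁, hS₁⟩ := exists_poly_mul hω.toIsConc hω'.toIsConc hd hgc hhc 0 Q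
      (F := CT ω₀ gl) (R := fun z => Q.eval z + CT ω₁ h z) (by simp) (fun _ _ => rfl)
    have hregl := hregT.const_mul (eps_im S l) (eps_ne_zero S l)
    have hF : ∀ z ∈ cdom (D j), f1 (stepφ i s σ ψ) l S z = ψ S z * CT ω₀ gl z :=
      eqOn_of_eq_nonreal (isOpen_cdom (H.compact j)) hregl.cont
        (hψS.cont.mul (hω.toIsConc.continuousOn_CT hgc)) hl'
    have hmain : ∀ z : ℂ, z.im ≠ 0 → f1 (stepφ i s σ ψ) k (insert l S) z = ψ (insert l S) z *
        ((Pk - S₁).eval z + CT ω₁ (fun x => (-s (j + 1) : ℝ) *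
          (f1 ψ k (insert l S) x * stepφ i s σ ψ (insert l S) x)) z) ∧
        CT ω₁ (fun x => (-s (j + 1) : ℝ) *
          (f1 ψ k (insert l S) x * stepφ i s σ ψ (insert l S) x)) z
          = S₁.eval z + CT ω₀ gk z - CT ω₀ gl z * (Q.eval z + CT ω₁ h z) := by
      intro z hz
      have hz' : ∀ K, z ∈ cdom K := fun K => mem_cdom_of_im K hz
      -- On the support of `ω₁`, `ψ S * CT ω₀ gl` is the new minor `f1 (stepφ i s σ ψ) l S`, which
      -- gives the desired density.
      have e1 : CT ω₁ (fun x => CT ω₀ gl x * h x) z = -CT ω₁ (fun x => (-s (j + 1) : ℝ) *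
          (f1 ψ k (insert l S) x * stepφ i s σ ψ (insert l S) x)) z := by
        rw [← CT_neg]
        refine hω'.toIsConc.CT_congr (fun x hx => ?_) z
        have h1 := hF x (ofReal_mem_cdom (Set.disjoint_right.1 hd hx))
        rw [f1_insert, apply_insert (stepφ i s σ ψ) l S x, h1]
        simp only [h]
        push_cast
        linear_combination (-(eps_mul_self S l)) * s (j + 1) * f2 ψ k l S x * ψ S x * CT ω₀ gl x
      -- On `D j` the factor `Q + CT ω₁ h` is the quotient `ψ_{S∪k} / ψ_{S∪l}`, so it turns `gl`
      -- into `gk`.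
      have e2 : CT ω₀ (fun x => (Q.eval (x : ℂ) + CT ω₁ h x) * gl x) z = CT ω₀ gk z := by
        refine hω.toIsConc.CT_congr (fun x hx => ?_) z
        have h1 := hQ x (ofReal_mem_cdom (Set.disjoint_left.1 hd hx))
        simp only [gk, gl, h1]
        ring
      have h1 := H.relation hS hk hl hkS hlS hkl hz
      have h2 := hS₁ z (hz' _) (hz' _)
      simp only [e1, e2] at h2
      rw [hl' z hz, hk' z hz, hQ z (hz' _)] at h1
      have h3 := mul_left_cancel₀ (hψS.ne z (hz' _))
        (h1.trans (by ring : _ = ψ S z * (f1 ψ l S z * ((Pk.eval z + CT ω₀ gk z) -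
          CT ω₀ gl z * (Q.eval z + CT ω₁ h z)))))
      rw [f1_insert, apply_insert ψ, h3, eval_sub]
      refine ⟨?_, by linear_combination h2⟩
      linear_combination (-(eps S l * f1 ψ l S z)) * h2
    refine ⟨Pk - S₁, fun hmaxk => ?_, fun z hz => (hmain z hz).1⟩
    have hkl' := hmaxk l (Finset.mem_insert_self l S)
    have hPk0 : Pk = 0 := hPk fun t ht => hmaxk t (Finset.mem_insert_of_mem ht)
    -- For `l < k` this quotient of old minors is bounded at infinity. All transforms tend to zero,
    -- hence so does the polynomial `S₁`.
    have hRbdd : (fun z => Q.eval z + CT ω₁ h z) =O[cobounded ℂ] fun _ => (1 : ℂ) := by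
      refine (hfk.isBigO_div (j := 0) hfl (highCount_insert_le hlS hkS hkl')).congr' ?_ (by simp)
      filter_upwards [eventually_mem_cdom (H.compact (j + 1))] with z hz
      rw [hQ z hz, mul_div_cancel_left₀ _ (hfl.ne z hz)]
    have ht := hω.toIsConc.tendsto_CT hgc
    have ht1 : Tendsto (fun z => CT ω₀ gl z * (Q.eval z + CT ω₁ h z)) (cobounded ℂ) (𝓝 0) := by
      refine (isLittleO_one_iff ℂ).1 ?_
      simpa using ((isLittleO_one_iff ℂ).2 ht).mul_isBigO hRbdd
    obtain ⟨hgT, -, -⟩ := (H.isReg_f1 hT hk hkT).density hregT hd' hd.symm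
      (neg_ne_zero.2 (H.ne (j + 1)))
    have ht2 := ((hω'.toIsConc.tendsto_CT hgT).sub (hω.toIsConc.tendsto_CT hgkc)).add ht1
    simp only [sub_zero, add_zero] at ht2
    have hS0 : S₁ = 0 := by
      have hU := (isOpen_cdom (H.compact j)).inter (isOpen_cdom (H.compact (j + 1)))
      have h1 := eqOn_of_eq_nonreal hU (F := fun z => S₁.eval z) S₁.continuous.continuousOn
        (G := fun z => CT ω₁ (fun x => (-s (j + 1) : ℝ) *
          (f1 ψ k (insert l S) x * stepφ i s σ ψ (insert l S) x)) z - CT ω₀ gk z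
          + CT ω₀ gl z * (Q.eval z + CT ω₁ h z)) ?_ fun z hz => by
            linear_combination -(hmain z hz).2
      · refine eq_zero_of_tendsto_zero (ht2.congr' ?_)
        filter_upwards [eventually_mem_cdom (H.compact j), eventually_mem_cdom (H.compact (j + 1))]
          with z hz hz'
        exact (h1 z ⟨hz, hz'⟩).symm
      · have c1 := (hω'.toIsConc.continuousOn_CT hgT).mono
          (Set.inter_subset_right (s := cdom (D j)) (t := cdom (D (j + 1))))
        have c2 := (hω.toIsConc.continuousOn_CT hgkc).mono
          (Set.inter_subset_left (s := cdom (D j)) (t := cdom (D (j + 1))))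
        have c3 := (hω.toIsConc.continuousOn_CT hgc).mono
          (Set.inter_subset_left (s := cdom (D j)) (t := cdom (D (j + 1))))
        have c4 := (hω'.toIsConc.continuousOn_CT hhc).mono
          (Set.inter_subset_right (s := cdom (D j)) (t := cdom (D (j + 1))))
        exact (c1.sub c2).add (c3.mul (Q.continuous.continuousOn.add c4))
    rw [hS0, hPk0, sub_zero]

end StepData

end

/-! ### Adding a generator: quotients of new minors -/

section

open Filter Topology Bornology

variable {m i k l : ℕ} {D : ℕ → Set ℝ} {s : ℕ → ℝ} {ψ : Finset ℕ → ℂ → ℂ}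
  {η : Finset ℕ → Measure ℝ} {σ τ : Measure ℝ} {S T U V : Finset ℕ} {z : ℂ}

namespace StepData

variable (H : StepData m D s i ψ η σ)
include H

lemma isReg_step (hT : T ⊆ Finset.Icc (i + 1) m) :
    IsReg (D (i + T.card)) (highCount i T) (stepφ i s σ ψ T) :=
  (H.isReg_and_exists_rep T.card T hT rfl).1

lemma isReg_f1_step (hT : T ⊆ Finset.Icc (i + 1) m) (hk : k ∈ Finset.Icc (i + 1) m) (hkT : k ∉ T) :
    IsReg (D (i + T.card + 1)) (highCount i (insert k T)) (f1 (stepφ i s σ ψ) k T) :=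
  (H.isReg_step (Finset.insert_subset hk hT)).f1 hkT

lemma isReg_f2_step (hT : T ⊆ Finset.Icc (i + 1) m) (hk : k ∈ Finset.Icc (i + 1) m) (hkT : k ∉ T)
    (hl : l ∈ Finset.Icc (i + 1) m) (hlT : l ∉ T) (hkl : k ≠ l) :
    IsReg (D (i + T.card + 1 + 1)) (highCount i (insert k (insert l T)))
      (f2 (stepφ i s σ ψ) k l T) :=
  (H.isReg_step (Finset.insert_subset hk (Finset.insert_subset hl hT))).f2 hkT hlT hkl

lemma density_first (hT : T ⊆ Finset.Icc (i + 1) m) (hk : k ∈ Finset.Icc (i + 1) m) (hkT : k ∉ T)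
    {c : ℝ} (hc : c ≠ 0) :
    ContinuousOn (fun x : ℝ => (c : ℂ) * (f1 ψ k T x * stepφ i s σ ψ T x)) (D (i + T.card + 1)) ∧
      (∀ x ∈ D (i + T.card + 1), ((c : ℂ) * (f1 ψ k T x * stepφ i s σ ψ T x)).im = 0) ∧
      ∀ x ∈ D (i + T.card + 1), (c : ℂ) * (f1 ψ k T x * stepφ i s σ ψ T x) ≠ 0 :=
  (H.isReg_f1 hT hk hkT).density (H.isReg_step hT) (H.disjoint _) (H.disjoint _).symm hc

lemma exists_rep_first (hT : T ⊆ Finset.Icc (i + 1) m) (hk : k ∈ Finset.Icc (i + 1) m)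
    (hkT : k ∉ T) : ∃ P : ℂ[X], ∀ z ∈ cdom (D (i + T.card + 1)),
      f1 (stepφ i s σ ψ) k T z = ψ T z * (P.eval z + CT (stepω σ η T)
        (fun x => (-s (i + T.card + 1) : ℝ) * (f1 ψ k T x * stepφ i s σ ψ T x)) z) := by
  obtain ⟨P, -, hP⟩ := (H.isReg_and_exists_rep T.card T hT rfl).2 k hk hkT
  have hω := H.isGen_stepω hT fun h => hkT (h ▸ hk)
  obtain ⟨hc, -, -⟩ := H.density_first hT hk hkT (neg_ne_zero.2 (H.ne (i + T.card + 1)))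
  exact ⟨P, eqOn_of_eq_nonreal (isOpen_cdom (H.compact _)) (H.isReg_f1_step hT hk hkT).cont
    ((H.isReg_ψ hT).cont.mul (P.continuous.continuousOn.add (hω.toIsConc.continuousOn_CT hc))) hP⟩

/-- The quotient `φ_{S∪l} / ψ_S` is bounded at infinity, real on the real line off its interval, and
without zeros. Its polynomial part is therefore a real constant, and `IsGen.exists_inv_eq` inverts
it with the same density up to sign. -/
lemma exists_rep_inv (hS : S ⊆ Finset.Icc (i + 1) m) (hl : l ∈ Finset.Icc (i + 1) m)
    (hlS : l ∉ S) : ∃ τ, IsGen (D (i + S.card + 1)) τ ∧ ∃ P : ℂ[X],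
      ∀ z ∈ cdom (D (i + S.card + 1)), ψ S z = f1 (stepφ i s σ ψ) l S z * (P.eval z + CT τ
        (fun x => s (i + S.card + 1) * (f1 ψ l S x * stepφ i s σ ψ S x)) z) := by
  obtain ⟨P, hP⟩ := H.exists_rep_first hS hl hlS
  have hω := H.isGen_stepω hS fun h => hlS (h ▸ hl)
  obtain ⟨hc, hr, h0⟩ := H.density_first hS hl hlS (neg_ne_zero.2 (H.ne (i + S.card + 1)))
  have hf := H.isReg_f1_step hS hl hlS
  have hψ := H.isReg_ψ hS
  set g : ℝ → ℂ := fun x => (-s (i + S.card + 1) : ℝ) * (f1 ψ l S x * stepφ i s σ ψ S x) with hg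
  have hdiv : ∀ z ∈ cdom (D (i + S.card + 1)),
      f1 (stepφ i s σ ψ) l S z / ψ S z = P.eval z + CT (stepω σ η S) g z := fun z hz => by
    rw [hP z hz, mul_div_cancel_left₀ _ (hψ.ne z hz)]
  have hdeg : P.degree ≤ 0 := by
    refine degree_le_zero_of_isBigO_one ?_
    have h1 := (hf.isBigO_div (j := 0) hψ (highCount_succ_le hlS)).sub
      ((hω.toIsConc.tendsto_CT hc).isBigO_one ℂ)
    refine h1.congr' ?_ (by simp)
    filter_upwards [eventually_mem_cdom (H.compact (i + S.card + 1))] with z hz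
    rw [hdiv z hz, add_sub_cancel_right]
  obtain ⟨c, hc'⟩ : ∃ c : ℝ, ∀ z, P.eval z = c := by
    rw [eq_C_of_degree_le_zero hdeg]
    refine ⟨(P.coeff 0).re, fun z => ?_⟩
    rw [eval_C]
    obtain ⟨x, hx⟩ : ∃ x, x ∉ D (i + S.card + 1) := by
      by_contra! hcon
      exact noncompact_univ ℝ ((Set.eq_univ_of_forall hcon) ▸ H.compact (i + S.card + 1))
    refine Complex.ext (by simp) ?_
    have h1 := hdiv x (ofReal_mem_cdom hx)
    rw [eq_C_of_degree_le_zero hdeg, eval_C] at h1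
    have h2 := congrArg Complex.im h1
    rw [Complex.div_im, hf.real x hx, hψ.real x hx, Complex.add_im, CT_im hω.toIsConc hr] at h2
    simpa using h2.symm
  obtain ⟨τ, hτ, Q, hQ⟩ := hω.exists_inv_eq hc hr h0 c fun z hz => by
    rw [← hc' z, ← hdiv z hz]
    exact div_ne_zero (hf.ne z hz) (hψ.ne z hz)
  refine ⟨τ, hτ, Q, fun z hz => ?_⟩
  have h1 := hQ z hz
  rw [← hc' z, ← hdiv z hz, one_div_div, div_eq_iff (hf.ne z hz)] at h1
  rw [h1, mul_comm, sub_eq_add_neg, ← CT_neg]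
  simp only [hg]
  push_cast
  simp only [neg_mul, neg_neg]

/-- Division of `relation` by `ψ_{S∪l} φ_{S∪l}` gives `φ_{S∪k} / φ_{S∪l} = ψ_{S∪k} / ψ_{S∪l} + (ψ_S
/ φ_{S∪l}) (φ_{S∪{k,l}} / ψ_{S∪l})` up to signs. Of the split product, the transform on the next
interval cancels that of the first summand, and what is left is carried by `τ`. -/
lemma exists_rep_of_measure (hS : S ⊆ Finset.Icc (i + 1) m) (hl : l ∈ Finset.Icc (i + 1) m)
    (hlS : l ∉ S) (hk : k ∈ Finset.Icc (i + 1) m) (hkS : k ∉ S) (hkl : k ≠ l)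
    (hτ : IsGen (D (i + S.card + 1)) τ) {P : ℂ[X]}
    (hP : ∀ z ∈ cdom (D (i + S.card + 1)), ψ S z = f1 (stepφ i s σ ψ) l S z * (P.eval z + CT τ
        (fun x => s (i + S.card + 1) * (f1 ψ l S x * stepφ i s σ ψ S x)) z)) :
    ∃ Q : ℂ[X], ∀ z ∈ cdom (D (i + S.card + 1)),
      f1 (stepφ i s σ ψ) k S z = f1 (stepφ i s σ ψ) l S z * (Q.eval z + CT τ
        (fun x => s (i + S.card + 1) * (f2 (stepφ i s σ ψ) k l S x * stepφ i s σ ψ S x)) z) := by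
  have hT := Finset.insert_subset hl hS
  have hkT : k ∉ insert l S := by simp [hkl, hkS]
  have hSn := Finset.card_insert_of_notMem hlS
  have hω := H.isGen_stepω hT fun h => hkT (h ▸ hk)
  have hωT : stepω σ η (insert l S) = η (insert l S) := if_neg (Finset.insert_ne_empty _ _)
  obtain ⟨P', hP'⟩ := H.exists_rep_first hT hk hkT
  obtain ⟨Q, hQ⟩ := H.fam.rep S hS l hl k hk hlS hkS hkl
  obtain ⟨hhc, -, -⟩ := H.density_first hT hk hkT (neg_ne_zero.2 (H.ne (i + (insert l S).card + 1)))
  obtain ⟨hgc, -, -⟩ := H.density_first hS hl hlS (H.ne (i + S.card + 1))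
  rw [← hωT] at hQ
  rw [show i + 1 + S.card + 1 = i + S.card + 1 + 1 by omega] at hQ
  rw [hSn, ← add_assoc i] at hω hP' hhc
  have hψ := H.isReg_ψ hS
  have hfl := H.isReg_f1 hS hl hlS
  have hΦ := H.isReg_step hS
  have hΦl := H.isReg_f1_step hS hl hlS
  have hΦk := H.isReg_f1_step hS hk hkS
  have hf2 := H.isReg_f2_step hS hk hkS hl hlS hkl
  set j := i + S.card + 1
  have hd := H.disjoint j
  have hd0 : Disjoint (D j) (D (i + S.card)) := (H.disjoint (i + S.card)).symm
  obtain ⟨hkc, -, -⟩ := hf2.density hΦ hd hd0 (H.ne j)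
  set ω := stepω σ η (insert l S)
  set g : ℝ → ℂ := fun x => s j * (f1 ψ l S x * stepφ i s σ ψ S x) with hg
  set h : ℝ → ℂ := fun x => (-s (j + 1) : ℝ) *
    (f1 ψ k (insert l S) x * stepφ i s σ ψ (insert l S) x) with hh
  set h' : ℝ → ℂ := fun x => s (j + 1) * (f2 ψ k l S x * ψ S x) with hh'
  obtain ⟨S₁, hS₁⟩ := exists_poly_mul hτ.toIsConc hω.toIsConc hd hgc hhc P P'
      (F := fun z => P.eval z + CT τ g z) (R := fun z => P'.eval z + CT ω h z)
      (fun _ _ => rfl) (fun _ _ => rfl)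
  refine ⟨S₁ + Q, eqOn_of_eq_nonreal (isOpen_cdom (H.compact j)) hΦk.cont
    (hΦl.cont.mul ((S₁ + Q).continuous.continuousOn.add (hτ.toIsConc.continuousOn_CT hkc))) ?_⟩
  intro z hz
  have hz' : ∀ K, z ∈ cdom K := fun K => mem_cdom_of_im K hz
  have hrel : ∀ z ∈ cdom (D (j + 1)),
      f2 (stepφ i s σ ψ) k l S z = f1 ψ l S z * (P'.eval z + CT ω h z) := fun z hz => by
    have h1 := hP' z hz
    rw [f1_insert, apply_insert ψ, mul_assoc] at h1
    exact mul_left_cancel₀ (eps_ne_zero S l) h1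
  have e1 : CT ω (fun x => (P.eval (x : ℂ) + CT τ g x) * h x) z = -CT ω h' z := by
    rw [← CT_neg]
    refine hω.toIsConc.CT_congr (fun x hx => ?_) z
    have h1 := hP x (ofReal_mem_cdom (Set.disjoint_right.1 hd hx))
    simp only [hh, hh']
    rw [f1_insert, apply_insert (stepφ i s σ ψ) l S x, h1]
    push_cast
    linear_combination (-(eps_mul_self S l)) * s (j + 1) * f2 ψ k l S x *
      f1 (stepφ i s σ ψ) l S x * (P.eval (x : ℂ) + CT τ g x)
  have e2 : CT τ (fun x => (P'.eval (x : ℂ) + CT ω h x) * g x) z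
      = CT τ (fun x => s j * (f2 (stepφ i s σ ψ) k l S x * stepφ i s σ ψ S x)) z := by
    refine hτ.toIsConc.CT_congr (fun x hx => ?_) z
    have h1 := hrel x (ofReal_mem_cdom (Set.disjoint_left.1 hd hx))
    simp only [hg, h1]
    ring
  have h1 := H.relation hS hk hl hkS hlS hkl hz
  have h2 := hS₁ z (hz' _) (hz' _)
  simp only [e1, e2] at h2
  refine mul_left_cancel₀ (hfl.ne z (hz' _)) ?_
  rw [eval_add]
  have h3 := hQ z (hz' _)
  have h4 := hP z (hz' _)
  have h5 := hrel z (hz' _)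
  rw [h3, h5] at h1
  rw [h4] at h1
  linear_combination f1 (stepφ i s σ ψ) l S z * f1 ψ l S z * h2 - h1

end StepData

end

/-! ### Adding a generator: the measure depends only on the index set -/

section

open Filter Topology Bornology

variable {m i j k l : ℕ} {D : ℕ → Set ℝ} {s : ℕ → ℝ} {ψ : Finset ℕ → ℂ → ℂ}
  {η : Finset ℕ → Measure ℝ} {σ τ τ₁ τ₂ : Measure ℝ} {S T U V : Finset ℕ} {z : ℂ}

namespace StepData

variable (H : StepData m D s i ψ η σ)
include H

/-- By `relation`, `ψ_U / φ_{U∪l}` is a combination of `ψ_{U∪k} / φ_{U∪{k,l}}` and `(ψ_{U∪l} /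
φ_{U∪{k,l}}) (φ_{U∪k} / φ_{U∪l})`. The left side is singular only on `D j`. On `D (j + 1)` the two
terms on the right carry `τ₁` and `τ₂` with the same nonvanishing density, so the measures agree by
`eq_of_CT_eq`. -/
lemma measure_unique (hU : U ⊆ Finset.Icc (i + 1) m) (hl : l ∈ Finset.Icc (i + 1) m)
    (hlU : l ∉ U) (hk : k ∈ Finset.Icc (i + 1) m) (hkU : k ∉ U) (hkl : k ≠ l)
    (hj : i + U.card + 1 = j)
    (hτ : IsGen (D j) τ) {P : ℂ[X]}
    (hP : ∀ z ∈ cdom (D j), ψ U z = f1 (stepφ i s σ ψ) l U z * (P.eval z + CT τ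
        (fun x => s j * (f1 ψ l U x * stepφ i s σ ψ U x)) z))
    (hτ₁ : IsGen (D (j + 1)) τ₁) {P₁ : ℂ[X]}
    (hP₁ : ∀ z ∈ cdom (D (j + 1)),
      ψ (insert k U) z = f1 (stepφ i s σ ψ) l (insert k U) z * (P₁.eval z + CT τ₁
        (fun x => s (j + 1) * (f1 ψ l (insert k U) x * stepφ i s σ ψ (insert k U) x)) z))
    (hτ₂ : IsGen (D (j + 1)) τ₂) {P₂ : ℂ[X]}
    (hP₂ : ∀ z ∈ cdom (D (j + 1)),
      ψ (insert l U) z = f1 (stepφ i s σ ψ) k (insert l U) z * (P₂.eval z + CT τ₂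
        (fun x => s (j + 1) * (f1 ψ k (insert l U) x * stepφ i s σ ψ (insert l U) x)) z)) :
    τ₁ = τ₂ := by
  have hlk : l ∉ insert k U := by simp [hkl.symm, hlU]
  have hkl' : k ∉ insert l U := by simp [hkl, hkU]
  have hkT := Finset.insert_subset hk hU
  have hlT := Finset.insert_subset hl hU
  have hck : i + (insert k U).card + 1 = j + 1 := by
    rw [Finset.card_insert_of_notMem hkU]
    omega
  have hcl : i + (insert l U).card + 1 = j + 1 := by
    rw [Finset.card_insert_of_notMem hlU]
    omega
  obtain ⟨Q, hQ⟩ := H.exists_rep_of_measure hU hl hlU hk hkU hkl (by rwa [hj]) (by rwa [hj])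
  have hΦ := H.isReg_step hU
  have hΦl := H.isReg_f1_step hU hl hlU
  have hf2 := H.isReg_f2_step hU hk hkU hl hlU hkl
  have hd0 := (H.disjoint (i + U.card)).symm
  obtain ⟨hgc, -, -⟩ := H.density_first hU hl hlU (H.ne (i + U.card + 1))
  obtain ⟨h1c, hr1, hn1⟩ := H.density_first hkT hl hlk (H.ne (i + (insert k U).card + 1))
  obtain ⟨h2c, -, -⟩ := H.density_first hlT hk hkl' (H.ne (i + (insert l U).card + 1))
  rw [hck] at h1c hr1 hn1
  rw [hcl] at h2c
  rw [hj] at hQ hΦl hf2 hd0 hgc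
  have hd := H.disjoint j
  obtain ⟨hRc, -, -⟩ := hf2.density hΦ hd hd0 (H.ne j)
  set g : ℝ → ℂ := fun x => s j * (f1 ψ l U x * stepφ i s σ ψ U x)
  set r : ℝ → ℂ := fun x => s j * (f2 (stepφ i s σ ψ) k l U x * stepφ i s σ ψ U x)
  set g₁ : ℝ → ℂ := fun x => s (j + 1) *
    (f1 ψ l (insert k U) x * stepφ i s σ ψ (insert k U) x) with hg₁
  set g₂ : ℝ → ℂ := fun x => s (j + 1) *
    (f1 ψ k (insert l U) x * stepφ i s σ ψ (insert l U) x) with hg₂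
  obtain ⟨S₁, hS₁⟩ := exists_poly_mul hτ.toIsConc hτ₂.toIsConc hd hRc h2c Q P₂
      (F := fun z => Q.eval z + CT τ r z) (R := fun z => P₂.eval z + CT τ₂ g₂ z)
      (fun _ _ => rfl) (fun _ _ => rfl)
  have hc2 : ContinuousOn (fun x : ℝ => P₂.eval (x : ℂ) + CT τ₂ g₂ x) (D j) :=
    (continuousOn_eval P₂ _).add ((hτ₂.toIsConc.continuousOn_CT h2c).comp
      Complex.continuous_ofReal.continuousOn fun x hx =>
        ofReal_mem_cdom (Set.disjoint_left.1 hd hx))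
  refine eq_of_CT_eq hτ₁.toIsConc hτ₂.toIsConc hτ.toIsConc hd.symm h1c
    (fun x hx h => hn1 x hx (Complex.ext h (hr1 x hx)))
    (hgc.sub (hc2.fun_mul hRc)) (P - P₁ - S₁) fun z hz => ?_
  have hz' : ∀ K, z ∈ cdom K := fun K => mem_cdom_of_im K hz
  have e1 : CT τ₂ (fun x => (Q.eval (x : ℂ) + CT τ r x) * g₂ x) z = -CT τ₂ g₁ z := by
    rw [← CT_neg]
    refine hτ₂.toIsConc.CT_congr (fun x hx => ?_) z
    have h1 := hQ x (ofReal_mem_cdom (Set.disjoint_right.1 hd hx))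
    simp only [hg₁, hg₂]
    rw [f1_insert, f1_insert, apply_insert (stepφ i s σ ψ) l U x, apply_insert (stepφ i s σ ψ) k U x,
      h1, f2_antisymm ψ hkU hlU hkl]
    linear_combination (-(eps_mul_self U l) + eps_mul_self U k) * s (j + 1) * f2 ψ l k U x *
      f1 (stepφ i s σ ψ) l U x * (Q.eval (x : ℂ) + CT τ r x)
  have e2 : CT τ (fun x => g x - (P₂.eval (x : ℂ) + CT τ₂ g₂ x) * r x) z
      = CT τ g z - CT τ (fun x => (P₂.eval (x : ℂ) + CT τ₂ g₂ x) * r x) z := by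
    rw [sub_eq_add_neg, ← CT_neg, ← hτ.toIsConc.CT_add hgc (hc2.fun_mul hRc).fun_neg (hz' _)]
    simp only [sub_eq_add_neg]
  have h2 := hS₁ z (hz' _) (hz' _)
  simp only [e1] at h2
  simp only [Pi.sub_def, e2, eval_sub]
  have h3 := hP z (hz' _)
  have h4 := hP₁ z (hz' _)
  have h5 := hP₂ z (hz' _)
  have h6 := hQ z (hz' _)
  have hrel := H.relation hU hl hk hlU hkU hkl.symm hz
  rw [f1_insert, apply_insert ψ, mul_assoc] at h4
  rw [f1_insert, apply_insert ψ, mul_assoc, f2_antisymm _ hkU hlU hkl] at h5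
  have h4' := mul_left_cancel₀ (eps_ne_zero U k) h4
  have h5' := mul_left_cancel₀ (eps_ne_zero U l) h5
  have hne : f2 (stepφ i s σ ψ) l k U z * f1 (stepφ i s σ ψ) l U z ≠ 0 :=
    mul_ne_zero ((H.isReg_f2_step hU hl hlU hk hkU hkl.symm).ne z (hz' _)) (hΦl.ne z (hz' _))
  refine mul_left_cancel₀ hne ?_
  rw [h3, h4', h5', h6] at hrel
  linear_combination (-hrel) - f2 (stepφ i s σ ψ) l k U z * f1 (stepφ i s σ ψ) l U z * h2

/-- `exists_rep_inv` gives a measure for each choice of `l ∈ T`. Two choices `k`, `l` are compared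
by `measure_unique` with `T = U ∪ {k, l}`, which also needs the representation for `U ∪ l` from the
smaller size. -/
lemma exists_measure (n : ℕ) : ∀ T ⊆ Finset.Icc (i + 1) m, T.card = n + 1 →
    ∃ τ, IsGen (D (i + T.card)) τ ∧ ∀ l S, l ∉ S → insert l S = T → ∃ P : ℂ[X],
      ∀ z ∈ cdom (D (i + T.card)), ψ S z = f1 (stepφ i s σ ψ) l S z * (P.eval z + CT τ
        (fun x => s (i + T.card) * (f1 ψ l S x * stepφ i s σ ψ S x)) z) := by
  induction n with
  | zero =>
    intro T hT hTn
    obtain ⟨l, rfl⟩ := Finset.card_eq_one.1 hTn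
    obtain ⟨τ, hτ, P, hP⟩ := H.exists_rep_inv (Finset.empty_subset _)
      (hT (Finset.mem_singleton_self l)) (Finset.notMem_empty l)
    refine ⟨τ, hτ, fun l' S hl hS => ⟨P, ?_⟩⟩
    have h1 : l' = l := Finset.mem_singleton.1 (hS ▸ Finset.mem_insert_self l' S)
    subst h1
    have h2 : S = ∅ := by
      have := Finset.card_insert_of_notMem hl
      rw [hS, Finset.card_singleton] at this
      exact Finset.card_eq_zero.1 (by omega)
    subst h2
    exact hP
  | succ n ih =>
    intro T hT hTn
    have hinv : ∀ l S, l ∉ S → insert l S = T → ∃ τ, IsGen (D (i + T.card)) τ ∧ ∃ P : ℂ[X],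
      ∀ z ∈ cdom (D (i + T.card)), ψ S z = f1 (stepφ i s σ ψ) l S z * (P.eval z + CT τ
        (fun x => s (i + T.card) * (f1 ψ l S x * stepφ i s σ ψ S x)) z) := by
      rintro l S hlS rfl
      have h := H.exists_rep_inv ((Finset.subset_insert _ _).trans hT)
        (hT (Finset.mem_insert_self l S)) hlS
      rwa [add_assoc, ← Finset.card_insert_of_notMem hlS] at h
    obtain ⟨l, hl⟩ : T.Nonempty := Finset.card_pos.1 (by omega)
    obtain ⟨τ, hτ, P, hP⟩ := hinv l (T.erase l) (Finset.notMem_erase _ _) (Finset.insert_erase hl)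
    refine ⟨τ, hτ, fun k S hkS hS => ?_⟩
    rcases eq_or_ne k l with rfl | hkl
    · rw [← hS, Finset.erase_insert hkS] at hP
      exact ⟨P, by rwa [← hS]⟩
    · obtain ⟨τ', hτ', P', hP'⟩ := hinv k S hkS hS
      refine ⟨P', ?_⟩
      obtain ⟨U, hlU, rfl⟩ : ∃ U, l ∉ U ∧ S = insert l U :=
        ⟨S.erase l, Finset.notMem_erase _ _, (Finset.insert_erase
          ((Finset.mem_insert.1 (hS.symm ▸ hl)).resolve_left hkl.symm)).symm⟩
      have hkU : k ∉ U := fun h => hkS (Finset.mem_insert_of_mem h)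
      have hTl : T.erase l = insert k U := by
        rw [← hS, Finset.insert_comm, Finset.erase_insert (by simp [hkl.symm, hlU])]
      have hc : T.card = U.card + 1 + 1 := by
        rw [← hS, Finset.card_insert_of_notMem hkS, Finset.card_insert_of_notMem hlU]
      have hkI : k ∈ Finset.Icc (i + 1) m := hT (hS ▸ Finset.mem_insert_self _ _)
      have hUI : U ⊆ Finset.Icc (i + 1) m := fun x hx =>
        hT (hS ▸ Finset.mem_insert_of_mem (Finset.mem_insert_of_mem hx))
      obtain ⟨τ₀, hτ₀, h₀⟩ := ih (insert l U) (Finset.insert_subset (hT hl) hUI)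
        (by rw [Finset.card_insert_of_notMem hlU]; omega)
      obtain ⟨P₀, hP₀⟩ := h₀ l U hlU rfl
      have hc0 : i + (insert l U).card = i + U.card + 1 := by
        rw [Finset.card_insert_of_notMem hlU, add_assoc]
      have hcT : i + T.card = i + U.card + 1 + 1 := by omega
      rw [hc0] at hτ₀ hP₀
      rw [hTl] at hP
      rw [hcT] at hτ hP hτ' hP' ⊢
      rw [H.measure_unique hUI (hT hl) hlU hkI hkU hkl rfl hτ₀ hP₀ hτ hP hτ' hP']
      exact hP'

end StepData

end

/-! ### Adding a generator: the complete family -/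

section

open Filter Topology Bornology

variable {m i j k l : ℕ} {D : ℕ → Set ℝ} {s : ℕ → ℝ} {ψ : Finset ℕ → ℂ → ℂ}
  {η : Finset ℕ → Measure ℝ} {σ τ : Measure ℝ} {S T U V : Finset ℕ} {z : ℂ}

lemma insert_Icc_succ (h : i ≤ m) : insert i (Finset.Icc (i + 1) m) = Finset.Icc i m := by
  ext x
  simp only [Finset.mem_insert, Finset.mem_Icc]
  omega

lemma subset_Icc_succ (hS : S ⊆ Finset.Icc i m) (hi : i ∉ S) : S ⊆ Finset.Icc (i + 1) m := by
  intro x hx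
  have h1 := Finset.mem_Icc.1 (hS hx)
  have h2 : x ≠ i := fun h => hi (h ▸ hx)
  exact Finset.mem_Icc.2 ⟨by omega, h1.2⟩

lemma mem_Icc_succ (hk : k ∈ Finset.Icc i m) (h : k ≠ i) : k ∈ Finset.Icc (i + 1) m := by
  have h1 := Finset.mem_Icc.1 hk
  exact Finset.mem_Icc.2 ⟨by omega, h1.2⟩

lemma exists_eq_insert (hS : S ⊆ Finset.Icc i m) (hi : i ∈ S) :
    ∃ S' ⊆ Finset.Icc (i + 1) m, i ∉ S' ∧ S = insert i S' :=
  ⟨S.erase i, subset_Icc_succ ((Finset.erase_subset _ _).trans hS) (Finset.notMem_erase _ _),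
    Finset.notMem_erase _ _, (Finset.insert_erase hi).symm⟩

namespace StepData

variable (H : StepData m D s i ψ η σ)
include H

lemma isReg_all (hV : V ⊆ Finset.Icc i m) :
    IsReg (D (i + V.card)) (highCount i V) (stepφ i s σ ψ V) := by
  by_cases hi : i ∈ V
  · obtain ⟨V, hV', hi', rfl⟩ := exists_eq_insert hV hi
    rw [stepφ_insert_self hi', highCount_insert_self hi', Finset.card_insert_of_notMem hi', ← add_assoc]
    exact H.isReg_ψ hV'
  · exact H.isReg_step (subset_Icc_succ hV hi)

/-- If `i ∈ S`, this is the relation for `ψ`; if `i` is one of the three indices, it is `relation`.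
Otherwise multiply by `ψ S` and replace each double minor by `relation`: all terms cancel
cyclically. -/
lemma inc_step (hS : S ⊆ Finset.Icc i m) {a b : ℕ} (ha : a ∈ Finset.Icc i m)
    (hb : b ∈ Finset.Icc i m) (hk : k ∈ Finset.Icc i m) (haS : a ∉ S) (hbS : b ∉ S) (hkS : k ∉ S)
    (hab : a ≠ b) (hbk : b ≠ k) (hka : k ≠ a) (hz : z.im ≠ 0) :
    f1 (stepφ i s σ ψ) a S z * f2 (stepφ i s σ ψ) b k S z
      + f1 (stepφ i s σ ψ) b S z * f2 (stepφ i s σ ψ) k a S z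
      + f1 (stepφ i s σ ψ) k S z * f2 (stepφ i s σ ψ) a b S z = 0 := by
  by_cases hi : i ∈ S
  · have hai : a ≠ i := fun h => haS (h ▸ hi)
    have hbi : b ≠ i := fun h => hbS (h ▸ hi)
    have hki : k ≠ i := fun h => hkS (h ▸ hi)
    obtain ⟨S, hS', hi', rfl⟩ := exists_eq_insert hS hi
    have ha' := mem_Icc_succ ha hai
    have hb' := mem_Icc_succ hb hbi
    have hk' := mem_Icc_succ hk hki
    rw [f1_stepφ_insert_self hS' ha', f1_stepφ_insert_self hS' hb', f1_stepφ_insert_self hS' hk',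
      f2_stepφ_insert_self hS' hb' hk', f2_stepφ_insert_self hS' hk' ha',
      f2_stepφ_insert_self hS' ha' hb']
    have := H.fam.inc S hS' a ha' b hb' k hk' (fun h => haS (Finset.mem_insert_of_mem h))
      (fun h => hbS (Finset.mem_insert_of_mem h)) (fun h => hkS (Finset.mem_insert_of_mem h))
      hab hbk hka z hz
    linear_combination -this
  have hS' := subset_Icc_succ hS hi
  have key : ∀ b k, b ∈ Finset.Icc (i + 1) m → k ∈ Finset.Icc (i + 1) m → b ∉ S → k ∉ S → b ≠ k →
      f1 (stepφ i s σ ψ) i S z * f2 (stepφ i s σ ψ) b k S z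
      + f1 (stepφ i s σ ψ) b S z * f2 (stepφ i s σ ψ) k i S z
      + f1 (stepφ i s σ ψ) k S z * f2 (stepφ i s σ ψ) i b S z = 0 := by
    intro b k hb hk hbS hkS hbk
    rw [f1_stepφ_self hS', f2_stepφ_self_right hS' hk, f2_stepφ_self_left hS' hb hbS]
    linear_combination H.relation hS' hb hk hbS hkS hbk hz
  by_cases hai : a = i
  · subst hai
    exact key b k (mem_Icc_succ hb hab.symm) (mem_Icc_succ hk hka) hbS hkS hbk
  have ha' := mem_Icc_succ ha hai
  by_cases hbi : b = i
  · subst hbi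
    have := key k a (mem_Icc_succ hk hbk.symm) ha' hkS haS hka
    linear_combination this
  have hb' := mem_Icc_succ hb hbi
  by_cases hki : k = i
  · subst hki
    have := key a b ha' hb' haS hbS hab
    linear_combination this
  have hk' := mem_Icc_succ hk hki
  refine mul_left_cancel₀ ((H.isReg_ψ hS').ne z (mem_cdom_of_im _ hz)) ?_
  have h1 := H.relation hS' hb' hk' hbS hkS hbk hz
  have h2 := H.relation hS' hk' ha' hkS haS hka hz
  have h3 := H.relation hS' ha' hb' haS hbS hab hz
  linear_combination f1 (stepφ i s σ ψ) a S z * h1 + f1 (stepφ i s σ ψ) b S z * h2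
    + f1 (stepφ i s σ ψ) k S z * h3

/-- Minors with `i` in their column set are old minors and keep the old measures, with `σ` for
`{i}`; the others get those of `exists_measure`. In `rep`, the case `i ∈ S` is the old statement, `l
= i` is `exists_rep_first`, `k = i` is the defining property of the new measure, and the rest is
`exists_rep_of_measure`. -/
lemma exists_family : ∃ ω, Family m D s i (stepφ i s σ ψ) ω := by
  have h : ∀ T, ∃ τ, T ⊆ Finset.Icc (i + 1) m → T.Nonempty → IsGen (D (i + T.card)) τ ∧
      ∀ l S, l ∉ S → insert l S = T → ∃ P : ℂ[X],
      ∀ z ∈ cdom (D (i + T.card)), ψ S z = f1 (stepφ i s σ ψ) l S z * (P.eval z + CT τ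
        (fun x => s (i + T.card) * (f1 ψ l S x * stepφ i s σ ψ S x)) z) := by
    intro T
    by_cases hT : T ⊆ Finset.Icc (i + 1) m
    · by_cases hne : T.Nonempty
      · obtain ⟨n, hn⟩ := Nat.exists_eq_succ_of_ne_zero (Finset.card_pos.2 hne).ne'
        obtain ⟨τ, hτ⟩ := H.exists_measure n T hT hn
        exact ⟨τ, fun _ _ => hτ⟩
      · exact ⟨0, fun _ h => absurd h hne⟩
    · exact ⟨0, fun h => absurd h hT⟩
  choose τ hτ using h
  refine ⟨fun V => if i ∈ V then stepω σ η (V.erase i) else τ V, ?_⟩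
  refine ⟨fun z => by rw [stepφ_empty], fun V hV => (H.isReg_all hV).cont,
    fun V hV => (H.isReg_all hV).real, fun V hV => (H.isReg_all hV).ne,
    fun V hV => (H.isReg_all hV).growth, fun V hV hne hfull => ?_, ?_,
    fun S hS a ha b hb k hk haS hbS hkS hab hbk hka z hz =>
      H.inc_step hS ha hb hk haS hbS hkS hab hbk hka hz⟩
  · split_ifs with hi
    · obtain ⟨V, hV', hi', rfl⟩ := exists_eq_insert hV hi
      rw [Finset.erase_insert hi', Finset.card_insert_of_notMem hi', ← add_assoc]
      refine H.isGen_stepω hV' fun h => hfull ?_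
      rw [h, insert_Icc_succ H.lt.le]
    · exact (hτ V (subset_Icc_succ hV hi) hne).1
  · intro S hS l hl k hk hlS hkS hkl
    by_cases hi : i ∈ S
    · have hli : l ≠ i := fun h => hlS (h ▸ hi)
      have hki : k ≠ i := fun h => hkS (h ▸ hi)
      obtain ⟨S, hS', hi', rfl⟩ := exists_eq_insert hS hi
      have hl' := mem_Icc_succ hl hli
      have hk' := mem_Icc_succ hk hki
      have hlS' : l ∉ S := fun h => hlS (Finset.mem_insert_of_mem h)
      rw [if_pos (by simp), Finset.insert_comm l i, Finset.erase_insert (by simp [hi', hli.symm]),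
        stepω, if_neg (Finset.insert_ne_empty _ _), Finset.card_insert_of_notMem hi']
      obtain ⟨P, hP⟩ := H.fam.rep S hS' l hl' k hk' hlS'
        (fun h => hkS (Finset.mem_insert_of_mem h)) hkl
      rw [show i + 1 + S.card + 1 = i + (S.card + 1) + 1 by omega] at hP
      refine ⟨P, fun z hz => ?_⟩
      rw [f1_stepφ_insert_self hS' hk', f1_stepφ_insert_self hS' hl', hP z hz, neg_mul]
      simp only [f2_stepφ_insert_self hS' hk' hl', stepφ_insert_self hi']
    · have hS' := subset_Icc_succ hS hi
      by_cases hli : l = i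
      · subst hli
        have hk' := mem_Icc_succ hk hkl
        rw [if_pos (by simp), Finset.erase_insert hi]
        obtain ⟨P, hP⟩ := H.exists_rep_first hS' hk' hkS
        refine ⟨P, fun z hz => ?_⟩
        rw [f1_stepφ_self hS', hP z hz]
        simp only [f2_stepφ_self_right hS' hk']
        push_cast
        simp only [neg_mul, mul_neg]
      · have hl' := mem_Icc_succ hl hli
        have hlT := Finset.insert_subset hl' hS'
        rw [if_neg (notMem_of_subset_Icc_succ hlT)]
        obtain ⟨hgen, hrep⟩ := hτ (insert l S) hlT (Finset.insert_nonempty _ _)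
        obtain ⟨P, hP⟩ := hrep l S hlS rfl
        have hc : i + (insert l S).card = i + S.card + 1 := by
          rw [Finset.card_insert_of_notMem hlS, add_assoc]
        rw [hc] at hgen hP
        by_cases hki : k = i
        · subst hki
          refine ⟨P, fun z hz => ?_⟩
          rw [f1_stepφ_self hS', hP z hz]
          simp only [f2_stepφ_self_left hS' hl' hlS]
        · exact H.exists_rep_of_measure hS' hl' hlS (mem_Icc_succ hk hki) hkS hkl hgen hP

lemma stepφ_singleton (hk : k ∈ Finset.Icc (i + 1) m) {z : ℂ} (hz : z ∈ cdom (D (i + 1))) :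
    stepφ i s σ ψ {k} z = -s (i + 1) * CT σ (fun x => ψ {k} x) z := by
  have h := (H.isReg_step (T := {k}) (by simpa using hk)).cont
  rw [Finset.card_singleton] at h
  refine eqOn_of_eq_nonreal (isOpen_cdom (H.compact _)) h (H.continuousOn_first hk)
    (fun z hz => ?_) z hz
  have h1 : eps ∅ k = 1 := eps_eq_one (by simp)
  rw [H.stepφ_eq (by simpa using hk) (by simp) hz, stepE, Finset.sum_singleton]
  simp [h1, H.fam.empty]

end StepData

lemma stepφ_singleton_self : stepφ i s σ ψ {i} = ψ ∅ := by
  simpa using stepφ_insert_self (s := s) (σ := σ) (ψ := ψ) (Finset.notMem_empty i)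

/-- The family of the empty system. -/
lemma family_one (D : ℕ → Set ℝ) (s : ℕ → ℝ) (m : ℕ) : Family m D s m (fun _ _ => 1) fun _ => 0 := by
  have hone : ∀ k ∈ Finset.Icc m m, k = m := fun k hk => by
    have := Finset.mem_Icc.1 hk
    omega
  refine ⟨fun _ => rfl, fun _ _ => continuousOn_const, by simp, by simp, fun V hV => ⟨1, one_ne_zero, ?_⟩,
    fun V hV hne hfull => absurd (hV.antisymm fun x hx => ?_) hfull, fun S _ l hl k hk _ _ hkl =>
      absurd ((hone k hk).trans (hone l hl).symm) hkl, fun S _ a ha b hb _ _ _ _ _ hab =>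
      absurd ((hone a ha).trans (hone b hb).symm) hab⟩
  · have h0 : highCount m V = 0 := by
      refine Finset.card_eq_zero.2 (Finset.filter_false_of_mem fun x hx h => ?_)
      have h1 := Finset.card_pos.2 ⟨x, hx⟩
      have h2 := hone x (hV hx)
      omega
    simp [h0]
  · obtain ⟨y, hy⟩ := hne
    rw [hone x hx, ← hone y (hV hy)]
    exact hy

/-- The functions and measures attached to a Nikishin system. -/
lemma exists_family (hc : ∀ l, IsCompact (D l)) (hd : ∀ l, Disjoint (D l) (D (l + 1)))
    (hs : ∀ l, s l ≠ 0) {μ : ℕ → Measure ℝ} (hμ : ∀ l, 1 < l → l ≤ m → IsGen (D l) (μ l))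
    {Φ : ℕ → ℕ → ℂ → ℂ} (hΦ : ∀ i z, Φ i i z = 1) (hΦ' : ∀ i k z, i < k → k ≤ m →
      Φ i k z = -s (i + 1) * CT (μ (i + 1)) (fun x => Φ (i + 1) k x) z) (hm : 1 ≤ m) :
    ∃ φ ω, Family m D s 1 φ ω ∧ ∀ k ∈ Finset.Icc 1 m, ∀ z ∈ cdom (D 2), φ {k} z = Φ 1 k z := by
  -- Generators are added from the last one down to `μ 2`. The measure `μ 1` is kept apart as the
  -- measure of orthogonality.
  suffices h : ∀ j i, i + j = m → 1 ≤ i → ∃ φ ω, Family m D s i φ ω ∧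
      ∀ k ∈ Finset.Icc i m, ∀ z ∈ cdom (D (i + 1)), φ {k} z = Φ i k z from
    h (m - 1) 1 (by omega) le_rfl
  intro j
  induction j with
  | zero =>
    rintro i rfl -
    refine ⟨fun _ _ => 1, fun _ => 0, family_one D s _, fun k hk z _ => ?_⟩
    have : k = i := by
      have := Finset.mem_Icc.1 hk
      omega
    rw [this, hΦ]
  | succ j ih =>
    intro i hij hi
    obtain ⟨ψ, η, hfam, hψ⟩ := ih (i + 1) (by omega) (by omega)
    have H : StepData m D s i ψ η (μ (i + 1)) :=
      ⟨hc, hd, hs, by omega, hfam, hμ (i + 1) (by omega) (by omega)⟩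
    obtain ⟨ω, hω⟩ := H.exists_family
    refine ⟨_, ω, hω, fun k hk z hz => ?_⟩
    rcases eq_or_ne k i with rfl | hki
    · rw [stepφ_singleton_self, hΦ, hfam.empty]
    · have hk' := mem_Icc_succ hk hki
      have h1 := Finset.mem_Icc.1 hk'
      rw [H.stepφ_singleton hk' hz, hΦ' i k z (by omega) h1.2]
      congr 1
      exact H.gen.toIsConc.CT_congr (fun x hx => hψ k hk' x
        (ofReal_mem_cdom (Set.disjoint_left.1 (hd (i + 1)) hx))) z

end

/-! ### Interpolation and sign changes -/

section

open Filter Topology Bornology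

section Interpolation

variable {D : Set ℝ} {ω : Measure ℝ} {G : ℝ → ℂ} {Z : Finset ℝ}

lemma injOn_ofReal (Z : Finset ℝ) : Set.InjOn (fun x : ℝ => (x : ℂ)) Z :=
  Complex.ofReal_injective.injOn

/-- The barycentric form of Lagrange interpolation of `r` at the nodes `Z`, evaluated at `t`. -/
lemma sum_nodalWeight_div {r : ℂ[X]} (hr : r.degree < Z.card) {t : ℝ} (ht : t ∉ Z) :
    ∑ x ∈ Z, Lagrange.nodalWeight Z (fun x : ℝ => (x : ℂ)) x * r.eval (x : ℂ) / (t - x)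
      = r.eval (t : ℂ) / ∏ x ∈ Z, ((t : ℂ) - x) := by
  have hx : ∀ x ∈ Z, (t : ℂ) ≠ x := fun x hx h => ht (by rwa [Complex.ofReal_inj.1 h])
  have hW : ∏ x ∈ Z, ((t : ℂ) - x) ≠ 0 := Finset.prod_ne_zero_iff.2 fun x h => sub_ne_zero.2 (hx x h)
  have h := congrArg (eval (t : ℂ)) (Lagrange.eq_interpolate (injOn_ofReal Z) hr)
  rw [Lagrange.eval_interpolate_not_at_node _ hx, Lagrange.eval_nodal] at h
  rw [h, mul_div_cancel_left₀ _ hW]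
  refine Finset.sum_congr rfl fun x _ => ?_
  rw [div_eq_mul_inv]
  ring

/-- The divided difference over `Z` annihilates low degrees: apply `sum_nodalWeight_div` to `(t - X)
r`, which vanishes at `t`. -/
lemma sum_nodalWeight_mul {r : ℂ[X]} (hr : r.natDegree + 1 < Z.card) :
    ∑ x ∈ Z, Lagrange.nodalWeight Z (fun x : ℝ => (x : ℂ)) x * r.eval (x : ℂ) = 0 := by
  obtain ⟨t, ht⟩ := Infinite.exists_notMem_finset Z
  have h := sum_nodalWeight_div (Z := Z) (r := (C (t : ℂ) - X) * r) ?_ ht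
  · simp only [eval_mul, eval_sub, eval_C, eval_X, sub_self, zero_mul, zero_div] at h
    rw [← h]
    refine Finset.sum_congr rfl fun x hx => ?_
    have : (t : ℂ) - x ≠ 0 := sub_ne_zero.2 fun h => ht (by rwa [Complex.ofReal_inj.1 h])
    field_simp
  · refine degree_le_natDegree.trans_lt ?_
    have h1 : (C (t : ℂ) - X).natDegree ≤ 1 := (natDegree_sub_le _ _).trans (by simp)
    have h2 := natDegree_mul_le (p := C (t : ℂ) - X) (q := r)
    exact_mod_cast (by omega : ((C (t : ℂ) - X) * r).natDegree < Z.card)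

/-- A function `q + ∫ G(t) dω(t) / (z - t)` with many zeros gives orthogonality relations. -/
lemma IsConc.integral_eq_zero_of_zeros (hω : IsConc D ω) (hG : ContinuousOn G D) {q : ℂ[X]} {n : ℕ}
    (hq : q.degree < n) (hZ : ∀ x ∈ Z, x ∉ D)
    (h0 : ∀ x ∈ Z, q.eval (x : ℂ) + CT ω G x = 0) {h : ℂ[X]} (hh : h.natDegree + n < Z.card) :
    ∫ t, h.eval (t : ℂ) * G t / ∏ x ∈ Z, ((t : ℂ) - x) ∂ω = 0 := by
  set w := Lagrange.nodalWeight Z (fun x : ℝ => (x : ℂ))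
  -- The divided difference over `Z` kills `h q`. Applied in `x` to `h(x) / (x - t)`, it yields
  -- `-h(t) / ∏ (t - x)`, the kernel of the claim.
  have hq0 : ∑ x ∈ Z, w x * (h * q).eval (x : ℂ) = 0 := by
    by_cases hq0 : q = 0
    · simp [hq0]
    · refine sum_nodalWeight_mul ?_
      have h1 := (natDegree_lt_iff_degree_lt hq0).2 hq
      have h2 := natDegree_mul_le (p := h) (q := q)
      omega
  have h1 : ∑ x ∈ Z, w x * h.eval (x : ℂ) * CT ω G x = 0 := by
    rw [← neg_eq_zero, ← Finset.sum_neg_distrib, ← hq0]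
    refine Finset.sum_congr rfl fun x hx => ?_
    rw [eval_mul]
    linear_combination (-(w x * h.eval (x : ℂ))) * h0 x hx
  rw [← neg_eq_zero, ← integral_neg, ← h1]
  have h2 : ∀ x ∈ Z, w x * h.eval (x : ℂ) * CT ω G x
      = ∫ t, w x * h.eval (x : ℂ) * (G t / (x - t)) ∂ω := fun x _ => (integral_const_mul _ _).symm
  rw [Finset.sum_congr rfl h2, ← integral_finsetSum]
  · refine hω.integral_congr fun t ht => ?_
    have ht' : t ∉ Z := fun h => hZ t h ht
    have h3 := sum_nodalWeight_div (r := h) (degree_le_natDegree.trans_lt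
      (by exact_mod_cast (by omega : h.natDegree < Z.card))) ht'
    rw [mul_div_right_comm, ← h3, Finset.sum_mul, ← Finset.sum_neg_distrib]
    refine Finset.sum_congr rfl fun x hx => ?_
    have h4 : (t : ℂ) - x ≠ 0 := sub_ne_zero.2 fun h => ht' (by rwa [Complex.ofReal_inj.1 h])
    have h5 : (x : ℂ) - t ≠ 0 := by rwa [← neg_ne_zero, neg_sub]
    have h6 : (x : ℂ) - t = -((t : ℂ) - x) := by ring
    rw [h6]
    field_simp
    simp only [w]
    ring
  · intro x hx
    exact (hω.integrable_kernel hG (ofReal_mem_cdom (hZ x hx))).const_mul _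

end Interpolation

/-- A polynomial with the same changes of sign as a given function. -/
lemma exists_sign_polynomial (Z : Finset ℝ) : ∀ {D : Set ℝ} (_ : Convex ℝ D) {f : ℝ → ℝ}
    (_ : ContinuousOn f D) (_ : ∀ x ∈ D, x ∉ Z → f x ≠ 0),
    ∃ h : ℝ[X], h.natDegree ≤ Z.card ∧ (∀ x, x ∉ Z → h.eval x ≠ 0) ∧
      ∀ x ∈ D, x ∉ Z → 0 < h.eval x * f x := by
  induction Z using Finset.induction_on_max with
  | empty =>
    intro D hD f hf h0
    rcases sign_const hD hf fun x hx => h0 x hx (Finset.notMem_empty x) with h | h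
    · exact ⟨1, by simp, by simp, fun x hx _ => by simpa using h x hx⟩
    · exact ⟨-1, by simp, by simp, fun x hx _ => by simpa using h x hx⟩
  | insert a Z ha ih =>
    intro D hD f hf h0
    have haZ : a ∉ Z := fun h => (ha a h).false
    obtain ⟨h, hdeg, hne, hpos⟩ := ih (hD.inter (convex_Iio a)) (hf.mono Set.inter_subset_left)
      fun x hx hxZ => h0 x hx.1 (by simp [hxZ, (Set.mem_Iio.1 hx.2).ne])
    have hright := sign_const (hD.inter (convex_Ioi a))
      ((h.continuous.continuousOn.mul hf).mono Set.inter_subset_left) fun x hx => by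
        have hxa : a < x := hx.2
        have hxZ : x ∉ Z := fun h => (ha x h).not_gt hxa
        exact mul_ne_zero (hne x hxZ) (h0 x hx.1 (by simp [hxZ, hxa.ne']))
    rw [Finset.card_insert_of_notMem haZ]
    -- To the right of the largest node `a` the product `h f` has one sign. If it is the wrong one,
    -- the factor `a - X`, positive to the left of `a`, corrects it.
    rcases hright with hr | hr
    · refine ⟨h, by omega, fun x hx => hne x fun h => hx (Finset.mem_insert_of_mem h),
        fun x hx hxZ => ?_⟩
      simp only [Finset.mem_insert, not_or] at hxZ
      rcases lt_or_gt_of_ne hxZ.1 with hxa | hxa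
      · exact hpos x ⟨hx, hxa⟩ hxZ.2
      · exact hr x ⟨hx, hxa⟩
    · refine ⟨(C a - X) * h, ?_, fun x hx => ?_, fun x hx hxZ => ?_⟩
      · have h1 : (C a - X).natDegree ≤ 1 := (natDegree_sub_le _ _).trans (by simp)
        have h2 := natDegree_mul_le (p := C a - X) (q := h)
        omega
      · simp only [Finset.mem_insert, not_or] at hx
        simp only [eval_mul, eval_sub, eval_C, eval_X]
        exact mul_ne_zero (sub_ne_zero.2 (Ne.symm hx.1)) (hne x hx.2)
      · simp only [Finset.mem_insert, not_or] at hxZ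
        simp only [eval_mul, eval_sub, eval_C, eval_X, mul_assoc]
        rcases lt_or_gt_of_ne hxZ.1 with hxa | hxa
        · exact mul_pos (by linarith) (hpos x ⟨hx, hxa⟩ hxZ.2)
        · exact mul_pos_of_neg_of_neg (by linarith) (hr x ⟨hx, hxa⟩)

end

/-! ### Zeros of linear forms in the minors -/

section

open Filter Topology Bornology

variable {m i k l : ℕ} {D : ℕ → Set ℝ} {s : ℕ → ℝ} {φ : Finset ℕ → ℂ → ℂ}
  {ω : Finset ℕ → Measure ℝ} {S : Finset ℕ}

/-- The least index where `n` is largest. The strict inequality for `k < l` pays for the linear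
polynomial part that such a quotient may have. -/
lemma exists_first_max (A : Finset ℕ) (hA : A.Nonempty) (n : ℕ → ℕ) :
    ∃ l ∈ A, ∀ k ∈ A, n k ≤ n l ∧ (k < l → n k < n l) := by
  obtain ⟨b, hb, hmax⟩ := A.exists_max_image n hA
  have hne : (A.filter fun k => n k = n b).Nonempty := ⟨b, by simp [hb]⟩
  have h1 := Finset.mem_filter.1 (Finset.min'_mem _ hne)
  refine ⟨_, h1.1, fun k hk => ⟨by rw [h1.2]; exact hmax k hk, fun hlt => ?_⟩⟩
  rw [h1.2]
  refine lt_of_le_of_ne (hmax k hk) fun h => hlt.not_ge (Finset.min'_le _ _ (by simp [hk, h]))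

/-- Multiplying a representation of a quotient by a polynomial. -/
lemma Family.exists_poly_mul_rep (h : Family m D s i φ ω) (hc : ∀ l, IsCompact (D l))
    (hd : ∀ l, Disjoint (D l) (D (l + 1))) (hs : ∀ l, s l ≠ 0) (hS : S ⊆ Finset.Icc i m)
    (hl : l ∈ Finset.Icc i m) (hk : k ∈ Finset.Icc i m) (hlS : l ∉ S) (hkS : k ∉ S) (hkl : k ≠ l)
    {a b j : ℕ} (hj : j ≤ 1) (hab : a + j ≤ b)
    (hcount : highCount i (insert l S) ≤ highCount i (insert k S) + j) {p : ℂ[X]}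
    (hp : p.degree < a) :
    ∃ q : ℂ[X], q.degree < b ∧ ∀ z ∈ cdom (D (i + S.card + 1)),
      p.eval z * f1 φ k S z = f1 φ l S z * (q.eval z + CT (ω (insert l S))
        (fun x => p.eval (x : ℂ) * (s (i + S.card + 1) * (f2 φ k l S x * φ S x))) z) := by
  obtain ⟨P, hP⟩ := h.rep S hS l hl k hk hlS hkS hkl
  have hgen : IsGen (D (i + S.card + 1)) (ω (insert l S)) := by
    have hT := Finset.insert_subset hl hS
    have := h.gen (insert l S) hT (Finset.insert_nonempty _ _) fun h => by
      rw [← h] at hk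
      exact (Finset.mem_insert.1 hk).elim hkl hkS
    rwa [Finset.card_insert_of_notMem hlS] at this
  have hfl := h.isReg_f1 hS hl hlS
  have hfk := h.isReg_f1 hS hk hkS
  obtain ⟨hgc, -, -⟩ := (h.isReg_f2 hS hk hkS hl hlS hkl).density (h.isReg hS) (hd _)
    (hd _).symm (hs (i + S.card + 1))
  set g : ℝ → ℂ := fun x => s (i + S.card + 1) * (f2 φ k l S x * φ S x)
  -- The orders at infinity allow the quotient to grow at most like `z ^ j`, so `P` has degree at
  -- most `j`; by `hab`, `p * P` then has degree below `b`.
  have hPO : (fun z => P.eval z) =O[cobounded ℂ] fun z => z ^ j := by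
    have h2 : (fun z => CT (ω (insert l S)) g z) =O[cobounded ℂ] fun z : ℂ => z ^ j := by
      refine ((hgen.toIsConc.tendsto_CT hgc).isBigO_one ℂ).trans (IsBigO.of_bound 1 ?_)
      filter_upwards [tendsto_norm_cobounded_atTop.eventually_ge_atTop (1 : ℝ)] with z hz
      rw [norm_one, norm_pow, one_mul]
      exact one_le_pow₀ hz
    refine ((hfk.isBigO_div hfl hcount).sub h2).congr' ?_ (by simp)
    filter_upwards [eventually_mem_cdom (hc (i + S.card + 1))] with z hz
    rw [hP z hz, mul_div_cancel_left₀ _ (hfl.ne z hz), add_sub_cancel_right]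
  have hPdeg : P.natDegree ≤ j := by
    rcases Nat.le_one_iff_eq_zero_or_eq_one.1 hj with rfl | rfl
    · exact natDegree_le_iff_degree_le.2 (degree_le_zero_of_isBigO_one (by simpa using hPO))
    · exact natDegree_le_iff_degree_le.2 (degree_le_one_of_isBigO (by simpa using hPO))
  obtain ⟨Q, hQ, hQ'⟩ := hgen.toIsConc.poly_mul_CT b hgc p
    (hp.trans_le (by exact_mod_cast (by omega : a ≤ b + 1)))
  refine ⟨p * P + Q, (degree_add_le _ _).trans_lt (max_lt ?_ hQ), fun z hz => ?_⟩
  · by_cases hp0 : p = 0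
    · simp [hp0]
    · have h1 := (natDegree_lt_iff_degree_lt hp0).2 hp
      have h2 := natDegree_mul_le (p := p) (q := P)
      exact degree_le_natDegree.trans_lt (by exact_mod_cast (by omega : (p * P).natDegree < b))
  · rw [hP z hz, eval_add, eval_mul]
    linear_combination f1 φ l S z * hQ' z hz

lemma eval_map_ofReal (p : ℝ[X]) (x : ℝ) :
    (p.map Complex.ofRealHom).eval (x : ℂ) = (p.eval x : ℝ) :=
  eval_map_apply Complex.ofRealHom x

lemma degree_map_ofReal (p : ℝ[X]) : (p.map Complex.ofRealHom).degree = p.degree :=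
  degree_map p Complex.ofRealHom

lemma sum_insert_rep {A : Finset ℕ} {μ : Measure ℝ} {K : Set ℝ} (hμ : IsConc K μ)
    {F : ℕ → ℂ → ℂ} {F₀ : ℂ → ℂ} {q : ℕ → ℂ[X]} {g : ℕ → ℝ → ℂ} {a : ℂ[X]}
    (hg : ∀ k ∈ A, ContinuousOn (g k) K) {z : ℂ} (hz : z ∈ cdom K)
    (h : ∀ k ∈ A, F k z = F₀ z * ((q k).eval z + CT μ (g k) z)) :
    a.eval z * F₀ z + ∑ k ∈ A, F k z
      = F₀ z * ((a + ∑ k ∈ A, q k).eval z + CT μ (fun x => ∑ k ∈ A, g k x) z) := by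
  rw [hμ.CT_sum A hg hz, Finset.sum_congr rfl h, ← Finset.mul_sum, Finset.sum_add_distrib,
    eval_add, eval_finsetSum]
  ring

/-- A bound for the number of zeros of the linear forms. -/
lemma Family.card_zeros_lt (h : Family m D s i φ ω) (hc : ∀ l, IsCompact (D l))
    (hd : ∀ l, Disjoint (D l) (D (l + 1))) (hs : ∀ l, s l ≠ 0) (N : ℕ) :
    ∀ S ⊆ Finset.Icc i m, (Finset.Icc i m \ S).card = N → ∀ (p : ℕ → ℝ[X]) (n : ℕ → ℕ),
    (∀ k ∈ Finset.Icc i m \ S, (p k).degree < n k) → (∃ k ∈ Finset.Icc i m \ S, p k ≠ 0) →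
    ∀ Z : Finset ℝ, (∀ x ∈ Z, x ∉ D (i + S.card + 1)) →
    (∀ x ∈ Z, ∑ k ∈ Finset.Icc i m \ S, ((p k).eval x : ℝ) * f1 φ k S x = 0) →
    Z.card < ∑ k ∈ Finset.Icc i m \ S, n k := by
  induction N with
  | zero =>
    intro S _ hN p n _ hne
    rw [Finset.card_eq_zero] at hN
    simp [hN] at hne
  | succ N ih =>
    intro S hS hN p n hdeg hne Z hZ h0
    -- For this `l`, division by `f1 φ l S` leaves a polynomial part of degree below `n l`.
    obtain ⟨l, hlA, hlmax⟩ := exists_first_max _ (Finset.card_pos.1 (by rw [hN]; omega)) n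
    have hl := (Finset.mem_sdiff.1 hlA).1
    have hlS := (Finset.mem_sdiff.1 hlA).2
    have hT := Finset.insert_subset hl hS
    have hA : Finset.Icc i m \ S = insert l (Finset.Icc i m \ insert l S) := by
      ext x
      simp only [Finset.mem_insert, Finset.mem_sdiff] at hlA ⊢
      by_cases hx : x = l
      · simp [hx, hlA]
      · simp [hx]
    have hlB : l ∉ Finset.Icc i m \ insert l S := by simp
    have hB : ∀ k ∈ Finset.Icc i m \ insert l S, k ∈ Finset.Icc i m ∧ k ≠ l ∧ k ∉ S := by
      intro k hk
      simp only [Finset.mem_sdiff, Finset.mem_insert, not_or] at hk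
      exact hk
    have hfl := h.isReg_f1 hS hl hlS
    rw [hA, Finset.sum_insert hlB]
    simp only [hA, Finset.sum_insert hlB] at h0
    by_cases hall : ∀ k ∈ Finset.Icc i m \ insert l S, p k = 0
    · have hpl : p l ≠ 0 := by
        obtain ⟨k, hk, hk0⟩ := hne
        rw [hA] at hk
        rcases Finset.mem_insert.1 hk with rfl | hk
        · exact hk0
        · exact absurd (hall k hk) hk0
      have h1 : Z.card ≤ (p l).natDegree := by
        refine Polynomial.card_le_degree_of_subset_roots fun x hx => ?_
        rw [mem_roots hpl, IsRoot]
        have h2 := h0 x hx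
        rw [Finset.sum_eq_zero fun k hk => by simp [hall k hk], add_zero] at h2
        exact_mod_cast (mul_eq_zero.1 h2).resolve_right (hfl.ne x (ofReal_mem_cdom (hZ x hx)))
      have h2 := (natDegree_lt_iff_degree_lt hpl).2 (hdeg l hlA)
      omega
    push Not at hall
    by_contra! hcard
    have hBA : ∀ k ∈ Finset.Icc i m \ insert l S, k ∈ Finset.Icc i m \ S := fun k hk => by
      rw [hA]
      exact Finset.mem_insert_of_mem hk
    have hNB : (Finset.Icc i m \ insert l S).card = N := by
      rw [hA, Finset.card_insert_of_notMem hlB] at hN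
      omega
    have hrep : ∀ k, ∃ q : ℂ[X], k ∈ Finset.Icc i m \ insert l S → q.degree < n l ∧
        ∀ z ∈ cdom (D (i + S.card + 1)), ((p k).map Complex.ofRealHom).eval z * f1 φ k S z
          = f1 φ l S z * (q.eval z + CT (ω (insert l S)) (fun x =>
            ((p k).map Complex.ofRealHom).eval (x : ℂ) *
              (s (i + S.card + 1) * (f2 φ k l S x * φ S x))) z) := by
      intro k
      by_cases hk : k ∈ Finset.Icc i m \ insert l S
      · obtain ⟨hkI, hkl, hkS⟩ := hB k hk
        obtain ⟨hle, hlt⟩ := hlmax k (hBA k hk)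
        have hdk := hdeg k (hBA k hk)
        rw [← degree_map_ofReal] at hdk
        rcases lt_or_gt_of_ne hkl with hkl' | hkl'
        · obtain ⟨q, hq⟩ := h.exists_poly_mul_rep hc hd hs hS hl hkI hlS hkS hkl (j := 1) le_rfl
            (hlt hkl') (highCount_insert_le_add_one hlS hkS) hdk
          exact ⟨q, fun _ => hq⟩
        · obtain ⟨q, hq⟩ := h.exists_poly_mul_rep hc hd hs hS hl hkI hlS hkS hkl (j := 0) (by omega)
            hle (highCount_insert_le hlS hkS hkl') hdk
          exact ⟨q, fun _ => hq⟩
      · exact ⟨0, fun h => absurd h hk⟩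
    choose q hq using hrep
    obtain ⟨k₀, hk₀, hpk₀⟩ := hall
    have hcT : i + (insert l S).card = i + S.card + 1 := by
      rw [Finset.card_insert_of_notMem hlS, add_assoc]
    have hgen : IsGen (D (i + S.card + 1)) (ω (insert l S)) := by
      have := h.gen (insert l S) hT (Finset.insert_nonempty _ _) fun h => by
        have := (Finset.mem_sdiff.1 hk₀).2
        rw [h] at this
        exact this (hB k₀ hk₀).1
      rwa [hcT] at this
    have hih := ih (insert l S) hT hNB p n (fun k hk => hdeg k (hBA k hk)) ⟨k₀, hk₀, hpk₀⟩
    rw [hcT] at hih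
    have hregT : ∀ k ∈ Finset.Icc i m \ insert l S, IsReg (D (i + S.card + 1 + 1))
        (highCount i (insert k (insert l S))) (f1 φ k (insert l S)) := fun k hk => by
      have := h.isReg_f1 hT (hB k hk).1 (Finset.mem_sdiff.1 hk).2
      rwa [hcT] at this
    have hregS := h.isReg hS
    set j := i + S.card + 1
    have hd0 : Disjoint (D j) (D (i + S.card)) := (hd (i + S.card)).symm
    set B := Finset.Icc i m \ insert l S
    set g : ℕ → ℝ → ℂ := fun k x => ((p k).map Complex.ofRealHom).eval (x : ℂ) *
      (s j * (f2 φ k l S x * φ S x)) with hg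
    set fT : ℝ → ℂ := fun x => ∑ k ∈ B, ((p k).eval x : ℝ) * f1 φ k (insert l S) x with hfT
    have hG : ∀ x, ∑ k ∈ B, g k x = s j * (eps S l * (φ S x * fT x)) := fun x => by
      simp only [hg, hfT, Finset.mul_sum]
      refine Finset.sum_congr rfl fun k _ => ?_
      rw [eval_map_ofReal, f2_eq]
      ring
    have hgc : ∀ k ∈ B, ContinuousOn (g k) (D j) := fun k hk =>
      (continuousOn_eval _ _).fun_mul ((h.isReg_f2 hS (hB k hk).1 (hB k hk).2.2 hl hlS
        (hB k hk).2.1).density hregS (hd j) hd0 (hs j)).1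
    have hGc : ContinuousOn (fun x => ∑ k ∈ B, g k x) (D j) := continuousOn_finsetSum _ hgc
    have hfTim : ∀ x ∈ D j, (fT x).im = 0 := fun x hx => by
      simp only [hfT, Complex.im_sum]
      exact Finset.sum_eq_zero fun k hk => im_mul_eq_zero (Complex.ofReal_im _)
        ((hregT k hk).real x (Set.disjoint_left.1 (hd j) hx))
    -- The induction hypothesis bounds every finite set of zeros of the next form, so all its zeros
    -- on `D j` form a finite set.
    have hfin : {x | x ∈ D j ∧ fT x = 0}.Finite := by
      by_contra hinf
      obtain ⟨Z', hZ', hZ'c⟩ := Set.Infinite.exists_subset_card_eq hinf (∑ k ∈ B, n k)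
      exact (hih Z' (fun x hx => Set.disjoint_left.1 (hd j) (hZ' hx).1)
        fun x hx => (hZ' hx).2).ne hZ'c
    set Z' := hfin.toFinset with hZ'
    have hmem : ∀ x, x ∈ Z' ↔ x ∈ D j ∧ fT x = 0 := fun x => by simp [hZ']
    have hZ'c : Z'.card < ∑ k ∈ B, n k := hih Z'
      (fun x hx => Set.disjoint_left.1 (hd j) ((hmem x).1 hx).1) fun x hx => ((hmem x).1 hx).2
    have hW : ∀ t ∈ D j, ∏ x ∈ Z, ((t : ℂ) - x) ≠ 0 := fun t ht =>
      Finset.prod_ne_zero_iff.2 fun x hx => sub_ne_zero.2 fun h => hZ x hx (by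
        rwa [← Complex.ofReal_inj.1 h])
    set v : ℝ → ℂ := fun t => (∑ k ∈ B, g k t) / ∏ x ∈ Z, ((t : ℂ) - x) with hv
    have hvc : ContinuousOn v (D j) := hGc.div (by fun_prop) hW
    have hvim : ∀ t ∈ D j, (v t).im = 0 := fun t ht => by
      have e : ∏ x ∈ Z, ((t : ℂ) - x) = ((∏ x ∈ Z, (t - x) : ℝ) : ℂ) := by push_cast; rfl
      have h1 : (s j * (eps S l * (φ S t * fT t)) : ℂ).im = 0 :=
        im_mul_eq_zero (Complex.ofReal_im _) (im_mul_eq_zero (eps_im _ _) (im_mul_eq_zero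
          (hregS.real t (Set.disjoint_left.1 hd0 ht)) (hfTim t ht)))
      simp only [hv]
      rw [hG, e, Complex.div_ofReal_im, h1, zero_div]
    have hv0 : ∀ t ∈ D j, t ∉ Z' → (v t).re ≠ 0 := fun t ht htZ h1 => by
      have h2 : v t ≠ 0 := by
        refine div_ne_zero ?_ (hW t ht)
        rw [hG]
        exact mul_ne_zero (Complex.ofReal_ne_zero.2 (hs j)) (mul_ne_zero (eps_ne_zero S l)
          (mul_ne_zero (hregS.ne _ (ofReal_mem_cdom (Set.disjoint_left.1 hd0 ht)))
            fun h => htZ ((hmem t).2 ⟨ht, h⟩)))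
      exact h2 (Complex.ext h1 (hvim t ht))
    -- On `D j` the density `v` vanishes only where the next form does. Since `deg r ≤ |Z'| < ∑ k ∈
    -- B, n k`, one has `deg r + n l < |Z|`: the zeros in `Z` make `∫ r v` vanish, although it is
    -- positive.
    obtain ⟨r, hrdeg, -, hrpos⟩ := exists_sign_polynomial Z' hgen.convex
      (Complex.continuous_re.comp_continuousOn hvc) hv0
    have hpos := hgen.integral_pos (f := fun t => r.eval t * (v t).re)
      (r.continuous.continuousOn.mul (Complex.continuous_re.comp_continuousOn hvc))
      (fun t ht => by
        by_cases htZ : t ∈ Z'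
        · simp [hv, hG, ((hmem t).1 htZ).2]
        · exact (hrpos t ht htZ).le) Z'.finite_toSet fun t ht htZ => hrpos t ht htZ
    have hzero := hgen.toIsConc.integral_eq_zero_of_zeros hGc (n := n l)
      (q := (p l).map Complex.ofRealHom + ∑ k ∈ B, q k) (Z := Z)
      (h := r.map Complex.ofRealHom) ?_ hZ ?_ ?_
    · refine hpos.ne' (Complex.ofReal_injective ?_)
      rw [Complex.ofReal_zero, ← hzero, ← integral_complex_ofReal]
      refine hgen.toIsConc.integral_congr fun t ht => ?_
      rw [eval_map_ofReal, mul_div_assoc]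
      push_cast
      congr 1
      exact Complex.ext (by simp [hv]) (by simpa [hv] using (hvim t ht).symm)
    · refine (degree_add_le _ _).trans_lt (max_lt ?_ ?_)
      · rw [degree_map_ofReal]
        exact hdeg l hlA
      · exact (degree_sum_le _ _).trans_lt ((Finset.sup_lt_iff (WithBot.bot_lt_coe _)).2 fun k hk =>
          (hq k hk).1)
    · intro x hx
      have hx' : (x : ℂ) ∈ cdom (D j) := ofReal_mem_cdom (hZ x hx)
      have h1 := sum_insert_rep hgen.toIsConc (a := (p l).map Complex.ofRealHom) hgc hx'
        (F := fun k z => ((p k).map Complex.ofRealHom).eval z * f1 φ k S z) (F₀ := f1 φ l S) (q := q)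
        fun k hk => (hq k hk).2 x hx'
      simp only [eval_map_ofReal] at h1
      rw [h0 x hx] at h1
      exact (mul_eq_zero.1 h1.symm).resolve_left (hfl.ne x hx')
    · have h1 : (r.map Complex.ofRealHom).natDegree ≤ r.natDegree := natDegree_map_le
      omega

end

/-! ### Orthogonality of the linear forms -/

section

open Filter Topology Bornology

variable {m : ℕ} {D : ℕ → Set ℝ} {s : ℕ → ℝ} {φ : Finset ℕ → ℂ → ℂ}
  {ω : Finset ℕ → Measure ℝ} {μ : Measure ℝ} {n : ℕ → ℕ}

lemma f1_empty (φ : Finset ℕ → ℂ → ℂ) (k : ℕ) : f1 φ k ∅ = φ {k} := by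
  funext z
  have h1 : eps ∅ k = 1 := eps_eq_one (by simp)
  rw [f1, h1, one_mul, LawfulSingleton.insert_empty_eq]

lemma Family.isReg_singleton {i k : ℕ} (h : Family m D s i φ ω) (hk : k ∈ Finset.Icc i m) :
    IsReg (D (i + 1)) (highCount i {k}) (φ {k}) := by
  have := h.isReg (V := {k}) (by simpa using hk)
  rwa [Finset.card_singleton] at this

lemma integral_poly_mul_eq_zero {K : Set ℝ} (hμ : IsConc K μ) {f : ℝ → ℝ} (hf : ContinuousOn f K)
    {N : ℕ} (h : ∀ ν < N, ∫ x, x ^ ν * f x ∂μ = 0) {r : ℝ[X]} (hr : r.natDegree < N) :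
    ∫ x, r.eval x * f x ∂μ = 0 := by
  have e : ∀ x : ℝ, r.eval x * f x = ∑ ν ∈ Finset.range N, r.coeff ν * (x ^ ν * f x) := fun x => by
    rw [eval_eq_sum_range' hr, Finset.sum_mul]
    simp only [mul_assoc]
  simp only [e]
  rw [integral_finsetSum]
  · refine Finset.sum_eq_zero fun ν hν => ?_
    rw [integral_const_mul, h ν (Finset.mem_range.1 hν), mul_zero]
  · exact fun ν _ => (hμ.integrable ((continuousOn_pow ν).mul hf)).const_mul _

/-- Linear forms with too many vanishing moments are zero: the case of real coefficients. -/
lemma Family.eq_zero_of_moments_real (h : Family m D s 1 φ ω) (hc : ∀ l, IsCompact (D l))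
    (hd : ∀ l, Disjoint (D l) (D (l + 1))) (hs : ∀ l, s l ≠ 0) (hμ : IsGen (D 1) μ)
    {p : ℕ → ℝ[X]} (hp : ∀ k ∈ Finset.Icc 1 m, (p k).degree < n k)
    (h0 : ∀ ν < ∑ k ∈ Finset.Icc 1 m, n k,
      ∫ x : ℝ, x ^ ν * ∑ k ∈ Finset.Icc 1 m, (p k).eval x * (φ {k} x).re ∂μ = 0) :
    ∀ k ∈ Finset.Icc 1 m, p k = 0 := by
  by_contra hne
  push Not at hne
  have hz := h.card_zeros_lt hc hd hs _ ∅ (Finset.empty_subset _) rfl p n (by simpa using hp)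
    (by simpa using hne)
  simp only [Finset.sdiff_empty, Finset.card_empty, f1_empty] at hz
  have hdis : ∀ x ∈ D 1, x ∉ D (1 + 0 + 1) := fun x hx => Set.disjoint_left.1 (hd 1) hx
  set f : ℝ → ℝ := fun x => ∑ k ∈ Finset.Icc 1 m, (p k).eval x * (φ {k} x).re with hf
  have hfx : ∀ x ∈ D 1, ∑ k ∈ Finset.Icc 1 m, ((p k).eval x : ℝ) * φ {k} x = f x := fun x hx => by
    simp only [hf]
    push_cast
    refine Finset.sum_congr rfl fun k hk => ?_
    congr 1
    exact Complex.ext (by simp) (by simpa using (h.isReg_singleton hk).real x (hdis x hx))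
  have hfc : ContinuousOn f (D 1) := continuousOn_finsetSum _ fun k hk =>
    (p k).continuous.continuousOn.mul (Complex.continuous_re.comp_continuousOn
      ((h.isReg_singleton hk).continuousOn_ofReal (hd 1)))
  have hfin : {x | x ∈ D 1 ∧ f x = 0}.Finite := by
    by_contra hinf
    obtain ⟨Z', hZ', hZ'c⟩ := Set.Infinite.exists_subset_card_eq hinf (∑ k ∈ Finset.Icc 1 m, n k)
    exact (hz Z' (fun x hx => hdis x (hZ' hx).1)
      fun x hx => by rw [hfx x (hZ' hx).1, (hZ' hx).2, Complex.ofReal_zero]).ne hZ'c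
  have hmem : ∀ x, x ∈ hfin.toFinset ↔ x ∈ D 1 ∧ f x = 0 := fun x => by simp
  have hcard := hz hfin.toFinset (fun x hx => hdis x ((hmem x).1 hx).1) fun x hx => by
    rw [hfx x ((hmem x).1 hx).1, ((hmem x).1 hx).2, Complex.ofReal_zero]
  -- The form has fewer than `∑ n k` zeros on `D 1`, so `r` is of a degree covered by `h0`, and `∫ r
  -- f` would be both zero and positive.
  obtain ⟨r, hrdeg, -, hrpos⟩ := exists_sign_polynomial hfin.toFinset hμ.convex hfc
    fun x hx hxZ hx0 => hxZ ((hmem x).2 ⟨hx, hx0⟩)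
  refine (hμ.integral_pos (r.continuous.continuousOn.mul hfc) (fun t ht => ?_)
    hfin.toFinset.finite_toSet fun t ht htZ => hrpos t ht htZ).ne'
    (integral_poly_mul_eq_zero hμ.toIsConc hfc h0 (by omega))
  by_cases htZ : t ∈ hfin.toFinset
  · simp [((hmem t).1 htZ).2]
  · exact (hrpos t ht htZ).le

/-- Since the functions `φ {k}` are real on `D 1`, the vanishing moments of a complex form split
into those of two real forms; zeros are counted only for the latter. -/
lemma exists_re_im {p : ℂ[X]} {a : ℕ} (hp : p.degree < a) : ∃ q r : ℝ[X], q.degree < a ∧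
    r.degree < a ∧ (∀ x : ℝ, (p.eval (x : ℂ)).re = q.eval x ∧ (p.eval (x : ℂ)).im = r.eval x) ∧
    (q = 0 → r = 0 → p = 0) := by
  have hdeg : ∀ c : ℕ → ℝ, (∑ i ∈ Finset.range a, monomial i (c i)).degree < (a : WithBot ℕ) :=
    fun c => (degree_sum_le _ _).trans_lt ((Finset.sup_lt_iff (WithBot.bot_lt_coe _)).2 fun i hi =>
      (degree_monomial_le _ _).trans_lt (by exact_mod_cast Finset.mem_range.1 hi))
  have hcoeff : ∀ c : ℕ → ℝ, ∀ i < a, (∑ i ∈ Finset.range a, monomial i (c i)).coeff i = c i :=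
    fun c i hi => by
      rw [finsetSum_coeff]
      simp [coeff_monomial, hi]
  have hp' : ∀ x : ℝ, p.eval (x : ℂ) = ∑ i ∈ Finset.range a, p.coeff i * ((x ^ i : ℝ) : ℂ) := by
    intro x
    by_cases h0 : p = 0
    · simp [h0]
    · rw [eval_eq_sum_range' ((natDegree_lt_iff_degree_lt h0).2 hp)]
      push_cast
      rfl
  refine ⟨∑ i ∈ Finset.range a, monomial i (p.coeff i).re,
    ∑ i ∈ Finset.range a, monomial i (p.coeff i).im, hdeg _, hdeg _, fun x => ?_, fun hq hr => ?_⟩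
  · rw [hp']
    simp only [Complex.re_sum, Complex.im_sum, eval_finsetSum, eval_monomial, Complex.re_mul_ofReal,
      Complex.im_mul_ofReal, and_self]
  · ext i
    by_cases hi : i < a
    · have h1 := hcoeff (fun i => (p.coeff i).re) i hi
      have h2 := hcoeff (fun i => (p.coeff i).im) i hi
      rw [hq] at h1
      rw [hr] at h2
      exact Complex.ext h1.symm h2.symm
    · exact coeff_eq_zero_of_degree_lt (hp.trans_le (by exact_mod_cast not_lt.1 hi))

/-- Linear forms with too many vanishing moments are zero. -/
lemma Family.eq_zero_of_moments (h : Family m D s 1 φ ω) (hc : ∀ l, IsCompact (D l))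
    (hd : ∀ l, Disjoint (D l) (D (l + 1))) (hs : ∀ l, s l ≠ 0) (hμ : IsGen (D 1) μ)
    {p : ℕ → ℂ[X]} (hp : ∀ k ∈ Finset.Icc 1 m, (p k).degree < n k)
    (h0 : ∀ ν < ∑ k ∈ Finset.Icc 1 m, n k,
      ∫ x : ℝ, (x : ℂ) ^ ν * ∑ k ∈ Finset.Icc 1 m, (p k).eval (x : ℂ) * φ {k} x ∂μ = 0) :
    ∀ k ∈ Finset.Icc 1 m, p k = 0 := by
  have hex : ∀ k, ∃ q r : ℝ[X], k ∈ Finset.Icc 1 m → q.degree < n k ∧ r.degree < n k ∧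
      (∀ x : ℝ, ((p k).eval (x : ℂ)).re = q.eval x ∧ ((p k).eval (x : ℂ)).im = r.eval x) ∧
      (q = 0 → r = 0 → p k = 0) := fun k => by
    by_cases hk : k ∈ Finset.Icc 1 m
    · obtain ⟨q, r, hqr⟩ := exists_re_im (hp k hk)
      exact ⟨q, r, fun _ => hqr⟩
    · exact ⟨0, 0, fun h => absurd h hk⟩
  choose q r hqr using hex
  have hreal : ∀ x ∈ D 1, ∀ k ∈ Finset.Icc 1 m, φ {k} x = ((φ {k} x).re : ℂ) := fun x hx k hk =>
    Complex.ext (by simp) (((h.isReg_singleton hk).real x (Set.disjoint_left.1 (hd 1) hx)).trans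
      (Complex.ofReal_im _).symm)
  have hint : ∀ ν, Integrable (fun x : ℝ => (x : ℂ) ^ ν *
      ∑ k ∈ Finset.Icc 1 m, (p k).eval (x : ℂ) * φ {k} x) μ := fun ν =>
    hμ.toIsConc.integrable (((Complex.continuous_ofReal.pow ν).continuousOn).mul
      (continuousOn_finsetSum _ fun k hk => (continuousOn_eval _ _).mul
        ((h.isReg_singleton hk).continuousOn_ofReal (hd 1))))
  have hq := h.eq_zero_of_moments_real hc hd hs hμ (p := q) (fun k hk => (hqr k hk).1) fun ν hν => by
    have h1 := congrArg Complex.re (h0 ν hν)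
    rw [Complex.zero_re] at h1
    rw [← h1]
    refine Eq.trans ?_ (integral_re (hint ν))
    refine hμ.toIsConc.integral_congr fun x hx => ?_
    rw [← Complex.ofReal_pow]
    simp only [RCLike.re_to_complex, Complex.re_ofReal_mul, Complex.re_sum]
    congr 1
    refine Finset.sum_congr rfl fun k hk => ?_
    rw [hreal x hx k hk, Complex.re_mul_ofReal, ((hqr k hk).2.2.1 x).1, Complex.ofReal_re]
  have hr := h.eq_zero_of_moments_real hc hd hs hμ (p := r) (fun k hk => (hqr k hk).2.1)
    fun ν hν => by
    have h1 := congrArg Complex.im (h0 ν hν)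
    rw [Complex.zero_im] at h1
    rw [← h1]
    refine Eq.trans ?_ (integral_im (hint ν))
    refine hμ.toIsConc.integral_congr fun x hx => ?_
    rw [← Complex.ofReal_pow]
    simp only [RCLike.im_to_complex, Complex.im_ofReal_mul, Complex.im_sum]
    congr 1
    refine Finset.sum_congr rfl fun k hk => ?_
    rw [hreal x hx k hk, Complex.im_mul_ofReal, ((hqr k hk).2.2.1 x).2, Complex.ofReal_re]
  exact fun k hk => (hqr k hk).2.2.2 (hq k hk) (hr k hk)

end

/-! ### From moments to Hermite–Padé normality -/

section

open Filter Topology Bornology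

section Moments

variable {D : Set ℝ} {μ : Measure ℝ} {g : ℝ → ℂ}

lemma continuousOn_ofReal_mul (hg : ContinuousOn g D) :
    ContinuousOn (fun x : ℝ => (x : ℂ) * g x) D :=
  Complex.continuous_ofReal.continuousOn.fun_mul hg

/-- By `IsConc.mul_CT` each vanishing moment gains a factor `1 / z`. A Cauchy transform is `O(1 /
z)` anyway, so order `N` needs only `N - 1` moments. -/
lemma IsConc.isBigO_CT_of_moments (hμ : IsConc D μ) (N : ℕ) : ∀ {g : ℝ → ℂ} (_ : ContinuousOn g D)
    (_ : ∀ ν, ν + 1 < N → ∫ x, (x : ℂ) ^ ν * g x ∂μ = 0),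
    CT μ g =O[cobounded ℂ] fun z => 1 / z ^ N := by
  induction N with
  | zero =>
    intro g hg _
    simpa using (hμ.tendsto_CT hg).isBigO_one ℂ
  | succ N ih =>
    intro g hg h
    have h1 : (fun z => z * CT μ g z) =O[cobounded ℂ] fun z => 1 / z ^ N := by
      rcases Nat.eq_zero_or_pos N with rfl | hN
      · simpa using (hμ.tendsto_mul_CT hg).isBigO_one ℂ
      · have h2 := ih (continuousOn_ofReal_mul hg) fun ν hν => by
          rw [← h (ν + 1) (by omega)]
          simp only [pow_succ, mul_assoc]
        refine h2.congr' ?_ EventuallyEq.rfl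
        filter_upwards [eventually_mem_cdom hμ.isCompact] with z hz
        have h3 := h 0 (by omega)
        simp only [pow_zero, one_mul] at h3
        rw [hμ.mul_CT hg hz, h3, zero_add]
    refine ((isBigO_refl (fun z : ℂ => z⁻¹) _).mul h1).congr' ?_ ?_
    · filter_upwards [eventually_ne_cobounded (0 : ℂ)] with z hz
      rw [inv_mul_cancel_left₀ hz]
    · filter_upwards with z
      rw [pow_succ', one_div, one_div, mul_inv]

lemma IsConc.moments_of_isBigO_CT (hμ : IsConc D μ) (N : ℕ) : ∀ {g : ℝ → ℂ} (_ : ContinuousOn g D)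
    (_ : CT μ g =O[cobounded ℂ] fun z => 1 / z ^ N) (ν : ℕ), ν + 1 < N →
    ∫ x, (x : ℂ) ^ ν * g x ∂μ = 0 := by
  induction N with
  | zero => exact fun _ _ ν hν => absurd hν (by omega)
  | succ N ih =>
    intro g hg h ν hν
    have h1 : (fun z => z * CT μ g z) =O[cobounded ℂ] fun z => 1 / z ^ N := by
      refine ((isBigO_refl (fun z : ℂ => z) _).mul h).congr' EventuallyEq.rfl ?_
      filter_upwards [eventually_ne_cobounded (0 : ℂ)] with z hz
      rw [pow_succ]
      field_simp
    have h2 : Tendsto (fun z : ℂ => 1 / z ^ N) (cobounded ℂ) (𝓝 0) := by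
      have h3 : Tendsto (fun z : ℂ => (z⁻¹) ^ N) (cobounded ℂ) (𝓝 (0 ^ N)) :=
        tendsto_inv₀_cobounded.pow N
      rw [zero_pow (by omega)] at h3
      simpa using h3
    have h0 : ∫ x, g x ∂μ = 0 := tendsto_nhds_unique (hμ.tendsto_mul_CT hg) (h1.trans_tendsto h2)
    rcases ν with - | ν
    · simpa using h0
    · have h4 := ih (continuousOn_ofReal_mul hg) (h1.congr' (by
        filter_upwards [eventually_mem_cdom hμ.isCompact] with z hz
        rw [hμ.mul_CT hg hz, h0, zero_add]) EventuallyEq.rfl) ν (by omega)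
      rw [← h4]
      simp only [pow_succ, mul_assoc]

/-- The order of a function at infinity in terms of the moments of a measure. -/
lemma IsConc.exists_isBigO_iff (hμ : IsConc D μ) (hg : ContinuousOn g D) {c : ℂ} (hc : c ≠ 0)
    {F : ℂ → ℂ} {R : ℂ[X]} (hF : ∀ z ∈ cdom D, F z = c * (R.eval z + CT μ g z)) {N : ℕ}
    (hN : 1 ≤ N) :
    (∃ P : ℂ[X], (fun z => P.eval z + F z) =O[cobounded ℂ] fun z => 1 / z ^ N) ↔
      ∀ ν, ν + 1 < N → ∫ x, (x : ℂ) ^ ν * g x ∂μ = 0 := by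
  constructor
  · rintro ⟨P, hP⟩
    have h1 : (fun z => (C c⁻¹ * P + R).eval z + CT μ g z) =O[cobounded ℂ]
        fun z => 1 / z ^ N := by
      refine (hP.const_mul_left c⁻¹).congr' ?_ EventuallyEq.rfl
      filter_upwards [eventually_mem_cdom hμ.isCompact] with z hz
      rw [hF z hz]
      simp only [eval_add, eval_mul, eval_C]
      field_simp
      ring
    have h2 : Tendsto (fun z : ℂ => 1 / z ^ N) (cobounded ℂ) (𝓝 0) := by
      have h3 : Tendsto (fun z : ℂ => (z⁻¹) ^ N) (cobounded ℂ) (𝓝 (0 ^ N)) :=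
        tendsto_inv₀_cobounded.pow N
      rw [zero_pow (by omega)] at h3
      simpa using h3
    have h4 : C c⁻¹ * P + R = 0 := by
      refine eq_zero_of_tendsto_zero ?_
      simpa using (h1.trans_tendsto h2).sub (hμ.tendsto_CT hg)
    simp only [h4, eval_zero, zero_add] at h1
    exact hμ.moments_of_isBigO_CT N hg h1
  · intro h
    refine ⟨-(C c * R), ?_⟩
    refine ((hμ.isBigO_CT_of_moments N hg h).const_mul_left c).congr' ?_ EventuallyEq.rfl
    filter_upwards [eventually_mem_cdom hμ.isCompact] with z hz
    rw [hF z hz]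
    simp
    ring

end Moments

section Perfect

variable {m : ℕ} {D : Set ℝ} {μ : Measure ℝ} {ψ : Fin m → ℝ → ℂ} {f : Fin m → ℂ → ℂ} {c : ℂ}
  {n : Fin m → ℕ}

/-- The linear forms in the functions `ψ` have no unexpected orthogonality relations. -/
def HasIndependentMoments (μ : Measure ℝ) (ψ : Fin m → ℝ → ℂ) : Prop :=
  ∀ (n : Fin m → ℕ) (p : Fin m → ℂ[X]), (∀ j, (p j).degree < n j) →
    (∀ ν < size n, ∫ x : ℝ, (x : ℂ) ^ ν * ∑ j, (p j).eval (x : ℂ) * ψ j x ∂μ = 0) → p = 0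

/-- The polynomials with given coefficients. -/
noncomputable def polys (v : (Σ j, Fin (n j)) → ℂ) (j : Fin m) : ℂ[X] :=
  ∑ i : Fin (n j), C (v ⟨j, i⟩) * X ^ (i : ℕ)

lemma degree_polys (v : (Σ j, Fin (n j)) → ℂ) (j : Fin m) : (polys v j).degree < n j :=
  degree_sum_fin_lt fun i : Fin (n j) => v ⟨j, i⟩

lemma eq_zero_of_polys {v : (Σ j, Fin (n j)) → ℂ} (h : polys v = 0) : v = 0 := by
  funext ⟨j, i⟩
  have h1 := congrArg (fun p => coeff p (i : ℕ)) (congrFun h j)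
  simp only [polys, finsetSum_coeff, coeff_C_mul_X_pow, Pi.zero_apply, coeff_zero] at h1
  rw [Finset.sum_eq_single i (fun b _ hb => if_neg fun h => hb (Fin.ext h.symm)) (by simp),
    if_pos rfl] at h1
  exact h1

lemma integral_pow_mul_polys (hμ : IsConc D μ) (hψ : ∀ j, ContinuousOn (ψ j) D)
    (v : (Σ j, Fin (n j)) → ℂ) (ν : ℕ) :
    ∫ x : ℝ, (x : ℂ) ^ ν * ∑ j, (polys v j).eval (x : ℂ) * ψ j x ∂μ
      = ∑ a : Σ j, Fin (n j), v a * ∫ x : ℝ, (x : ℂ) ^ (ν + (a.2 : ℕ)) * ψ a.1 x ∂μ := by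
  have hx : ∀ t : ℕ, ContinuousOn (fun x : ℝ => (x : ℂ) ^ t) D := fun t =>
    (Complex.continuous_ofReal.pow t).continuousOn
  simp only [← integral_const_mul]
  rw [← integral_finsetSum]
  · congr 1
    funext x
    rw [Fintype.sum_sigma, Finset.mul_sum]
    refine Finset.sum_congr rfl fun j _ => ?_
    simp only [polys, eval_finsetSum, eval_mul, eval_C, eval_pow, eval_X, Finset.sum_mul,
      Finset.mul_sum]
    refine Finset.sum_congr rfl fun i _ => ?_
    rw [pow_add]
    ring
  · exact fun a _ => (hμ.integrable ((hx _).fun_mul (hψ a.1))).const_mul _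

lemma integral_pow_mul_eval (hμ : IsConc D μ) (hψ : ∀ j, ContinuousOn (ψ j) D) (j : Fin m)
    (ν : ℕ) {Q : ℂ[X]} {N : ℕ} (hQ : Q.natDegree < N) :
    ∫ x : ℝ, (x : ℂ) ^ ν * (Q.eval (x : ℂ) * ψ j x) ∂μ
      = ∑ t : Fin N, (∫ x : ℝ, (x : ℂ) ^ ((t : ℕ) + ν) * ψ j x ∂μ) * Q.coeff t := by
  have hx : ∀ t : ℕ, ContinuousOn (fun x : ℝ => (x : ℂ) ^ t) D := fun t =>
    (Complex.continuous_ofReal.pow t).continuousOn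
  simp only [← integral_mul_const]
  rw [← integral_finsetSum]
  · congr 1
    funext x
    rw [eval_eq_sum_range' hQ, Finset.sum_range, Finset.sum_mul, Finset.mul_sum]
    refine Finset.sum_congr rfl fun i _ => ?_
    rw [pow_add]
    ring
  · exact fun a _ => (hμ.integrable ((hx _).fun_mul (hψ j))).mul_const _

lemma exists_mulVec_eq_zero {ι κ : Type*} [Fintype ι] [Fintype κ] (A : Matrix ι κ ℂ)
    (h : Fintype.card ι < Fintype.card κ) : ∃ v ≠ 0, A.mulVec v = 0 := by
  have h1 := LinearMap.ker_ne_bot_of_finrank_lt (f := A.mulVecLin) (by simpa using h)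
  obtain ⟨v, hv, hv0⟩ := Submodule.exists_mem_ne_zero_of_ne_bot h1
  exact ⟨v, hv0, by simpa using hv⟩

lemma card_sigma_fin (n : Fin m → ℕ) : Fintype.card (Σ j, Fin (n j)) = size n := by
  simp [size]

lemma deg_of_ne_zero {p : ℂ[X]} (hp : p ≠ 0) : deg p = p.natDegree := if_neg hp

lemma deg_le_sub_one_iff {p : ℂ[X]} {a : ℕ} : deg p ≤ (a : ℤ) - 1 ↔ p.degree < a := by
  by_cases hp : p = 0
  · simp [deg, hp]
    omega
  · rw [deg_of_ne_zero hp, degree_eq_natDegree hp, Nat.cast_lt]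
    omega

lemma size_pos (hn : n ≠ 0) : 1 ≤ size n := by
  obtain ⟨j, hj⟩ := Function.ne_iff.1 hn
  exact (Nat.one_le_iff_ne_zero.2 hj).trans (Finset.single_le_sum (fun _ _ => Nat.zero_le _)
    (Finset.mem_univ j))

lemma typeI_iff (hμ : IsConc D μ) (hψ : ∀ j, ContinuousOn (ψ j) D) (hc : c ≠ 0)
    (hf : ∀ j, ∀ z ∈ cdom D, f j z = c * CT μ (ψ j) z) {N : ℕ} (hN : 1 ≤ N) (a : Fin m → ℂ[X]) :
    (∃ a₀ : ℂ[X], (fun z => a₀.eval z + ∑ j, (a j).eval z * f j z) =O[cobounded ℂ]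
      fun z => 1 / z ^ N) ↔
    ∀ ν, ν + 1 < N → ∫ x : ℝ, (x : ℂ) ^ ν * ∑ j, (a j).eval (x : ℂ) * ψ j x ∂μ = 0 := by
  have hcont : ∀ j, ContinuousOn (fun x : ℝ => (a j).eval (x : ℂ) * ψ j x) D := fun j =>
    (continuousOn_eval _ _).fun_mul (hψ j)
  choose Q hQ using fun j => hμ.exists_poly_mul_CT (hψ j) (a j)
  refine hμ.exists_isBigO_iff (continuousOn_finsetSum _ fun j _ => hcont j) hc (R := ∑ j, Q j)
    (fun z hz => ?_) hN
  rw [hμ.CT_sum _ (fun j _ => hcont j) hz, eval_finsetSum, ← Finset.sum_add_distrib, Finset.mul_sum]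
  refine Finset.sum_congr rfl fun j _ => ?_
  rw [hf j z hz]
  linear_combination c * hQ j z hz

lemma typeII_iff (hμ : IsConc D μ) (hψ : ∀ j, ContinuousOn (ψ j) D) (hc : c ≠ 0)
    (hf : ∀ j, ∀ z ∈ cdom D, f j z = c * CT μ (ψ j) z) (j : Fin m) (Q : ℂ[X]) (a : ℕ) :
    (∃ P : ℂ[X], (fun z => Q.eval z * f j z - P.eval z) =O[cobounded ℂ]
      fun z => 1 / z ^ (a + 1)) ↔
    ∀ ν < a, ∫ x : ℝ, (x : ℂ) ^ ν * (Q.eval (x : ℂ) * ψ j x) ∂μ = 0 := by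
  have hcont : ContinuousOn (fun x : ℝ => Q.eval (x : ℂ) * ψ j x) D :=
    (continuousOn_eval _ _).fun_mul (hψ j)
  obtain ⟨R, hR⟩ := hμ.exists_poly_mul_CT (hψ j) Q
  have h := hμ.exists_isBigO_iff hcont hc (F := fun z => Q.eval z * f j z) (R := R)
    (fun z hz => by
      rw [hf j z hz]
      linear_combination c * hR z hz) (Nat.le_add_left 1 a)
  simp only [add_lt_add_iff_right] at h
  rw [← h]
  constructor
  · rintro ⟨P, hP⟩
    exact ⟨-P, by simpa [sub_eq_neg_add] using hP⟩
  · rintro ⟨P, hP⟩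
    exact ⟨-P, by simpa [add_comm] using hP⟩

/-- Existence: `|n| - 1` homogeneous moment equations in `|n|` coefficients. If some degree dropped,
the form would fit the index with `n j` lowered by one, whose size is `|n| - 1`, and its vanishing
moments would force it to be zero. -/
theorem isPerfectTypeI_of_moments (hμ : IsConc D μ) (hψ : ∀ j, ContinuousOn (ψ j) D) (hc : c ≠ 0)
    (hf : ∀ j, ∀ z ∈ cdom D, f j z = c * CT μ (ψ j) z) (hind : HasIndependentMoments μ ψ) :
    IsPerfectTypeI f := by
  intro n hn
  have hN := size_pos hn
  constructor
  · obtain ⟨v, hv, hv0⟩ := exists_mulVec_eq_zero (Matrix.of fun (ν : Fin (size n - 1))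
      (a : Σ j, Fin (n j)) => ∫ x : ℝ, (x : ℂ) ^ ((ν : ℕ) + (a.2 : ℕ)) * ψ a.1 x ∂μ) (by
        rw [card_sigma_fin, Fintype.card_fin]
        omega)
    refine ⟨polys v, fun h => hv (eq_zero_of_polys h),
      fun j => deg_le_sub_one_iff.2 (degree_polys v j),
      (typeI_iff hμ hψ hc hf hN _).2 fun ν hν => ?_⟩
    rw [integral_pow_mul_polys hμ hψ]
    have h1 := congrFun hv0 ⟨ν, by omega⟩
    simp only [Matrix.mulVec, dotProduct, Matrix.of_apply, Pi.zero_apply] at h1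
    rw [← h1]
    exact Finset.sum_congr rfl fun a _ => mul_comm _ _
  · intro a ha j
    have hmom := (typeI_iff hμ hψ hc hf hN a).1 ha.isBigO
    by_contra hne
    have hlt : deg (a j) < (n j : ℤ) - 1 := lt_of_le_of_ne (ha.deg_le j) hne
    -- Needed for the truncated `n j - 1`: as `deg` is at least `-1`, a drop in degree is impossible
    -- for `n j = 0`.
    have hnj : 1 ≤ n j := by
      have : -1 ≤ deg (a j) := by
        rw [deg]
        split_ifs <;> omega
      omega
    refine ha.ne_zero (hind (Function.update n j (n j - 1)) a (fun k => ?_) fun ν hν => hmom ν ?_)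
    · rw [← deg_le_sub_one_iff]
      rcases eq_or_ne k j with rfl | hk
      · rw [Function.update_self]
        omega
      · rw [Function.update_of_ne hk]
        exact ha.deg_le k
    · have h1 : size (Function.update n j (n j - 1)) + 1 = size n := by
        rw [size, size, Finset.sum_update_of_mem (Finset.mem_univ j),
          ← Finset.add_sum_erase _ _ (Finset.mem_univ j), Finset.sdiff_singleton_eq_erase]
        omega
      omega

/-- Existence: `|n|` equations in `|n| + 1` coefficients. A `Q` of smaller degree lies in the kernel
of the square moment matrix. The transposed matrix then has a kernel too, which is a nonzero type I
form with `|n|` vanishing moments, against independence. -/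
theorem isPerfectTypeII_of_moments (hμ : IsConc D μ) (hψ : ∀ j, ContinuousOn (ψ j) D) (hc : c ≠ 0)
    (hf : ∀ j, ∀ z ∈ cdom D, f j z = c * CT μ (ψ j) z) (hind : HasIndependentMoments μ ψ) :
    IsPerfectTypeII f := by
  intro n hn
  constructor
  · obtain ⟨q, hq, hq0⟩ := exists_mulVec_eq_zero (Matrix.of fun (a : Σ j, Fin (n j))
      (t : Fin (size n + 1)) => ∫ x : ℝ, (x : ℂ) ^ ((t : ℕ) + (a.2 : ℕ)) * ψ a.1 x ∂μ) (by
        rw [card_sigma_fin, Fintype.card_fin]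
        omega)
    set Q : ℂ[X] := ∑ t : Fin (size n + 1), C (q t) * X ^ (t : ℕ) with hQ
    have hcoeff : ∀ t : Fin (size n + 1), Q.coeff t = q t := fun t => by
      simp only [hQ, finsetSum_coeff, coeff_C_mul_X_pow]
      rw [Finset.sum_eq_single t (fun b _ hb => if_neg fun h => hb (Fin.ext h.symm)) (by simp),
        if_pos rfl]
    have hQ0 : Q ≠ 0 := fun h => hq (by
      funext t
      rw [← hcoeff t, h, coeff_zero, Pi.zero_apply])
    have hdeg : Q.natDegree < size n + 1 :=
      (natDegree_lt_iff_degree_lt hQ0).2 (degree_sum_fin_lt q)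
    refine ⟨Q, hQ0, ?_, fun j => (typeII_iff hμ hψ hc hf j Q (n j)).2 fun ν hν => ?_⟩
    · rw [deg_of_ne_zero hQ0]
      omega
    · rw [integral_pow_mul_eval hμ hψ j ν hdeg]
      have h1 := congrFun hq0 ⟨j, ν, hν⟩
      simp only [Matrix.mulVec, dotProduct, Matrix.of_apply, Pi.zero_apply] at h1
      rw [← h1]
      exact Finset.sum_congr rfl fun t _ => by rw [hcoeff]
  · intro Q hQ
    by_contra hne
    have hlt : deg Q < size n := lt_of_le_of_ne hQ.deg_le hne
    rw [deg_of_ne_zero hQ.ne_zero, Nat.cast_lt] at hlt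
    let e : Fin (size n) ≃ Σ j, Fin (n j) := Fintype.equivOfCardEq (by rw [Fintype.card_fin, card_sigma_fin])
    set B : Matrix (Σ j, Fin (n j)) (Σ j, Fin (n j)) ℂ := Matrix.of fun a b =>
      ∫ x : ℝ, (x : ℂ) ^ ((e.symm b : ℕ) + (a.2 : ℕ)) * ψ a.1 x ∂μ with hB
    have hdet : B.det = 0 := by
      refine Matrix.exists_mulVec_eq_zero_iff.1 ⟨fun b => Q.coeff (e.symm b), fun h => ?_, ?_⟩
      · have h1 := congrFun h (e ⟨Q.natDegree, hlt⟩)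
        simp only [Equiv.symm_apply_apply, Pi.zero_apply, coeff_natDegree,
          leadingCoeff_eq_zero] at h1
        exact hQ.ne_zero h1
      · funext a
        have h1 := (typeII_iff hμ hψ hc hf a.1 Q (n a.1)).1 (hQ.isBigO a.1) a.2 a.2.2
        rw [integral_pow_mul_eval hμ hψ a.1 a.2 hlt] at h1
        rw [Pi.zero_apply, ← h1]
        simp only [Matrix.mulVec, dotProduct, hB, Matrix.of_apply]
        exact (e.sum_comp _).symm.trans (by simp)
    obtain ⟨v, hv, hv0⟩ := Matrix.exists_vecMul_eq_zero_iff.2 hdet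
    refine hv (eq_zero_of_polys (hind n (polys v) (degree_polys v) fun ν hν => ?_))
    rw [integral_pow_mul_polys hμ hψ]
    have h1 := congrFun hv0 (e ⟨ν, hν⟩)
    simpa [Matrix.vecMul, dotProduct, hB] using h1

end Perfect

end

/-! ### Signed measures of constant sign and their products -/

section

open Filter Topology Bornology

variable {K K' : Set ℝ} {α β : SignedMeasure ℝ} {μ : Measure ℝ} {c : ℝ} {z : ℂ}

/-- `α` is up to a sign a positive measure on the interval `K`, not concentrated on a finite set. -/
def IsSigned (K : Set ℝ) (α : SignedMeasure ℝ) : Prop :=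
  ∃ (c : ℝ) (μ : Measure ℝ) (_ : IsFiniteMeasure μ), (c = 1 ∨ c = -1) ∧ IsGen K μ ∧
    α = c • μ.toSignedMeasure

lemma isCompact_convexHull_real {S : Set ℝ} (hS : IsCompact S) (hne : S.Nonempty) :
    IsCompact (convexHull ℝ S) := by
  have h : convexHull ℝ S = Set.Icc (sInf S) (sSup S) := by
    refine (convexHull_min (t := Set.Icc (sInf S) (sSup S))
      (fun x hx => ⟨csInf_le hS.bddBelow hx, le_csSup hS.bddAbove hx⟩)
      (convex_Icc _ _)).antisymm ?_
    exact (convex_convexHull ℝ S).ordConnected.out (subset_convexHull ℝ S (hS.sInf_mem hne))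
      (subset_convexHull ℝ S (hS.sSup_mem hne))
  rw [h]
  exact isCompact_Icc

/-- A finite set carrying `μ` is closed, hence would contain the infinite support. -/
lemma isGen_convexHull_support [IsFiniteMeasure μ] (hc : IsCompact μ.support)
    (hinf : μ.support.Infinite) : IsGen (convexHull ℝ μ.support) μ where
  isCompact := isCompact_convexHull_real hc hinf.nonempty
  isFinite := inferInstance
  null := measure_mono_null (Set.compl_subset_compl.2 (subset_convexHull ℝ _))
    Measure.measure_compl_support
  convex := convex_convexHull ℝ _
  infinite _ hZ h := hinf (hZ.subset (Measure.support_subset_of_isClosed hZ.isClosed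
    (mem_ae_iff.2 h)))

lemma exists_eq_toSignedMeasure (h : 0 ≤ α) :
    ∃ (μ : Measure ℝ) (_ : IsFiniteMeasure μ), α = μ.toSignedMeasure := by
  have h' := (VectorMeasure.le_restrict_univ_iff_le _ _).2 h
  refine ⟨α.toMeasureOfZeroLE Set.univ MeasurableSet.univ h', inferInstance, ?_⟩
  exact (SignedMeasure.toMeasureOfZeroLE_toSignedMeasure α h').symm

lemma IsAdmissible.isSigned (h : IsAdmissible α) : IsSigned (hull α) α := by
  have hc := h.isCompact_supp
  have hi := h.infinite_supp
  rcases h.constant_sign with h0 | h0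
  · obtain ⟨μ, _, rfl⟩ := exists_eq_toSignedMeasure h0
    rw [supp, Measure.variation_toSignedMeasure] at hc hi
    refine ⟨1, μ, inferInstance, Or.inl rfl, ?_, by simp⟩
    rw [hull, supp, Measure.variation_toSignedMeasure]
    exact isGen_convexHull_support hc hi
  · obtain ⟨μ, _, hμ⟩ := exists_eq_toSignedMeasure (neg_nonneg.2 h0)
    have hv : α.variation = μ := by
      rw [← VectorMeasure.variation_neg, hμ, Measure.variation_toSignedMeasure]
    rw [supp, hv] at hc hi
    refine ⟨-1, μ, inferInstance, Or.inr rfl, ?_, by rw [← hμ]; simp⟩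
    rw [hull, supp, hv]
    exact isGen_convexHull_support hc hi

lemma cauchy_smul_toSignedMeasure [IsFiniteMeasure μ] (c : ℝ) (z : ℂ) :
    cauchy (c • μ.toSignedMeasure) z = c * CT μ (fun _ => 1) z := by
  rw [cauchy, VectorMeasure.integral_smul_vectorMeasure, VectorMeasure.integral_toSignedMeasure,
    Complex.real_smul, CT]

lemma cauchyReal_eq (hα : IsSigned K α) (y : ℝ) : (cauchyReal α y : ℂ) = cauchy α y := by
  obtain ⟨c, μ, _, -, -, rfl⟩ := hα
  rw [cauchy_smul_toSignedMeasure, cauchyReal, VectorMeasure.integral_smul_vectorMeasure,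
    VectorMeasure.integral_toSignedMeasure, smul_eq_mul, Complex.ofReal_mul, CT,
    ← integral_complex_ofReal]
  push_cast
  rfl

lemma IsSigned.isReg_cauchy (hα : IsSigned K α) : IsReg K 1 (cauchy α) := by
  obtain ⟨c, μ, _, hc, hμ, rfl⟩ := hα
  have h := (hμ.isReg_CT (g := fun _ => 1) continuousOn_const (by simp) (by simp)).const_mul
    (c := c) (Complex.ofReal_im c) (Complex.ofReal_ne_zero.2 (by rcases hc with rfl | rfl <;> simp))
  exact h.congr hμ.isCompact fun z _ => cauchy_smul_toSignedMeasure c z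

lemma withDensity_smul_toSignedMeasure [IsFiniteMeasure μ] (hμ : IsConc K μ) (c : ℝ) {w : ℝ → ℝ}
    (hw : ContinuousOn w K) {ε : ℝ} (hε : ε * ε = 1) (hpos : ∀ x ∈ K, 0 < ε * w x)
    [IsFiniteMeasure (wdens μ fun x => ε * w x)] :
    (c • μ.toSignedMeasure).withDensity w (ContinuousLinearMap.lsmul ℝ ℝ).flip
      = (c * ε) • (wdens μ fun x => ε * w x).toSignedMeasure := by
  have hint : Integrable w μ := hμ.integrable hw
  have hv : (c • μ.toSignedMeasure).Integrable w := by
    rw [VectorMeasure.Integrable, VectorMeasure.variation_smul, Measure.variation_toSignedMeasure]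
    exact hint.smul_measure (by simp)
  ext s hs
  rw [VectorMeasure.withDensity_apply hv, VectorMeasure.restrict_smul,
    VectorMeasure.integral_smul_vectorMeasure, VectorMeasure.setIntegral_toSignedMeasure hs]
  have h1 : (wdens μ fun x => ε * w x).real s = ε * ∫ x in s, w x ∂μ := by
    rw [← integral_const_mul, integral_eq_lintegral_of_nonneg_ae, wdens, measureReal_def,
      withDensity_apply _ hs]
    · exact ae_restrict_of_ae (hμ.ae_mem.mono fun x hx => (hpos x hx).le)
    · exact (hint.const_mul ε).aestronglyMeasurable.restrict
  rw [FunLike.coe_smul, Pi.smul_apply, Measure.toSignedMeasure_apply_measurable hs, h1,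
    smul_eq_mul, smul_eq_mul]
  linear_combination (-(c * ∫ x in s, w x ∂μ)) * hε

/-- On the interval `K`, disjoint from `K'`, the function `β̂` is real, continuous and without
zeros, so it has a constant sign `ε`; the product is `c ε` times the positive measure `ε β̂ dμ`. -/
lemma prod_smul_toSignedMeasure [IsFiniteMeasure μ] (hμ : IsGen K μ) (hc : c = 1 ∨ c = -1)
    (hβ : IsSigned K' β) (hd : Disjoint K K') :
    IsSigned K (prod (c • μ.toSignedMeasure) β) ∧
      ∀ z, cauchy (prod (c • μ.toSignedMeasure) β) z = c * CT μ (fun x => cauchy β x) z := by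
  have hreg := hβ.isReg_cauchy
  have hre : ∀ x : ℝ, (cauchy β x).re = cauchyReal β x := fun x => by
    rw [← cauchyReal_eq hβ, Complex.ofReal_re]
  have hw : ContinuousOn (cauchyReal β) K :=
    (Complex.continuous_re.comp_continuousOn (hreg.continuousOn_ofReal hd)).congr
      fun x _ => (hre x).symm
  have hw0 : ∀ x ∈ K, cauchyReal β x ≠ 0 := fun x hx h => by
    refine hreg.ne x (ofReal_mem_cdom (Set.disjoint_left.1 hd hx)) ?_
    rw [← cauchyReal_eq hβ, h, Complex.ofReal_zero]
  obtain ⟨ε, hε, hpos⟩ : ∃ ε : ℝ, (ε = 1 ∨ ε = -1) ∧ ∀ x ∈ K, 0 < ε * cauchyReal β x := by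
    rcases sign_const hμ.convex hw hw0 with h | h
    · exact ⟨1, Or.inl rfl, fun x hx => by simpa using h x hx⟩
    · exact ⟨-1, Or.inr rfl, fun x hx => by simpa using h x hx⟩
  have hεε : ε * ε = 1 := by rcases hε with rfl | rfl <;> norm_num
  have hwε : ContinuousOn (fun x => ε * cauchyReal β x) K := continuousOn_const.mul hw
  have hgen := hμ.wd hwε hpos
  have := hgen.isFinite
  have e := withDensity_smul_toSignedMeasure hμ.toIsConc c hw hεε hpos
  refine ⟨⟨c * ε, _, this, ?_, hgen, e⟩, fun z => ?_⟩
  · rcases hc with rfl | rfl <;> rcases hε with rfl | rfl <;> simp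
  · rw [prod, e, cauchy_smul_toSignedMeasure, hμ.toIsConc.CT_wd hwε fun x hx => (hpos x hx).le]
    simp only [mul_one, ← cauchyReal_eq hβ]
    push_cast
    rw [CT_const_mul]
    have h2 : (ε : ℂ) * ε = 1 := by exact_mod_cast hεε
    linear_combination c * CT μ (fun x => (cauchyReal β x : ℂ)) z * h2

end

/-! ### The chain of iterated products and the conclusion -/

section

open Filter Topology Bornology

section Chain

variable {m : ℕ} {σ : ℕ → SignedMeasure ℝ} {D : ℕ → Set ℝ} {c : ℕ → ℝ} {μ : ℕ → Measure ℝ}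

/-- The Cauchy transforms of the iterated products `⟨σ_{i + 1}, …, σ_k⟩` (and `1` for `k = i`). -/
noncomputable def chainCauchy (σ : ℕ → SignedMeasure ℝ) (i k : ℕ) : ℂ → ℂ :=
  if i < k then cauchy (iterProd ((List.range' (i + 1) (k - i)).map σ)) else fun _ => 1

/-- The outermost bracket is unrolled. The two claims go together: each inner product must be a
measure of constant sign on the hull of its own first generator before the next bracket can be
evaluated. -/
lemma isSigned_iterProd (hσ : ∀ l, 1 ≤ l → l ≤ m → ∃ _ : IsFiniteMeasure (μ l),
    (c l = 1 ∨ c l = -1) ∧ IsGen (D l) (μ l) ∧ σ l = c l • (μ l).toSignedMeasure)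
    (hd : ∀ l, Disjoint (D l) (D (l + 1))) (n : ℕ) : ∀ i, i + n + 1 ≤ m →
    IsSigned (D (i + 1)) (iterProd ((List.range' (i + 1) (n + 1)).map σ)) ∧
      ∀ z, cauchy (iterProd ((List.range' (i + 1) (n + 1)).map σ)) z
        = c (i + 1) * CT (μ (i + 1)) (fun x => chainCauchy σ (i + 1) (i + 1 + n) x) z := by
  induction n with
  | zero =>
    intro i hi
    obtain ⟨_, hc, hμ, hs⟩ := hσ (i + 1) (by omega) (by omega)
    have h1 : iterProd ((List.range' (i + 1) (0 + 1)).map σ) = σ (i + 1) := rfl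
    rw [h1, hs]
    refine ⟨⟨_, _, _, hc, hμ, rfl⟩, fun z => ?_⟩
    rw [cauchy_smul_toSignedMeasure]
    simp [chainCauchy]
  | succ n ih =>
    intro i hi
    obtain ⟨_, hc, hμ, hs⟩ := hσ (i + 1) (by omega) (by omega)
    obtain ⟨h2, -⟩ := ih (i + 1) (by omega)
    have h1 : iterProd ((List.range' (i + 1) (n + 1 + 1)).map σ)
        = prod (σ (i + 1)) (iterProd ((List.range' (i + 1 + 1) (n + 1)).map σ)) := rfl
    rw [h1, hs]
    obtain ⟨h3, h4⟩ := prod_smul_toSignedMeasure hμ hc h2 (hd (i + 1))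
    refine ⟨h3, fun z => ?_⟩
    rw [h4, chainCauchy, if_pos (by omega), Nat.add_sub_cancel_left]

lemma chainCauchy_eq (hσ : ∀ l, 1 ≤ l → l ≤ m → ∃ _ : IsFiniteMeasure (μ l),
    (c l = 1 ∨ c l = -1) ∧ IsGen (D l) (μ l) ∧ σ l = c l • (μ l).toSignedMeasure)
    (hd : ∀ l, Disjoint (D l) (D (l + 1))) {i k : ℕ} (hik : i < k) (hk : k ≤ m) (z : ℂ) :
    chainCauchy σ i k z = c (i + 1) * CT (μ (i + 1)) (fun x => chainCauchy σ (i + 1) k x) z := by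
  obtain ⟨n, rfl⟩ : ∃ n, k = i + 1 + n := ⟨k - (i + 1), by omega⟩
  rw [chainCauchy, if_pos hik, show i + 1 + n - i = n + 1 by omega]
  exact (isSigned_iterProd hσ hd n i (by omega)).2 z

end Chain

variable {m : ℕ}

/-- The family `F`, numbered from `1` to `m` and extended by zero. -/
def ofFin {M : Type*} [Zero M] (F : Fin m → M) (l : ℕ) : M :=
  if h : 1 ≤ l ∧ l ≤ m then F ⟨l - 1, by omega⟩ else 0

lemma ofFin_succ {M : Type*} [Zero M] (F : Fin m → M) (j : Fin m) : ofFin F (j + 1) = F j := by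
  rw [ofFin, dif_pos ⟨by omega, by omega⟩]
  rfl

lemma exists_eq_succ {l : ℕ} (h : l ∈ Finset.Icc 1 m) : ∃ j : Fin m, l = j + 1 := by
  rw [Finset.mem_Icc] at h
  exact ⟨⟨l - 1, by omega⟩, by simp; omega⟩

lemma ofFin_cases {M : Type*} [Zero M] (F : Fin m → M) (l : ℕ) :
    (∃ j : Fin m, l = j + 1 ∧ ofFin F l = F j) ∨ ¬ (1 ≤ l ∧ l ≤ m) ∧ ofFin F l = 0 := by
  by_cases h : 1 ≤ l ∧ l ≤ m
  · obtain ⟨j, rfl⟩ := exists_eq_succ (Finset.mem_Icc.2 h)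
    exact Or.inl ⟨j, rfl, ofFin_succ F j⟩
  · exact Or.inr ⟨h, dif_neg h⟩

lemma sum_Icc_eq_sum_fin {M : Type*} [AddCommMonoid M] (F : ℕ → M) :
    ∑ k ∈ Finset.Icc 1 m, F k = ∑ j : Fin m, F (j + 1) := by
  rw [Finset.sum_fin_eq_sum_range, ← Finset.Ico_add_one_right_eq_Icc, Finset.sum_Ico_eq_sum_range]
  refine Finset.sum_congr rfl fun i hi => ?_
  rw [dif_pos (Finset.mem_range.1 hi), add_comm]

lemma hull_zero : hull 0 = ∅ := by
  simp [hull, supp]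

/-- Outside the range `1, …, m` the measure is zero and its hull is empty. -/
lemma IsNikishinGenerator.disjoint_hull {σ : Fin m → SignedMeasure ℝ}
    (hσ : IsNikishinGenerator σ) (l : ℕ) :
    Disjoint (hull (ofFin σ l)) (hull (ofFin σ (l + 1))) := by
  rcases ofFin_cases σ l with ⟨i, hi, ei⟩ | ⟨-, e⟩
  · rcases ofFin_cases σ (l + 1) with ⟨j, hj, ej⟩ | ⟨-, e⟩
    · rw [ei, ej]
      exact Set.disjoint_iff_inter_eq_empty.2 (hσ.disjoint i j (by omega))
    · simp [e, hull_zero]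
  · simp [e, hull_zero]

lemma nikishin_eq (σ : Fin m → SignedMeasure ℝ) (j : Fin m) :
    cauchy (nikishin σ j) = chainCauchy (ofFin σ) 0 (j + 1) := by
  rw [chainCauchy, if_pos (by omega), nikishin]
  congr 2
  refine List.ext_getElem (by simp) fun i h1 h2 => ?_
  simp only [List.length_map, List.length_range'] at h2
  have hi : i < m := by omega
  have h3 := ofFin_succ σ ⟨i, hi⟩
  simp [← h3, add_comm]

lemma IsNikishinGenerator.isPerfect {σ : Fin m → SignedMeasure ℝ} (hσ : IsNikishinGenerator σ) :
    IsPerfectTypeI (fun j => cauchy (nikishin σ j)) ∧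
      IsPerfectTypeII (fun j => cauchy (nikishin σ j)) := by
  rcases Nat.eq_zero_or_pos m with rfl | hm
  · exact ⟨fun n hn => absurd (Subsingleton.elim _ _) hn,
      fun n hn => absurd (Subsingleton.elim _ _) hn⟩
  set D : ℕ → Set ℝ := fun l => hull (ofFin σ l) with hD
  have hd : ∀ l, Disjoint (D l) (D (l + 1)) := hσ.disjoint_hull
  have hex : ∀ l, ∃ (c : ℝ) (μ : Measure ℝ), (c = 1 ∨ c = -1) ∧ (1 ≤ l → l ≤ m →
      ∃ _ : IsFiniteMeasure μ, (c = 1 ∨ c = -1) ∧ IsGen (D l) μ ∧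
        ofFin σ l = c • μ.toSignedMeasure) := fun l => by
    rcases ofFin_cases σ l with ⟨i, -, ei⟩ | ⟨h, -⟩
    · obtain ⟨c, μ, hfin, hc, hμ, e⟩ := (hσ.admissible i).isSigned
      refine ⟨c, μ, hc, fun _ _ => ⟨hfin, hc, ?_, by rw [ei, e]⟩⟩
      simpa only [hD, ei] using hμ
    · exact ⟨1, 0, Or.inl rfl, fun h1 h2 => absurd ⟨h1, h2⟩ h⟩
  choose c μ hc hμ using hex
  have hcomp : ∀ l, IsCompact (D l) := fun l => by
    rcases ofFin_cases σ l with ⟨i, hi, ei⟩ | ⟨-, e⟩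
    · obtain ⟨_, -, h, -⟩ := hμ l (by omega) (by omega)
      exact h.isCompact
    · simp [hD, e, hull_zero]
  have hc0 : ∀ l, c l ≠ 0 := fun l => by rcases hc l with h | h <;> simp [h]
  -- The signs in the family are `s = -c`: in `Family.rep` with `S = ∅` and `l = i`, moving `k` past
  -- `i` costs a sign, so the recursion for the Cauchy transforms carries the factor `-s = c`.
  have hs : ∀ l, -c l ≠ 0 := fun l => neg_ne_zero.2 (hc0 l)
  obtain ⟨φ, ω, hfam, hφ⟩ := exists_family (m := m) (s := fun l => -c l) hcomp hd hs
    (fun l h1 h2 => (hμ l h1.le h2).2.2.1) (Φ := chainCauchy (ofFin σ))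
    (fun i z => by simp [chainCauchy])
    (fun i k z hik hk => by simpa using chainCauchy_eq hμ hd hik hk z) hm
  have hgen : IsGen (D 1) (μ 1) := (hμ 1 le_rfl hm).2.2.1
  have hmem : ∀ j : Fin m, (j : ℕ) + 1 ∈ Finset.Icc 1 m := fun j =>
    Finset.mem_Icc.2 ⟨by omega, by omega⟩
  have hψ : ∀ j : Fin m, ContinuousOn (fun x : ℝ => φ {(j : ℕ) + 1} x) (D 1) := fun j =>
    (hfam.isReg_singleton (hmem j)).continuousOn_ofReal (hd 1)
  have hf : ∀ j : Fin m, ∀ z ∈ cdom (D 1), cauchy (nikishin σ j) z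
      = c 1 * CT (μ 1) (fun x : ℝ => φ {(j : ℕ) + 1} x) z := fun j z _ => by
    rw [nikishin_eq, chainCauchy_eq hμ hd (by omega) (by omega)]
    congr 1
    refine hgen.toIsConc.CT_congr (fun x hx => ?_) z
    exact (hφ _ (hmem j) x (ofReal_mem_cdom (Set.disjoint_left.1 (hd 1) hx))).symm
  have hind : HasIndependentMoments (μ 1) fun (j : Fin m) (x : ℝ) => φ {(j : ℕ) + 1} x := by
    intro n p hp h0
    have h1 := hfam.eq_zero_of_moments hcomp hd hs hgen (p := ofFin p) (n := ofFin n)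
      (fun k hk => by
        obtain ⟨j, rfl⟩ := exists_eq_succ hk
        simpa only [ofFin_succ] using hp j)
      (by
        simp only [sum_Icc_eq_sum_fin, ofFin_succ]
        exact h0)
    funext j
    simpa only [ofFin_succ, Pi.zero_apply] using h1 _ (hmem j)
  exact ⟨isPerfectTypeI_of_moments hgen.toIsConc hψ (Complex.ofReal_ne_zero.2 (hc0 1)) hf hind,
    isPerfectTypeII_of_moments hgen.toIsConc hψ (Complex.ofReal_ne_zero.2 (hc0 1)) hf hind⟩

end

end HermitePade

theorem theorem2 {m : ℕ} (σ : Fin m → MeasureTheory.SignedMeasure ℝ)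
    (hσ : HermitePade.IsNikishinGenerator σ) :
    HermitePade.IsPerfectTypeI (fun j => HermitePade.cauchy (HermitePade.nikishin σ j)) ∧
      HermitePade.IsPerfectTypeII (fun j => HermitePade.cauchy (HermitePade.nikishin σ j)) :=
  hσ.isPerfect
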